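/- Let $d\in\{2,3\}$ and let $K\subset\mathbb R^d$ be a polygon ($d=2$) or polyhedron ($d=3$) with $n$ edges/faces: a bounded connected open set whose boundary is the union of the closures of $n$ pairwise disjoint relatively open flat faces $e$ (open segments for $d=2$, plane polygonal regions for $d=3$), such that $K$ lies locally on one side of each face; every simple polygon and every simple polyhedron is of this kind. Let $\mathbf n$ be the outward unit normal, and for $D=K$ or $D=e$ let $|D|$, $x_D$, $h_D$ be the measure, the center of gravity and the diameter of $D$. For an integer $k\ge 1$ put $$V_h^k(K)=\Big\{v\in H^1(K):\ \tfrac{\partial v}{\partial \mathbf n}\Big|_e\in\mathbb P^{k-1}(e)\ \text{for every face } e\subset\partial K,\ \ \Delta v\in\mathbb P^{k-2}(K)\Big\},$$ where $\mathbb P^{\ell}(D)$ is the space of polynomials of degree at most $\ell$ on $D$, $\mathbb P^{-1}(K)=\{0\}$, the Laplacian is taken in the sense of distributions, and the normal derivative in the weak sense, i.e. $\int_K\nabla v\cdot\nabla w\,dx+\int_K\Delta v\,w\,dx=\sum_{e}\int_e\frac{\partial v}{\partial\mathbf n}\,w\,ds$ for all $w\in H^1(K)$. Let $\mathcal M^{\ell}(D)=\{((x-x_D)/h_D)^s:\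 |s|\le\ell\}$ be the scaled monomials, in Cartesian coordinates of $\mathbb R^d$ for $D=K$ (with multi-indices $s\in\mathbb N^d$) and in Cartesian coordinates of the line or plane of $e$ for $D=e$ (with $s\in\mathbb N^{d-1}$); $\mathcal M^{-1}(K)=\emptyset$. Then the degrees of freedom $$\frac1{|e|}\int_e v\,m\,ds\quad (m\in\mathcal M^{k-1}(e),\ e\subset\partial K),\qquad \frac1{|K|}\int_K v\,m\,dx\quad(m\in\mathcal M^{k-2}(K))$$ are unisolvent for $V_h^k(K)$: a function $v\in V_h^k(K)$ all of whose degrees of freedom vanish is $0$, and for every choice of real values for the degrees of freedom there is exactly one $v\in V_h^k(K)$ that attains them. -/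

import Mathlib

open MeasureTheory Topology
open scoped ContDiff

noncomputable section

/-- A bounded open connected set in `ℝᵐ` that equals the interior of its closure and whose boundary
lies in finitely many affine hyperplanes (for `m = 1` an open interval, for `m = 2` the interior
of a polygon). -/
structure IsPolytopalRegion {m : ℕ} (F : Set (EuclideanSpace ℝ (Fin m))) : Prop where
  isOpen : IsOpen F
  isBounded : Bornology.IsBounded F
  isConnected : IsConnected F
  interior_closure : interior (closure F) = F
  flat_frontier : ∃ S : Set (EuclideanSpace ℝ (Fin m) × ℝ), S.Finite ∧ (∀ p ∈ S, p.1 ≠ 0) ∧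
    frontier F ⊆ ⋃ p ∈ S, {y | inner ℝ p.1 y = p.2}

/-- A polygon (`d = 2`) or polyhedron (`d = 3`) with `n` edges/faces: a bounded connected open set
whose boundary consists of `n` flat faces and which lies locally on one side of each of them.
The relatively open face number `i` is the image of the region `face i ⊆ ℝᵈ⁻¹` under the affine
isometry `chart i`, that is, `chart i` is a system of Cartesian coordinates on the plane of
the face. -/
structure PolytopalDomain (d n : ℕ) where
  carrier : Set (EuclideanSpace ℝ (Fin d))
  isOpen : IsOpen carrier
  isBounded : Bornology.IsBounded carrier
  isConnected : IsConnected carrier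
  /-- the faces, in local coordinates -/
  face : Fin n → Set (EuclideanSpace ℝ (Fin (d - 1)))
  face_region : ∀ i, IsPolytopalRegion (face i)
  /-- Cartesian coordinates on the faces -/
  chart : Fin n → EuclideanSpace ℝ (Fin (d - 1)) →ᵃⁱ[ℝ] EuclideanSpace ℝ (Fin d)
  frontier_eq : frontier carrier = ⋃ i, chart i '' closure (face i)
  face_disjoint : ∀ i j, i ≠ j → Disjoint (chart i '' face i) (chart j '' face j)
  /-- the outward unit normals of the faces -/
  normal : Fin n → EuclideanSpace ℝ (Fin d)
  norm_normal : ∀ i, ‖normal i‖ = 1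
  one_sided : ∀ i, ∀ y ∈ face i, ∀ᶠ z in 𝓝 (chart i y),
    (z ∈ carrier ↔ inner ℝ (normal i) (z - chart i y) < 0)

/-- Real polynomials in `m` variables of degree at most `ℓ`; for `ℓ = -1` only the zero
polynomial. -/
def PolyDegLE (m : ℕ) (ℓ : ℤ) : Set (MvPolynomial (Fin m) ℝ) :=
  {p | ∀ s ∈ p.support, ((∑ j, s j : ℕ) : ℤ) ≤ ℓ}

/-- The `m`-dimensional multi-indices `s` with `|s| ≤ ℓ` (none for `ℓ = -1`). -/
def MultiIndexLE (m : ℕ) (ℓ : ℤ) : Type :=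
  {s : Fin m → ℕ // ((∑ j, s j : ℕ) : ℤ) ≤ ℓ}

/-- The scaled monomial `((x - x_D) / h_D) ^ s` of a set `D ⊆ ℝᵐ`, where `x_D` is the center of
gravity and `h_D` the diameter of `D`. -/
def scaledMonomial {m : ℕ} (D : Set (EuclideanSpace ℝ (Fin m))) (s : Fin m → ℕ)
    (x : EuclideanSpace ℝ (Fin m)) : ℝ :=
  ∏ j, ((x j - (⨍ z in D, z) j) / Metric.diam D) ^ s j

/-- `L²(Ω; F)`. -/
abbrev L2 {m : ℕ} (Ω : Set (EuclideanSpace ℝ (Fin m))) (F : Type) [NormedAddCommGroup F] : Type :=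
  Lp F 2 (volume.restrict Ω)

/-- `φ ∈ C_c^∞(Ω)`. -/
def IsTestFunction {m : ℕ} (Ω : Set (EuclideanSpace ℝ (Fin m)))
    (φ : EuclideanSpace ℝ (Fin m) → ℝ) : Prop :=
  ContDiff ℝ ∞ φ ∧ HasCompactSupport φ ∧ tsupport φ ⊆ Ω

/-- `v ∈ H¹(Ω)` with weak gradient `G ∈ L²(Ω; ℝᵐ)`. -/
def HasWeakGradient {m : ℕ} {Ω : Set (EuclideanSpace ℝ (Fin m))} (v : L2 Ω ℝ)
    (G : L2 Ω (EuclideanSpace ℝ (Fin m))) : Prop :=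
  ∀ φ, IsTestFunction Ω φ → ∀ a : EuclideanSpace ℝ (Fin m),
    ∫ x in Ω, v x * fderiv ℝ φ x a = -∫ x in Ω, inner ℝ (G x) a * φ x

/-- The distributional divergence of `G` in `Ω` is the function `f`; for a weak gradient `G = ∇v`
this says `Δv = f`. -/
def HasWeakDivergence {m : ℕ} {Ω : Set (EuclideanSpace ℝ (Fin m))}
    (G : L2 Ω (EuclideanSpace ℝ (Fin m))) (f : EuclideanSpace ℝ (Fin m) → ℝ) : Prop :=
  ∀ φ, IsTestFunction Ω φ → ∫ x in Ω, inner ℝ (G x) (gradient φ x) = -∫ x in Ω, f x * φ x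

namespace PolytopalDomain

variable {d n : ℕ} (K : PolytopalDomain d n)

/-- A family `g` of square integrable functions on the faces (in local coordinates) is the boundary
trace of `v ∈ H¹(K)`: the Gauss-Green formula
`∫_K (v ∂_a φ + φ ∂_a v) dx = ∑_e ∫_e g φ (n_e · a) ds`
holds for every smooth `φ` and every direction `a`. Two such families coincide almost
everywhere, and for a smooth `v` the formula is the divergence theorem, with `g` the restriction
of `v`. -/
def IsTrace (v : L2 K.carrier ℝ) (g : ∀ i, L2 (K.face i) ℝ) : Prop :=
  ∃ G : L2 K.carrier (EuclideanSpace ℝ (Fin d)), HasWeakGradient v G ∧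
    ∀ φ : EuclideanSpace ℝ (Fin d) → ℝ, ContDiff ℝ ∞ φ → ∀ a : EuclideanSpace ℝ (Fin d),
      ∫ x in K.carrier, (v x * fderiv ℝ φ x a + inner ℝ (G x) a * φ x) =
        ∑ i, ∫ y in K.face i, g i y * φ (K.chart i y) * inner ℝ (K.normal i) a

open Classical in
/-- The trace of `v ∈ H¹(K)` on the faces. (The value `0` where there is no trace only serves to
make the function total.) -/
def trace (v : L2 K.carrier ℝ) : ∀ i, L2 (K.face i) ℝ :=
  if h : ∃ g, K.IsTrace v g then h.choose else 0

/-- For a field `G = ∇v` with `div G = Δv = f`, the normal derivative `∂v/∂n`, an element of the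
dual `H^{-1/2}(∂K)` of the space of traces of `H¹(K)`, is given by the function `p i` on the face
number `i`:  `∫_K ∇v · ∇w dx + ∫_K Δv w dx = ∑_e ∫_e (∂v/∂n) w ds` for all `w ∈ H¹(K)`. -/
def HasNormalComponent (G : L2 K.carrier (EuclideanSpace ℝ (Fin d)))
    (f : EuclideanSpace ℝ (Fin d) → ℝ)
    (p : Fin n → EuclideanSpace ℝ (Fin (d - 1)) → ℝ) : Prop :=
  ∀ (w : L2 K.carrier ℝ) (H : L2 K.carrier (EuclideanSpace ℝ (Fin d))), HasWeakGradient w H →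
    (∫ x in K.carrier, inner ℝ (G x) (H x)) + ∫ x in K.carrier, f x * w x =
      ∑ i, ∫ y in K.face i, p i y * K.trace w i y

/-- The local space `V_h^k(K)` of all `v ∈ H¹(K)` with `Δv ∈ ℙ^{k-2}(K)` and
`∂v/∂n ∈ ℙ^{k-1}(e)` on each face `e`. -/
def localSpace (k : ℕ) : Set (L2 K.carrier ℝ) :=
  {v | ∃ G : L2 K.carrier (EuclideanSpace ℝ (Fin d)), HasWeakGradient v G ∧
    ∃ q ∈ PolyDegLE d ((k : ℤ) - 2), HasWeakDivergence G (fun x => q.eval x) ∧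
    ∃ p : Fin n → MvPolynomial (Fin (d - 1)) ℝ, (∀ i, p i ∈ PolyDegLE (d - 1) ((k : ℤ) - 1)) ∧
      K.HasNormalComponent G (fun x => q.eval x) (fun i y => (p i).eval y)}

/-- `|e|⁻¹ ∫_e v m ds` for the scaled monomial `m` with exponent `s` on the face `e` number `i`. -/
def faceMoment (v : L2 K.carrier ℝ) (i : Fin n) (s : Fin (d - 1) → ℕ) : ℝ :=
  (volume.real (K.face i))⁻¹ * ∫ y in K.face i, K.trace v i y * scaledMonomial (K.face i) s y

/-- `|K|⁻¹ ∫_K v m dx` for the scaled monomial `m` with exponent `s` on `K`. -/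
def cellMoment (v : L2 K.carrier ℝ) (s : Fin d → ℕ) : ℝ :=
  (volume.real K.carrier)⁻¹ * ∫ x in K.carrier, v x * scaledMonomial K.carrier s x

end PolytopalDomain

end

/-! The local space consists of the solutions of a family of Neumann problems. A function `v` lies
in it exactly when there are coefficients `c` with `∫ ∇v · ∇w = ∑ c_j D_j(w)` for all `w ∈ H¹(K)`,
where the `D_j` are the degrees of freedom. Indeed, polynomial Neumann data on the faces and a
polynomial Laplacian are combinations of scaled monomials, so that pairing them with `w` gives a
combination of moments of `w` (`mem_localSpace_iff`).

If all `D_j(v)` vanish, the choice `w = v` gives `∇v = 0`. The Poincaré inequality makes `v`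
constant, and the zeroth moment on a face makes it zero. For existence, the form `∫ ∇v · ∇w + ∑
D_j(v) D_j(w)` is coercive on `H¹(K)`, so Lax–Milgram yields a solution for each right-hand side `∑
c_j D_j`. The linear map from `c` to the moments of that solution is injective, because the `D_j`
are linearly independent on `H¹(K)`, and an injective endomorphism of a finite-dimensional space is
surjective (`exists_inner_eq_sum`).

The analytic work is to obtain square integrable traces and the Poincaré inequality on a domain that
is not assumed to be Lipschitz. The planes of the faces cut space into finitely many convex cells,
and a cell that meets `K` lies in `K` (`cell_subset`). Hence, outside finitely many hyperplanes of a
face, each of its points is the start of a segment into `K` in one of finitely many directions `ξ`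
(`exists_finite_visible`). Integration along these segments defines the trace and gives the
Gauss–Green formula near such points (`greenPairing_eq_obliqueTrace`). The excluded boundary points
lie in affine subspaces of codimension two, which `H¹` does not see
(`HasGreenOn.of_diff_codim_two`). Boundedness of the trace follows from the closed graph theorem.
For the Poincaré inequality, the increments of `v` are estimated on convex cells and the cells are
linked by chains of balls (`IncrementBound.of_convex`). -/

/-! ### Oblique coordinates adapted to a hyperplane -/

section Coordinates

variable {V W : Type*} [NormedAddCommGroup V] [InnerProductSpace ℝ V] [FiniteDimensional ℝ V]
  [MeasurableSpace V] [BorelSpace V] [NormedAddCommGroup W] [InnerProductSpace ℝ W]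
  [FiniteDimensional ℝ W] [MeasurableSpace W] [BorelSpace W]

omit [FiniteDimensional ℝ V] [MeasurableSpace V] [BorelSpace V] [FiniteDimensional ℝ W]
  [MeasurableSpace W] [BorelSpace W] in
theorem AffineIsometry.apply_add (c : V →ᵃⁱ[ℝ] W) (y z : V) :
    c (y + z) = c y + c.linearIsometry z := by
  have h := c.map_vadd y z
  rw [vadd_eq_add, vadd_eq_add] at h
  rw [add_comm y, h, add_comm]

/-- `c` is a system of Cartesian coordinates on a hyperplane with unit normal `ν`. -/
structure IsHyperplaneChart (c : V →ᵃⁱ[ℝ] W) (ν : W) : Prop where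
  norm_normal : ‖ν‖ = 1
  inner_normal : ∀ z, inner ℝ ν (c.linearIsometry z) = 0
  finrank_eq : Module.finrank ℝ V + 1 = Module.finrank ℝ W

namespace IsHyperplaneChart

variable {c : V →ᵃⁱ[ℝ] W} {ν : W} (h : IsHyperplaneChart c ν)
include h

omit [MeasurableSpace V] [BorelSpace V] [MeasurableSpace W] [BorelSpace W] in
theorem exists_linearIsometryEquiv :
    ∃ e : WithLp 2 (V × ℝ) ≃ₗᵢ[ℝ] W, ∀ p, e p = c.linearIsometry p.fst + p.snd • ν := by
  let f : WithLp 2 (V × ℝ) →ₗ[ℝ] W :=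
    { toFun := fun p => c.linearIsometry p.fst + p.snd • ν
      map_add' := fun p q => by simp [add_smul]; abel
      map_smul' := fun r p => by simp [mul_smul] }
  have hf : ∀ p, ‖f p‖ = ‖p‖ := by
    intro p
    have h1 : ‖f p‖ ^ 2 = ‖p‖ ^ 2 := by
      have : f p = c.linearIsometry p.fst + p.snd • ν := rfl
      rw [this, norm_add_sq_real, WithLp.prod_norm_sq_eq_of_L2, inner_smul_right, real_inner_comm,
        h.inner_normal, norm_smul, h.norm_normal, LinearIsometry.norm_map]
      simp
    exact (sq_eq_sq₀ (norm_nonneg _) (norm_nonneg _)).1 h1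
  let g : WithLp 2 (V × ℝ) →ₗᵢ[ℝ] W := ⟨f, hf⟩
  have hd : Module.finrank ℝ (WithLp 2 (V × ℝ)) = Module.finrank ℝ W := by
    rw [← h.finrank_eq, (WithLp.linearEquiv 2 ℝ (V × ℝ)).finrank_eq, Module.finrank_prod]
    simp
  exact ⟨g.toLinearIsometryEquiv hd, fun p => rfl⟩

theorem measurePreserving_normal :
    MeasurePreserving (fun p : V × ℝ => c p.1 + p.2 • ν) := by
  obtain ⟨e, he⟩ := h.exists_linearIsometryEquiv
  have h1 := (measurePreserving_add_left (volume : Measure W) (c 0)).comp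
    (e.measurePreserving.comp (WithLp.volume_preserving_toLp V ℝ))
  have h2 : (fun p : V × ℝ => c p.1 + p.2 • ν) =
      (fun x => c 0 + x) ∘ ⇑e ∘ WithLp.toLp 2 := by
    funext p
    have h3 := c.apply_add 0 p.1
    rw [zero_add] at h3
    simp only [Function.comp_apply, he]
    rw [h3, add_assoc]
    rfl
  rw [h2]
  exact h1

omit [MeasurableSpace V] [BorelSpace V] [MeasurableSpace W] [BorelSpace W] in
theorem exists_eq_add (ξ : W) : ∃ τ : V, ξ = c.linearIsometry τ + (inner ℝ ν ξ : ℝ) • ν := by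
  obtain ⟨e, he⟩ := h.exists_linearIsometryEquiv
  obtain ⟨p, rfl⟩ := e.surjective ξ
  refine ⟨p.fst, ?_⟩
  rw [he]
  simp [inner_add_right, inner_smul_right, h.inner_normal, h.norm_normal]

/-- With `ξ = τ + (ν · ξ) ν`, where `τ` is tangential, the map is a shear by `τ`, followed by a
dilation of `t` by `ν · ξ`, followed by the isometric coordinates along `ν`. Only the dilation
changes the measure. -/
theorem map_oblique {ξ : W} (hξ : (inner ℝ ν ξ : ℝ) ≠ 0) :
    Measure.map (fun p : V × ℝ => c p.1 + p.2 • ξ) volume =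
      ENNReal.ofReal |(inner ℝ ν ξ : ℝ)|⁻¹ • volume := by
  obtain ⟨τ, hτ⟩ := h.exists_eq_add ξ
  set a : ℝ := inner ℝ ν ξ with ha
  have hs : MeasurePreserving (fun p : V × ℝ => (p.1 + p.2 • τ, p.2)) := by
    have h1 : MeasurePreserving (fun p : ℝ × V => (p.1, p.2 + p.1 • τ)) := by
      refine MeasurePreserving.skew_product (g := fun t y => y + t • τ) (MeasurePreserving.id _)
        (by fun_prop) (Filter.Eventually.of_forall fun t => ?_)
      exact map_add_right_eq_self volume (t • τ)
    have h2 : MeasurePreserving (Prod.swap : V × ℝ → ℝ × V) := Measure.measurePreserving_swap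
    have h3 : MeasurePreserving (Prod.swap : ℝ × V → V × ℝ) := Measure.measurePreserving_swap
    exact h3.comp (h1.comp h2)
  have hm : Measure.map (fun p : V × ℝ => (p.1, p.2 * a)) volume =
      ENNReal.ofReal |a|⁻¹ • volume := by
    have h1 : Measure.map (Prod.map (id : V → V) (· * a)) (volume.prod volume) =
        (Measure.map id volume).prod (Measure.map (· * a) volume) :=
      (Measure.map_prod_map _ _ measurable_id (measurable_mul_const a)).symm
    rw [Measure.map_id, Real.map_volume_mul_right hξ, Measure.prod_smul_right, abs_inv] at h1
    exact h1
  have hcomp : (fun p : V × ℝ => c p.1 + p.2 • ξ) =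
      (fun p : V × ℝ => c p.1 + p.2 • ν) ∘ (fun p : V × ℝ => (p.1, p.2 * a)) ∘
        (fun p : V × ℝ => (p.1 + p.2 • τ, p.2)) := by
    funext p
    simp only [Function.comp_apply]
    rw [c.apply_add, map_smul]
    conv_lhs => rw [hτ]
    simp [smul_add, mul_smul]; abel
  have hn := h.measurePreserving_normal
  rw [hcomp, ← Measure.map_map hn.measurable (by fun_prop),
    ← Measure.map_map (by fun_prop) hs.measurable, hs.map_eq, hm, Measure.map_smul, hn.map_eq]

theorem lintegral_oblique {ξ : W} (hξ : (inner ℝ ν ξ : ℝ) ≠ 0) {f : W → ENNReal}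
    (hf : Measurable f) :
    ∫⁻ p : V × ℝ, f (c p.1 + p.2 • ξ) = ENNReal.ofReal |(inner ℝ ν ξ : ℝ)|⁻¹ * ∫⁻ x, f x := by
  have hc : Continuous (fun p : V × ℝ => c p.1 + p.2 • ξ) :=
    (c.continuous.comp continuous_fst).add (continuous_snd.smul continuous_const)
  rw [← lintegral_map hf hc.measurable, h.map_oblique hξ, lintegral_smul_measure, smul_eq_mul]

theorem integrable_oblique {ξ : W} (hξ : (inner ℝ ν ξ : ℝ) ≠ 0) {f : W → ℝ}
    (hf : Integrable f) : Integrable (fun p : V × ℝ => f (c p.1 + p.2 • ξ)) := by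
  have hc : Continuous (fun p : V × ℝ => c p.1 + p.2 • ξ) :=
    (c.continuous.comp continuous_fst).add (continuous_snd.smul continuous_const)
  have h1 : Integrable f (Measure.map (fun p : V × ℝ => c p.1 + p.2 • ξ) volume) := by
    rw [h.map_oblique hξ]; exact hf.smul_measure (by simp)
  exact h1.comp_measurable hc.measurable

theorem integral_oblique {ξ : W} (hξ : (inner ℝ ν ξ : ℝ) ≠ 0) {f : W → ℝ}
    (hf : Integrable f) :
    ∫ x, f x = |(inner ℝ ν ξ : ℝ)| * ∫ y : V, ∫ t : ℝ, f (c y + t • ξ) := by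
  have hc : Continuous (fun p : V × ℝ => c p.1 + p.2 • ξ) :=
    (c.continuous.comp continuous_fst).add (continuous_snd.smul continuous_const)
  have h1 : AEStronglyMeasurable f (Measure.map (fun p : V × ℝ => c p.1 + p.2 • ξ) volume) := by
    rw [h.map_oblique hξ]; exact hf.aestronglyMeasurable.smul_measure _
  rw [← integral_prod (fun p : V × ℝ => f (c p.1 + p.2 • ξ)) (h.integrable_oblique hξ hf)]
  have h2 := integral_map hc.measurable.aemeasurable h1
  rw [h.map_oblique hξ, integral_smul_measure, ENNReal.toReal_ofReal (by positivity)] at h2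
  have h3 : (volume : Measure (V × ℝ)) = volume.prod volume := rfl
  rw [← h3, ← h2, smul_eq_mul, mul_inv_cancel_left₀ (by positivity)]

omit [MeasurableSpace V] [BorelSpace V] [MeasurableSpace W] [BorelSpace W] in
theorem exists_eq_of_inner_eq_zero {x : W} {y : V} (hx : (inner ℝ ν (x - c y) : ℝ) = 0) :
    ∃ y', x = c y' := by
  obtain ⟨τ, hτ⟩ := h.exists_eq_add (x - c y)
  refine ⟨y + τ, ?_⟩
  rw [hx, zero_smul, add_zero] at hτ
  rw [c.apply_add, ← hτ]; abel

omit [FiniteDimensional ℝ V] [MeasurableSpace V] [BorelSpace V] [FiniteDimensional ℝ W]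
  [MeasurableSpace W] [BorelSpace W] in
theorem inner_sub_eq_zero (y z : V) : (inner ℝ ν (c y - c z) : ℝ) = 0 := by
  have h1 := c.apply_add z (y - z)
  rw [add_sub_cancel] at h1
  rw [h1, add_sub_cancel_left, h.inner_normal]

end IsHyperplaneChart
end Coordinates

/-! ### Local geometry of the faces -/

namespace PolytopalDomain

variable {d n : ℕ} (K : PolytopalDomain d n)

theorem chart_mem_frontier {i : Fin n} {y : EuclideanSpace ℝ (Fin (d - 1))}
    (hy : y ∈ closure (K.face i)) : K.chart i y ∈ frontier K.carrier := by
  rw [K.frontier_eq]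
  exact Set.mem_iUnion.2 ⟨i, Set.mem_image_of_mem _ hy⟩

theorem notMem_carrier_of_mem_frontier {x : EuclideanSpace ℝ (Fin d)}
    (hx : x ∈ frontier K.carrier) : x ∉ K.carrier := by
  rw [K.isOpen.frontier_eq] at hx
  exact hx.2

theorem exists_ball_oneSided {i : Fin n} {y : EuclideanSpace ℝ (Fin (d - 1))}
    (hy : y ∈ K.face i) : ∃ ρ > 0, (∀ x ∈ Metric.ball (K.chart i y) ρ,
      (x ∈ K.carrier ↔ (inner ℝ (K.normal i) (x - K.chart i y) : ℝ) < 0)) ∧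
      Metric.ball y ρ ⊆ K.face i := by
  obtain ⟨ρ₁, h₁, h₁'⟩ := Metric.eventually_nhds_iff_ball.1 (K.one_sided i y hy)
  obtain ⟨ρ₂, h₂, h₂'⟩ := Metric.isOpen_iff.1 (K.face_region i).isOpen y hy
  refine ⟨min ρ₁ ρ₂, lt_min h₁ h₂, fun x hx => h₁' x ?_, fun x hx => h₂' ?_⟩
  · exact Metric.ball_subset_ball (min_le_left _ _) hx
  · exact Metric.ball_subset_ball (min_le_right _ _) hx

/-- Nearby points of the face are boundary points, so they are not in `K`, and one-sidedness makes
their normal component nonnegative. Applied to `z` and `-z`, this forces the component to vanish. -/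
theorem inner_normal_linear (i : Fin n) (z : EuclideanSpace ℝ (Fin (d - 1))) :
    (inner ℝ (K.normal i) ((K.chart i).linearIsometry z) : ℝ) = 0 := by
  obtain ⟨y, hy⟩ := (K.face_region i).isConnected.nonempty
  obtain ⟨ρ, hρ, h1, h2⟩ := K.exists_ball_oneSided hy
  have key : ∀ z : EuclideanSpace ℝ (Fin (d - 1)), ‖z‖ < ρ →
      0 ≤ (inner ℝ (K.normal i) ((K.chart i).linearIsometry z) : ℝ) := by
    intro z hz
    have h3 : y + z ∈ Metric.ball y ρ := by simpa [Metric.mem_ball, dist_eq_norm] using hz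
    have h4 : K.chart i (y + z) ∈ Metric.ball (K.chart i y) ρ := by
      rw [Metric.mem_ball, (K.chart i).dist_map]; exact h3
    have h5 := K.notMem_carrier_of_mem_frontier (K.chart_mem_frontier (subset_closure (h2 h3)))
    rw [h1 _ h4, AffineIsometry.apply_add, add_sub_cancel_left] at h5
    exact not_lt.1 h5
  obtain ⟨r, hr, hr'⟩ : ∃ r : ℝ, 0 < r ∧ r * ‖z‖ < ρ := by
    refine ⟨ρ / (‖z‖ + 1), by positivity, ?_⟩
    rw [div_mul_eq_mul_div, div_lt_iff₀ (by positivity)]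
    nlinarith [norm_nonneg z]
  have h6 := key (r • z) (by rwa [norm_smul, Real.norm_of_nonneg hr.le])
  have h7 := key (-(r • z)) (by rwa [norm_neg, norm_smul, Real.norm_of_nonneg hr.le])
  rw [map_neg, inner_neg_right] at h7
  have h8 : (inner ℝ (K.normal i) ((K.chart i).linearIsometry (r • z)) : ℝ) = 0 := by linarith
  rw [map_smul, inner_smul_right] at h8
  exact (mul_eq_zero.1 h8).resolve_left hr.ne'

theorem isHyperplaneChart (hd : 1 ≤ d) (i : Fin n) :
    IsHyperplaneChart (K.chart i) (K.normal i) where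
  norm_normal := K.norm_normal i
  inner_normal := K.inner_normal_linear i
  finrank_eq := by simp; omega

/-- On the negative side the point would belong to the open set `K`; on the positive side it would
have a neighbourhood that misses `K`. -/
theorem inner_eq_zero_of_mem_frontier {x z : EuclideanSpace ℝ (Fin d)} {ν : EuclideanSpace ℝ (Fin d)}
    {ρ : ℝ} (h : ∀ x ∈ Metric.ball z ρ, (x ∈ K.carrier ↔ (inner ℝ ν (x - z) : ℝ) < 0))
    (hx : x ∈ Metric.ball z ρ) (hx' : x ∈ frontier K.carrier) : (inner ℝ ν (x - z) : ℝ) = 0 := by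
  have h1 := K.notMem_carrier_of_mem_frontier hx'
  rw [h x hx, not_lt] at h1
  refine le_antisymm (not_lt.1 fun h2 => ?_) h1
  have ho : IsOpen (Metric.ball z ρ ∩ {x | 0 < (inner ℝ ν (x - z) : ℝ)}) :=
    Metric.isOpen_ball.inter (isOpen_lt continuous_const (by fun_prop))
  obtain ⟨w, ⟨hw1, hw2⟩, hw3⟩ := mem_closure_iff.1 (frontier_subset_closure hx') _ ho ⟨hx, h2⟩
  rw [h w hw1] at hw3
  exact absurd hw3 (not_lt.2 (le_of_lt hw2))

/-- Otherwise points of the open face `j` would come arbitrarily close to a point of the open face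
`i`. Being boundary points, they would lie in the plane of face `i`, hence in face `i` itself,
although open faces are disjoint. -/
theorem chart_notMem_image_closure (hd : 1 ≤ d) {i j : Fin n} (hij : i ≠ j)
    {y : EuclideanSpace ℝ (Fin (d - 1))} (hy : y ∈ K.face i) :
    K.chart i y ∉ K.chart j '' closure (K.face j) := by
  rintro ⟨z, hz, hzy⟩
  obtain ⟨ρ, hρ, h1, h2⟩ := K.exists_ball_oneSided hy
  obtain ⟨z', hz', hd'⟩ := Metric.mem_closure_iff.1 hz ρ hρ
  have h3 : K.chart j z' ∈ Metric.ball (K.chart i y) ρ := by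
    rw [Metric.mem_ball, ← hzy, (K.chart j).dist_map, dist_comm]; exact hd'
  have h4 := K.inner_eq_zero_of_mem_frontier h1 h3 (K.chart_mem_frontier (subset_closure hz'))
  obtain ⟨y', hy'⟩ := (K.isHyperplaneChart hd i).exists_eq_of_inner_eq_zero h4
  have h5 : y' ∈ K.face i := by
    apply h2
    rw [Metric.mem_ball, ← (K.chart i).dist_map, ← hy']; exact h3
  exact Set.disjoint_left.1 (K.face_disjoint i j hij) ⟨y', h5, rfl⟩ ⟨z', hz', hy'⟩

end PolytopalDomain

/-- A smooth cutoff which vanishes on `(-∞, 1]` and equals one on `[2, ∞)`. -/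
theorem exists_cutoff : ∃ χ : ℝ → ℝ, ContDiff ℝ ∞ χ ∧ (∀ t ≤ 1, χ t = 0) ∧ (∀ t, 2 ≤ t → χ t = 1) ∧
    (∀ t, 0 ≤ χ t ∧ χ t ≤ 1) ∧ (∀ t, 2 < t → deriv χ t = 0) ∧ ∃ M, 0 ≤ M ∧ ∀ t, |deriv χ t| ≤ M := by
  have hs : ContDiff ℝ ∞ (fun t : ℝ => Real.smoothTransition (t - 1)) :=
    Real.smoothTransition.contDiff.comp (contDiff_id.sub contDiff_const)
  have h0 : ∀ t : ℝ, t ≤ 1 → Real.smoothTransition (t - 1) = 0 := fun t ht =>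
    Real.smoothTransition.zero_of_nonpos (by linarith)
  have h1 : ∀ t : ℝ, 2 ≤ t → Real.smoothTransition (t - 1) = 1 := fun t ht =>
    Real.smoothTransition.one_of_one_le (by linarith)
  have hd0 : ∀ t : ℝ, t < 1 → deriv (fun t : ℝ => Real.smoothTransition (t - 1)) t = 0 := by
    intro t ht
    have : (fun t : ℝ => Real.smoothTransition (t - 1)) =ᶠ[𝓝 t] fun _ => 0 := by
      filter_upwards [gt_mem_nhds ht] with s hs using h0 s hs.le
    rw [this.deriv_eq]; simp
  have hd1 : ∀ t : ℝ, 2 < t → deriv (fun t : ℝ => Real.smoothTransition (t - 1)) t = 0 := by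
    intro t ht
    have : (fun t : ℝ => Real.smoothTransition (t - 1)) =ᶠ[𝓝 t] fun _ => 1 := by
      filter_upwards [lt_mem_nhds ht] with s hs using h1 s hs.le
    rw [this.deriv_eq]; simp
  obtain ⟨M, hM⟩ := (isCompact_Icc (a := (1 : ℝ)) (b := 2)).exists_bound_of_continuousOn
    (hs.continuous_deriv (by simp)).continuousOn
  have hM0 : 0 ≤ M := (norm_nonneg _).trans (hM 1 (by norm_num))
  refine ⟨_, hs, h0, h1, fun t => ⟨Real.smoothTransition.nonneg _, Real.smoothTransition.le_one _⟩,
    hd1, M, hM0, fun t => ?_⟩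
  by_cases ht1 : t < 1
  · rw [hd0 t ht1]; simpa using hM0
  by_cases ht2 : 2 < t
  · rw [hd1 t ht2]; simpa using hM0
  exact hM t ⟨not_lt.1 ht1, not_lt.1 ht2⟩

/-! ### The Green pairing and test functions reaching a flat boundary piece -/

section Sobolev

variable {m : ℕ}

/-- `v ∈ H¹(Ω)` with weak gradient `G`, for functions instead of classes of functions. -/
structure IsSobolevPair (Ω : Set (EuclideanSpace ℝ (Fin m))) (v : EuclideanSpace ℝ (Fin m) → ℝ)
    (G : EuclideanSpace ℝ (Fin m) → EuclideanSpace ℝ (Fin m)) : Prop where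
  measurable : Measurable v
  measurable_grad : Measurable G
  memLp : MemLp v 2 (volume.restrict Ω)
  memLp_grad : MemLp G 2 (volume.restrict Ω)
  weak : ∀ φ, IsTestFunction Ω φ → ∀ a : EuclideanSpace ℝ (Fin m),
    ∫ x in Ω, v x * fderiv ℝ φ x a = -∫ x in Ω, inner ℝ (G x) a * φ x

/-- The left-hand side `∫_Ω (v ∂_a φ + φ ∂_a v) dx` of the Gauss-Green formula. -/
noncomputable def greenPairing (Ω : Set (EuclideanSpace ℝ (Fin m)))
    (v : EuclideanSpace ℝ (Fin m) → ℝ)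
    (G : EuclideanSpace ℝ (Fin m) → EuclideanSpace ℝ (Fin m))
    (φ : EuclideanSpace ℝ (Fin m) → ℝ) (a : EuclideanSpace ℝ (Fin m)) : ℝ :=
  ∫ x in Ω, (v x * fderiv ℝ φ x a + inner ℝ (G x) a * φ x)

theorem integrable_mul_of_isBounded {Ω : Set (EuclideanSpace ℝ (Fin m))}
    (hb : Bornology.IsBounded Ω) (hm : MeasurableSet Ω) {v f : EuclideanSpace ℝ (Fin m) → ℝ}
    (hv : MemLp v 2 (volume.restrict Ω)) (hf : Continuous f) :
    Integrable (fun x => v x * f x) (volume.restrict Ω) := by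
  have : IsFiniteMeasure (volume.restrict Ω) :=
    ⟨by rw [Measure.restrict_apply_univ]; exact hb.measure_lt_top⟩
  obtain ⟨C, hC⟩ := (hb.isCompact_closure).exists_bound_of_continuousOn hf.continuousOn
  refine (hv.integrable (by norm_num)).mul_bdd (c := C) hf.aestronglyMeasurable ?_
  filter_upwards [ae_restrict_mem hm] with x hx using hC x (subset_closure hx)

theorem memLp_inner_const {Ω : Set (EuclideanSpace ℝ (Fin m))}
    {G : EuclideanSpace ℝ (Fin m) → EuclideanSpace ℝ (Fin m)}
    (hG : MemLp G 2 (volume.restrict Ω)) (a : EuclideanSpace ℝ (Fin m)) :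
    MemLp (fun x => (inner ℝ (G x) a : ℝ)) 2 (volume.restrict Ω) :=
  hG.inner_const a

namespace IsSobolevPair

variable {Ω : Set (EuclideanSpace ℝ (Fin m))} {v : EuclideanSpace ℝ (Fin m) → ℝ}
  {G : EuclideanSpace ℝ (Fin m) → EuclideanSpace ℝ (Fin m)}

theorem integrable_mul (h : IsSobolevPair Ω v G) (hb : Bornology.IsBounded Ω)
    (hm : MeasurableSet Ω) {f : EuclideanSpace ℝ (Fin m) → ℝ} (hf : Continuous f) :
    Integrable (fun x => v x * f x) (volume.restrict Ω) :=
  integrable_mul_of_isBounded hb hm h.memLp hf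

theorem integrable_grad_mul (h : IsSobolevPair Ω v G) (hb : Bornology.IsBounded Ω)
    (hm : MeasurableSet Ω) {f : EuclideanSpace ℝ (Fin m) → ℝ} (hf : Continuous f)
    (a : EuclideanSpace ℝ (Fin m)) :
    Integrable (fun x => (inner ℝ (G x) a : ℝ) * f x) (volume.restrict Ω) :=
  integrable_mul_of_isBounded hb hm (memLp_inner_const h.memLp_grad a) hf

theorem integrable_pairing (h : IsSobolevPair Ω v G) (hb : Bornology.IsBounded Ω)
    (hm : MeasurableSet Ω) {φ : EuclideanSpace ℝ (Fin m) → ℝ} (hφ : ContDiff ℝ ∞ φ)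
    (a : EuclideanSpace ℝ (Fin m)) :
    Integrable (fun x => v x * fderiv ℝ φ x a + (inner ℝ (G x) a : ℝ) * φ x)
      (volume.restrict Ω) :=
  (h.integrable_mul hb hm ((hφ.continuous_fderiv (by simp)).clm_apply continuous_const)).add
    (h.integrable_grad_mul hb hm hφ.continuous a)

theorem greenPairing_eq_zero (h : IsSobolevPair Ω v G) (hb : Bornology.IsBounded Ω)
    (hm : MeasurableSet Ω) {φ : EuclideanSpace ℝ (Fin m) → ℝ} (hφ : IsTestFunction Ω φ)
    (a : EuclideanSpace ℝ (Fin m)) : greenPairing Ω v G φ a = 0 := by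
  have h1 := h.integrable_mul hb hm
    ((hφ.1.continuous_fderiv (by simp)).clm_apply (continuous_const (y := a)))
  have h2 := h.integrable_grad_mul hb hm hφ.1.continuous a
  rw [greenPairing, integral_add h1 h2, h.weak φ hφ a, neg_add_cancel]

theorem greenPairing_add (h : IsSobolevPair Ω v G) (hb : Bornology.IsBounded Ω)
    (hm : MeasurableSet Ω) {φ ψ : EuclideanSpace ℝ (Fin m) → ℝ} (hφ : ContDiff ℝ ∞ φ)
    (hψ : ContDiff ℝ ∞ ψ) (a : EuclideanSpace ℝ (Fin m)) :
    greenPairing Ω v G (fun x => φ x + ψ x) a =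
      greenPairing Ω v G φ a + greenPairing Ω v G ψ a := by
  rw [greenPairing, greenPairing, greenPairing,
    ← integral_add (h.integrable_pairing hb hm hφ a) (h.integrable_pairing hb hm hψ a)]
  congr 1; funext x
  have : fderiv ℝ (fun x => φ x + ψ x) x = fderiv ℝ φ x + fderiv ℝ ψ x :=
    fderiv_fun_add (hφ.differentiable (by simp) x) (hψ.differentiable (by simp) x)
  rw [this]; simp; ring

theorem greenPairing_dir_add (h : IsSobolevPair Ω v G) (hb : Bornology.IsBounded Ω)
    (hm : MeasurableSet Ω) {φ : EuclideanSpace ℝ (Fin m) → ℝ} (hφ : ContDiff ℝ ∞ φ)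
    (a b : EuclideanSpace ℝ (Fin m)) (r : ℝ) :
    greenPairing Ω v G φ (a + r • b) = greenPairing Ω v G φ a + r * greenPairing Ω v G φ b := by
  rw [greenPairing, greenPairing, greenPairing, ← integral_const_mul,
    ← integral_add (h.integrable_pairing hb hm hφ a) ((h.integrable_pairing hb hm hφ b).const_mul r)]
  congr 1; funext x
  simp [inner_add_right, inner_smul_right]; ring

end IsSobolevPair

/-- A smooth function of compact support is Lipschitz; compare its value at `x` with the value zero
at the orthogonal projection of `x` to the hyperplane. -/
theorem abs_le_mul_abs_of_zero_on_hyperplane {τ : EuclideanSpace ℝ (Fin m)} (hτ : τ ≠ 0) (b : ℝ)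
    {φ : EuclideanSpace ℝ (Fin m) → ℝ} (hφ : ContDiff ℝ ∞ φ) (hc : HasCompactSupport φ)
    (h0 : ∀ x, (inner ℝ τ x : ℝ) + b = 0 → φ x = 0) :
    ∃ C, 0 ≤ C ∧ ∀ x, |φ x| ≤ C * |(inner ℝ τ x : ℝ) + b| := by
  obtain ⟨L, hL⟩ := hφ.lipschitzWith_of_hasCompactSupport hc (by simp)
  refine ⟨L * ‖τ‖⁻¹, by positivity, fun x => ?_⟩
  set T : ℝ := (inner ℝ τ x : ℝ) + b with hT
  have hn : ‖τ‖ ≠ 0 := norm_ne_zero_iff.2 hτ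
  have h1 : φ (x - (T / ‖τ‖ ^ 2) • τ) = 0 := by
    apply h0
    rw [inner_sub_right, inner_smul_right, real_inner_self_eq_norm_sq]
    field_simp
    rw [hT]; ring
  have h2 := hL.dist_le_mul x (x - (T / ‖τ‖ ^ 2) • τ)
  rw [h1, dist_eq_norm, dist_eq_norm, sub_zero, sub_sub_cancel, norm_smul, Real.norm_eq_abs,
    Real.norm_eq_abs, abs_div, abs_of_nonneg (sq_nonneg ‖τ‖)] at h2
  refine h2.trans (le_of_eq ?_)
  field_simp

/-- Test functions that need not vanish at a flat piece of the boundary. -/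
theorem IsSobolevPair.greenPairing_eq_zero_of_halfSpace
    {Ω : Set (EuclideanSpace ℝ (Fin m))} {v : EuclideanSpace ℝ (Fin m) → ℝ}
    {G : EuclideanSpace ℝ (Fin m) → EuclideanSpace ℝ (Fin m)} (h : IsSobolevPair Ω v G)
    (hb : Bornology.IsBounded Ω) (hm : MeasurableSet Ω) {φ : EuclideanSpace ℝ (Fin m) → ℝ}
    (hφ : ContDiff ℝ ∞ φ) (hc : HasCompactSupport φ) {τ : EuclideanSpace ℝ (Fin m)} {b : ℝ}
    (hH : ∀ x ∈ tsupport φ, (x ∈ Ω ↔ 0 < (inner ℝ τ x : ℝ) + b)) {a : EuclideanSpace ℝ (Fin m)}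
    (ha : (inner ℝ τ a : ℝ) = 0 ∨ ∀ x, (inner ℝ τ x : ℝ) + b = 0 → φ x = 0) :
    greenPairing Ω v G φ a = 0 := by
  obtain ⟨χ, hχ, hχ0, hχ1, hχb, hχd, M, hM0, hM⟩ := exists_cutoff
  set T : EuclideanSpace ℝ (Fin m) → ℝ := fun x => (inner ℝ τ x : ℝ) + b with hT
  have hTs : ContDiff ℝ ∞ T := (contDiff_const.inner ℝ contDiff_id).add contDiff_const
  -- The cutoffs `χ (e k * T x)` remove a layer of width `1 / e k` at the hyperplane, so `φ * X k`
  -- is admissible in `Ω` and has pairing zero. The dangerous term `φ χ' e_k (τ · a)` vanishes for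
  -- tangential `a`; otherwise it is bounded, since `|φ| ≤ C |T|` and `e_k T ≤ 2` wherever `χ'` may
  -- be nonzero.
  let e : ℕ → ℝ := fun k => (k : ℝ) + 1
  have he : ∀ k, 0 < e k := fun k => by positivity
  let X : ℕ → EuclideanSpace ℝ (Fin m) → ℝ := fun k x => χ (e k * T x)
  have hX : ∀ k, ContDiff ℝ ∞ (X k) := fun k => hχ.comp (contDiff_const.mul hTs)
  have hXd : ∀ k x, fderiv ℝ (X k) x a = deriv χ (e k * T x) * (e k * inner ℝ τ a) := by
    intro k x
    have h1 : HasFDerivAt T (innerSL ℝ τ) x := by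
      have := (innerSL ℝ τ).hasFDerivAt (x := x)
      exact this.add_const b
    have h2 : HasDerivAt χ (deriv χ (e k * T x)) (e k * T x) :=
      (hχ.differentiable (by simp) _).hasDerivAt
    have h3 := h2.comp_hasFDerivAt x (h1.const_mul (e k))
    have h4 : fderiv ℝ (X k) x = _ := h3.fderiv
    rw [h4]; simp
  have htest : ∀ k, IsTestFunction Ω (fun x => φ x * X k x) := by
    intro k
    refine ⟨hφ.mul (hX k), hc.mul_right, fun x hx => ?_⟩
    have h1 : x ∈ tsupport φ := tsupport_mul_subset_left hx
    rw [hH x h1]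
    have h2 : tsupport (fun x => φ x * X k x) ⊆ {x | 1 ≤ e k * T x} := by
      refine closure_minimal (fun y hy => ?_)
        (isClosed_le continuous_const (continuous_const.mul hTs.continuous))
      by_contra hy'
      exact hy (by simp [X, hχ0 _ (not_le.1 hy').le])
    have h3 : 1 ≤ e k * T x := h2 hx
    exact pos_of_mul_pos_right (lt_of_lt_of_le one_pos h3) (he k).le
  have hzero : ∀ k, greenPairing Ω v G (fun x => φ x * X k x) a = 0 := fun k =>
    h.greenPairing_eq_zero hb hm (htest k) a
  have hfd : ∀ k x, fderiv ℝ (fun x => φ x * X k x) x a =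
      φ x * (deriv χ (e k * T x) * (e k * inner ℝ τ a)) + X k x * fderiv ℝ φ x a := by
    intro k x
    have := fderiv_fun_mul (hφ.differentiable (by simp) x) ((hX k).differentiable (by simp) x)
    rw [this]; simp [hXd]
  -- the critical term is bounded
  obtain ⟨C, hC0, hC⟩ : ∃ C, 0 ≤ C ∧ ∀ k x,
      |φ x * (deriv χ (e k * T x) * (e k * inner ℝ τ a))| ≤ C ∨ x ∉ Ω := by
    rcases ha with ha | ha
    · exact ⟨0, le_rfl, fun k x => Or.inl (by simp [ha])⟩
    by_cases hτ : τ = 0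
    · exact ⟨0, le_rfl, fun k x => Or.inl (by simp [hτ])⟩
    obtain ⟨C, hC0, hC⟩ := abs_le_mul_abs_of_zero_on_hyperplane hτ b hφ hc ha
    refine ⟨C * 2 * M * |(inner ℝ τ a : ℝ)|, by positivity, fun k x => ?_⟩
    by_cases hx : x ∈ Ω
    swap
    · exact Or.inr hx
    left
    by_cases hxs : x ∈ tsupport φ
    swap
    · rw [image_eq_zero_of_notMem_tsupport hxs]; simp; positivity
    have hTx : 0 < T x := (hH x hxs).1 hx
    by_cases h2 : 2 < e k * T x
    · rw [hχd _ h2]; simp; positivity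
    rw [abs_mul, abs_mul, abs_mul, abs_of_pos (he k)]
    have h3 := hC x
    change |φ x| ≤ C * |T x| at h3
    rw [abs_of_pos hTx] at h3
    have h4 := hM (e k * T x)
    calc |φ x| * (|deriv χ (e k * T x)| * (e k * |(inner ℝ τ a : ℝ)|))
        ≤ (C * T x) * (M * (e k * |(inner ℝ τ a : ℝ)|)) := by gcongr
      _ = C * (e k * T x) * M * |(inner ℝ τ a : ℝ)| := by ring
      _ ≤ C * 2 * M * |(inner ℝ τ a : ℝ)| := by gcongr; exact not_lt.1 h2
  have hlim : Filter.Tendsto (fun k => greenPairing Ω v G (fun x => φ x * X k x) a) Filter.atTop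
      (𝓝 (greenPairing Ω v G φ a)) := by
    unfold greenPairing
    have hdc : Continuous (fun x => fderiv ℝ φ x a) :=
      (hφ.continuous_fderiv (by simp)).clm_apply continuous_const
    refine tendsto_integral_of_dominated_convergence
      (fun x => |v x * C| + |v x * fderiv ℝ φ x a| + |(inner ℝ (G x) a : ℝ) * φ x|)
      (fun k => (h.integrable_pairing hb hm (hφ.mul (hX k)) a).aestronglyMeasurable) ?_ ?_ ?_
    · exact ((h.integrable_mul hb hm continuous_const).abs.add
        (h.integrable_mul hb hm hdc).abs).add (h.integrable_grad_mul hb hm hφ.continuous a).abs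
    · intro k
      filter_upwards [ae_restrict_mem hm] with x hx
      have h1 := (hC k x).resolve_right (not_not.2 hx)
      have h2 := hχb (e k * T x)
      have h3 : |X k x| ≤ 1 := abs_le.2 ⟨by linarith [h2.1], h2.2⟩
      rw [hfd, mul_add, Real.norm_eq_abs]
      refine (abs_add_three _ _ _).trans ?_
      have h4 : |v x * (φ x * (deriv χ (e k * T x) * (e k * inner ℝ τ a)))| ≤ |v x * C| := by
        rw [abs_mul, abs_mul (v x) C, abs_of_nonneg hC0]; gcongr
      have h5 : |v x * (X k x * fderiv ℝ φ x a)| ≤ |v x * fderiv ℝ φ x a| := by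
        rw [abs_mul, abs_mul, abs_mul]
        have : |X k x| * |fderiv ℝ φ x a| ≤ |fderiv ℝ φ x a| :=
          mul_le_of_le_one_left (abs_nonneg _) h3
        gcongr
      have h6 : |(inner ℝ (G x) a : ℝ) * (φ x * X k x)| ≤ |(inner ℝ (G x) a : ℝ) * φ x| := by
        rw [← mul_assoc, abs_mul _ (X k x)]
        exact mul_le_of_le_one_right (abs_nonneg _) h3
      linarith
    · filter_upwards [ae_restrict_mem hm] with x hx
      refine tendsto_const_nhds.congr' ?_
      by_cases hxs : x ∈ tsupport φ
      swap
      · refine Filter.Eventually.of_forall fun k => ?_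
        have h1 : x ∉ tsupport (fun x => φ x * X k x) := fun h =>
          hxs (tsupport_mul_subset_left h)
        simp only []
        rw [fderiv_of_notMem_tsupport (𝕜 := ℝ) hxs, fderiv_of_notMem_tsupport (𝕜 := ℝ) h1,
          image_eq_zero_of_notMem_tsupport hxs]
        simp
      have hTx : 0 < T x := (hH x hxs).1 hx
      obtain ⟨N, hN⟩ := exists_nat_gt (2 / T x)
      filter_upwards [Filter.eventually_ge_atTop N] with k hk
      have h2 : 2 < e k * T x := by
        have : (N : ℝ) ≤ k := by exact_mod_cast hk
        have : 2 / T x < e k := by simp only [e]; linarith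
        rwa [div_lt_iff₀ hTx] at this
      rw [hfd, hχd _ h2]
      simp only [X]
      rw [hχ1 _ h2.le]; simp
  have h0 : Filter.Tendsto (fun k => greenPairing Ω v G (fun x => φ x * X k x) a) Filter.atTop
      (𝓝 0) := by simp only [hzero]; exact tendsto_const_nhds
  exact tendsto_nhds_unique hlim h0

end Sobolev

/-! ### Traces along oblique segments and the local Gauss–Green formula -/

section ObliqueProjection

variable {V W : Type*} [NormedAddCommGroup V] [InnerProductSpace ℝ V] [FiniteDimensional ℝ V]
  [NormedAddCommGroup W] [InnerProductSpace ℝ W] [FiniteDimensional ℝ W]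

omit [FiniteDimensional ℝ V] [FiniteDimensional ℝ W] in
theorem AffineIsometry.contDiff_coe (c : V →ᵃⁱ[ℝ] W) : ContDiff ℝ ∞ c := by
  have h : (c : V → W) = fun y => c 0 + c.linearIsometry y := by
    funext y
    have := c.apply_add 0 y
    rwa [zero_add] at this
  rw [h]
  exact contDiff_const.add c.linearIsometry.contDiff

/-- Removing the multiple of `ξ` that carries the normal component leaves a tangential vector, and
on such vectors the adjoint of the linear part of `c` is its inverse. Being smooth, `P` transports
test functions from the face into space. -/
theorem IsHyperplaneChart.exists_obliqueProjection {c : V →ᵃⁱ[ℝ] W} {ν : W}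
    (h : IsHyperplaneChart c ν) {ξ : W} (hξ : (inner ℝ ν ξ : ℝ) ≠ 0) :
    ∃ P : W → V, ContDiff ℝ ∞ P ∧
      (∀ x, x = c (P x) + ((inner ℝ ν (x - c 0) : ℝ) / inner ℝ ν ξ) • ξ) ∧
      ∀ (y : V) (t : ℝ), P (c y + t • ξ) = y := by
  let L : V →L[ℝ] W := c.linearIsometry.toContinuousLinearMap
  have hL : ∀ τ, L.adjoint (c.linearIsometry τ) = τ := by
    intro τ
    refine ext_inner_right ℝ fun w => ?_
    rw [ContinuousLinearMap.adjoint_inner_left]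
    exact c.linearIsometry.inner_map_map τ w
  let P : W → V := fun x => L.adjoint (x - c 0 - ((inner ℝ ν (x - c 0) : ℝ) / inner ℝ ν ξ) • ξ)
  have hP : ContDiff ℝ ∞ P := by
    refine L.adjoint.contDiff.comp ?_
    refine (contDiff_id.sub contDiff_const).sub (ContDiff.smul ?_ contDiff_const)
    exact (contDiff_const.inner ℝ (contDiff_id.sub contDiff_const)).div_const _
  have hx : ∀ x, x = c (P x) + ((inner ℝ ν (x - c 0) : ℝ) / inner ℝ ν ξ) • ξ := by
    intro x
    obtain ⟨τ, hτ⟩ := h.exists_eq_add (x - c 0 - ((inner ℝ ν (x - c 0) : ℝ) / inner ℝ ν ξ) • ξ)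
    have h0 : (inner ℝ ν (x - c 0 - ((inner ℝ ν (x - c 0) : ℝ) / inner ℝ ν ξ) • ξ) : ℝ) = 0 := by
      rw [inner_sub_right, inner_smul_right, div_mul_cancel₀ _ hξ, sub_self]
    rw [h0, zero_smul, add_zero] at hτ
    have h1 : P x = τ := by simp only [P]; rw [hτ, hL]
    have h2 := c.apply_add 0 τ
    rw [zero_add] at h2
    rw [h1, h2, ← hτ]; abel
  refine ⟨P, hP, hx, fun y t => c.injective ?_⟩
  have h1 := hx (c y + t • ξ)
  have h2 : (inner ℝ ν (c y + t • ξ - c 0) : ℝ) / inner ℝ ν ξ = t := by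
    rw [add_sub_right_comm, inner_add_right, h.inner_sub_eq_zero, inner_smul_right, zero_add,
      mul_div_cancel_right₀ _ hξ]
  rw [h2] at h1
  exact (add_right_cancel h1).symm

end ObliqueProjection

/-- A smooth profile equal to one near zero and vanishing near one. -/
noncomputable def traceProfile (t : ℝ) : ℝ := Real.smoothTransition (2 - 3 * t)

theorem contDiff_traceProfile : ContDiff ℝ ∞ traceProfile :=
  Real.smoothTransition.contDiff.comp (contDiff_const.sub (contDiff_const.mul contDiff_id))

theorem traceProfile_zero : traceProfile 0 = 1 :=
  Real.smoothTransition.one_of_one_le (by norm_num)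

theorem traceProfile_eq_zero {t : ℝ} (ht : 2 / 3 ≤ t) : traceProfile t = 0 :=
  Real.smoothTransition.zero_of_nonpos (by linarith)

/-- `traceProfile` does not vanish for negative `t`. Cutting it off below `-δ` gives test functions
of compact support, and nothing changes on the inner side `t ≥ 0`. -/
theorem exists_localProfile {δ : ℝ} (hδ : 0 < δ) : ∃ β : ℝ → ℝ, ContDiff ℝ ∞ β ∧
    (∀ t, 0 ≤ t → β t = traceProfile t) ∧ ∀ t, β t ≠ 0 → t ∈ Set.Icc (-δ) (2 / 3) := by
  refine ⟨fun t => traceProfile t * Real.smoothTransition (1 + t / δ),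
    contDiff_traceProfile.mul (Real.smoothTransition.contDiff.comp
      (contDiff_const.add (contDiff_id.div_const _))), fun t ht => ?_, fun t ht => ⟨?_, ?_⟩⟩
  · have h1 : 1 ≤ 1 + t / δ := by have := div_nonneg ht hδ.le; linarith
    simp only [Real.smoothTransition.one_of_one_le h1, mul_one]
  · by_contra hc
    apply ht
    have h1 : 1 + t / δ ≤ 0 := by
      have : t / δ ≤ -1 := by rw [div_le_iff₀ hδ]; linarith [not_le.1 hc]
      linarith
    simp only [Real.smoothTransition.zero_of_nonpos h1, mul_zero]
  · by_contra hc
    apply ht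
    simp only [traceProfile_eq_zero (not_le.1 hc).le, zero_mul]

namespace PolytopalDomain

variable {d n : ℕ} (K : PolytopalDomain d n)

/-- The part of the face number `i` from which the direction `ξ` leads into the domain, at least up
to the parameter one. -/
def visible (i : Fin n) (ξ : EuclideanSpace ℝ (Fin d)) : Set (EuclideanSpace ℝ (Fin (d - 1))) :=
  {y | y ∈ K.face i ∧ ∀ t ∈ Set.Ioc (0 : ℝ) 1, K.chart i y + t • ξ ∈ K.carrier}

variable {K}

theorem inner_neg_of_mem_visible {i : Fin n} {ξ : EuclideanSpace ℝ (Fin d)}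
    {y : EuclideanSpace ℝ (Fin (d - 1))} (hy : y ∈ K.visible i ξ) :
    (inner ℝ (K.normal i) ξ : ℝ) < 0 := by
  obtain ⟨ρ, hρ, h1, -⟩ := K.exists_ball_oneSided hy.1
  set t : ℝ := min 1 (ρ / (2 * (‖ξ‖ + 1))) with ht
  have ht0 : 0 < t := lt_min one_pos (by positivity)
  have h2 := hy.2 t ⟨ht0, min_le_left _ _⟩
  have h3 : K.chart i y + t • ξ ∈ Metric.ball (K.chart i y) ρ := by
    rw [Metric.mem_ball, dist_eq_norm, add_sub_cancel_left, norm_smul, Real.norm_of_nonneg ht0.le]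
    have h4 : t * (2 * (‖ξ‖ + 1)) ≤ ρ := by
      rw [← le_div_iff₀ (by positivity)]; exact min_le_right _ _
    nlinarith [norm_nonneg ξ]
  rw [h1 _ h3, add_sub_cancel_left, inner_smul_right] at h2
  exact neg_of_mul_neg_right h2 ht0.le

/-- For parameters in the compact interval `[δ, 1]` the condition is stable because `K` is open. For
parameters below `δ` the point stays in a ball where `K` is a half space, and `ξ` points strictly
into it. -/
theorem isOpen_visible (hd : 1 ≤ d) (i : Fin n) (ξ : EuclideanSpace ℝ (Fin d)) :
    IsOpen (K.visible i ξ) := by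
  rw [isOpen_iff_mem_nhds]
  intro y hy
  have hn := inner_neg_of_mem_visible hy
  obtain ⟨ρ, hρ, h1, h2⟩ := K.exists_ball_oneSided hy.1
  set δ : ℝ := ρ / (2 * (‖ξ‖ + 1)) with hδ
  have hδ0 : 0 < δ := by positivity
  have hδ1 : δ * (2 * (‖ξ‖ + 1)) = ρ := by rw [hδ]; field_simp
  have h3 : ∀ᶠ z in 𝓝 y, ∀ t ∈ Set.Icc δ 1, K.chart i z + t • ξ ∈ K.carrier := by
    refine isCompact_Icc.eventually_forall_of_forall_eventually fun t ht => ?_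
    have hc : ContinuousAt (fun p : EuclideanSpace ℝ (Fin (d - 1)) × ℝ => K.chart i p.1 + p.2 • ξ)
        (y, t) := (((K.chart i).continuous.comp continuous_fst).add
          (continuous_snd.smul continuous_const)).continuousAt
    exact hc.eventually (K.isOpen.mem_nhds (hy.2 t ⟨hδ0.trans_le ht.1, ht.2⟩))
  filter_upwards [h3, Metric.ball_mem_nhds y (half_pos hρ)] with z hz hz'
  refine ⟨h2 (Metric.ball_subset_ball (half_le_self hρ.le) hz'), fun t ht => ?_⟩
  rcases le_or_gt δ t with h4 | h4
  · exact hz t ⟨h4, ht.2⟩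
  have h5 : K.chart i z + t • ξ ∈ Metric.ball (K.chart i y) ρ := by
    rw [Metric.mem_ball, dist_eq_norm, add_sub_right_comm]
    refine (norm_add_le _ _).trans_lt ?_
    rw [← dist_eq_norm, (K.chart i).dist_map, norm_smul, Real.norm_of_nonneg ht.1.le]
    have := Metric.mem_ball.1 hz'
    nlinarith [norm_nonneg ξ]
  rw [h1 _ h5, add_sub_right_comm, inner_add_right,
    (K.isHyperplaneChart hd i).inner_sub_eq_zero, inner_smul_right, zero_add]
  exact mul_neg_of_pos_of_neg ht.1 hn

variable (K) in
/-- The boundary values on the face number `i` computed from the function and its gradient on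
segments in the direction `ξ`. -/
noncomputable def obliqueTrace (i : Fin n) (ξ : EuclideanSpace ℝ (Fin d))
    (v : EuclideanSpace ℝ (Fin d) → ℝ) (G : EuclideanSpace ℝ (Fin d) → EuclideanSpace ℝ (Fin d))
    (y : EuclideanSpace ℝ (Fin (d - 1))) : ℝ :=
  -∫ t in Set.Ioo (0 : ℝ) 1, (v (K.chart i y + t • ξ) * deriv traceProfile t +
    inner ℝ (G (K.chart i y + t • ξ)) ξ * traceProfile t)

/-- The half space description is provided on the doubled ball because segments starting within
distance `r` are later prolonged backwards, out of `K`, by less than `r`. -/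
theorem exists_ball_visible (hd : 1 ≤ d) {i : Fin n} {ξ : EuclideanSpace ℝ (Fin d)}
    {y₀ : EuclideanSpace ℝ (Fin (d - 1))} (hy₀ : y₀ ∈ K.visible i ξ) :
    ∃ r > 0, (∀ x ∈ Metric.ball (K.chart i y₀) (2 * r),
      (x ∈ K.carrier ↔ (inner ℝ (K.normal i) (x - K.chart i y₀) : ℝ) < 0)) ∧
      Metric.ball y₀ r ⊆ K.visible i ξ ∧
      ∀ j, j ≠ i → Disjoint (Metric.ball (K.chart i y₀) r) (K.chart j '' closure (K.face j)) := by
  obtain ⟨ρ, hρ, h1, -⟩ := K.exists_ball_oneSided hy₀.1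
  obtain ⟨r₁, hr₁, h2⟩ := Metric.isOpen_iff.1 (isOpen_visible hd i ξ) y₀ hy₀
  have hcl : ∀ j, IsClosed (K.chart j '' closure (K.face j)) := fun j =>
    ((K.face_region j).isBounded.isCompact_closure.image (K.chart j).continuous).isClosed
  have h3 : ∀ᶠ x in 𝓝 (K.chart i y₀), ∀ j, j ≠ i → x ∉ K.chart j '' closure (K.face j) := by
    rw [Filter.eventually_all]
    intro j
    by_cases hj : j = i
    · exact Filter.Eventually.of_forall fun x h => absurd hj h
    · filter_upwards [(hcl j).isOpen_compl.mem_nhds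
        (K.chart_notMem_image_closure hd (Ne.symm hj) hy₀.1)] with x hx _ using hx
  obtain ⟨r₂, hr₂, h4⟩ := Metric.eventually_nhds_iff_ball.1 h3
  refine ⟨min (ρ / 2) (min r₁ r₂), by positivity, fun x hx => h1 x ?_, ?_, fun j hj => ?_⟩
  · refine Metric.ball_subset_ball ?_ hx
    have := min_le_left (ρ / 2) (min r₁ r₂)
    linarith
  · exact (Metric.ball_subset_ball ((min_le_right _ _).trans (min_le_left _ _))).trans h2
  · rw [Set.disjoint_left]
    intro x hx
    exact h4 x (Metric.ball_subset_ball ((min_le_right _ _).trans (min_le_right _ _)) hx) j hj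

/-- The pairing vanishes in tangential directions and for test functions that vanish on the plane
(`greenPairing_eq_zero_of_halfSpace`). Therefore `a` may be replaced by a multiple of `ξ`, and `φ`
by the function `ψ` with the same values on the plane that is a product in the coordinates along
`ξ`. Its derivative along `ξ` falls on the profile alone, so Fubini in these coordinates leaves on
each segment the integral that defines `obliqueTrace`. -/
theorem greenPairing_eq_obliqueTrace (hd : 1 ≤ d) {v : EuclideanSpace ℝ (Fin d) → ℝ}
    {G : EuclideanSpace ℝ (Fin d) → EuclideanSpace ℝ (Fin d)} (h : IsSobolevPair K.carrier v G)
    {i : Fin n} {ξ : EuclideanSpace ℝ (Fin d)} {y₀ : EuclideanSpace ℝ (Fin (d - 1))} {r : ℝ}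
    (hr : 0 < r) (hn : (inner ℝ (K.normal i) ξ : ℝ) < 0)
    (hK : ∀ x ∈ Metric.ball (K.chart i y₀) (2 * r),
      (x ∈ K.carrier ↔ (inner ℝ (K.normal i) (x - K.chart i y₀) : ℝ) < 0))
    (hvis : Metric.ball y₀ r ⊆ K.visible i ξ) {φ : EuclideanSpace ℝ (Fin d) → ℝ}
    (hφ : ContDiff ℝ ∞ φ) (hc : HasCompactSupport φ)
    (hs : tsupport φ ⊆ Metric.ball (K.chart i y₀) r) (a : EuclideanSpace ℝ (Fin d)) :
    greenPairing K.carrier v G φ a =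
      ∫ y in K.face i, K.obliqueTrace i ξ v G y * φ (K.chart i y) * inner ℝ (K.normal i) a := by
  have hcr := K.isHyperplaneChart hd i
  set c := K.chart i with hcdef
  set ν := K.normal i with hνdef
  set q : ℝ := inner ℝ ν ξ with hq
  have hq0 : q ≠ 0 := hn.ne
  have hb := K.isBounded
  have hm := K.isOpen.measurableSet
  obtain ⟨P, hP, hPx, hPc⟩ := hcr.exists_obliqueProjection hq0
  set T : EuclideanSpace ℝ (Fin d) → ℝ := fun x => (inner ℝ ν (x - c 0) : ℝ) / q with hTdef
  have hTs : ContDiff ℝ ∞ T :=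
    (contDiff_const.inner ℝ (contDiff_id.sub contDiff_const)).div_const _
  have hTc : ∀ y t, T (c y + t • ξ) = t := by
    intro y t
    simp only [hTdef]
    rw [add_sub_right_comm, inner_add_right, hcr.inner_sub_eq_zero, inner_smul_right, zero_add,
      mul_div_cancel_right₀ _ hq0]
  -- Then `δ ‖ξ‖ < r`, so prolonging a segment backwards by the parameter `δ` stays in the ball of
  -- radius `2 * r`.
  set δ : ℝ := r / (‖ξ‖ + 1) with hδ
  have hδ0 : 0 < δ := by positivity
  have hδ1 : δ * (‖ξ‖ + 1) = r := by rw [hδ]; field_simp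
  obtain ⟨β, hβ, hβp, hβs⟩ := exists_localProfile hδ0
  set f : EuclideanSpace ℝ (Fin (d - 1)) → ℝ := fun y => φ (c y) with hf
  have hfs : ∀ y ∈ tsupport f, y ∈ Metric.ball y₀ r := by
    intro y hy
    have h1 : c y ∈ tsupport φ := tsupport_comp_subset_preimage φ c.continuous hy
    have h2 := hs h1
    rwa [Metric.mem_ball, c.dist_map] at h2
  have hfc : HasCompactSupport f := by
    refine HasCompactSupport.of_support_subset_isCompact
      (isCompact_closedBall y₀ r) fun y hy => ?_
    exact Metric.ball_subset_closedBall (hfs y (subset_tsupport f hy))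
  set ψ : EuclideanSpace ℝ (Fin d) → ℝ := fun x => f (P x) * β (T x) with hψdef
  have hfsm : ContDiff ℝ ∞ f := hφ.comp c.contDiff_coe
  have hψ : ContDiff ℝ ∞ ψ := (hfsm.comp hP).mul (hβ.comp hTs)
  set A : EuclideanSpace ℝ (Fin (d - 1)) × ℝ → EuclideanSpace ℝ (Fin d) :=
    fun p => c p.1 + p.2 • ξ with hA
  have hAc : Continuous A := (c.continuous.comp continuous_fst).add
    (continuous_snd.smul continuous_const)
  have hcomp : IsCompact (A '' (tsupport f ×ˢ Set.Icc (-δ) (2 / 3))) :=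
    (hfc.isCompact.prod isCompact_Icc).image hAc
  have hψsub : Function.support ψ ⊆ A '' (tsupport f ×ˢ Set.Icc (-δ) (2 / 3)) := by
    intro x hx
    refine ⟨(P x, T x), ⟨subset_tsupport f (left_ne_zero_of_mul hx),
      hβs _ (right_ne_zero_of_mul hx)⟩, ?_⟩
    exact (hPx x).symm
  have hψc : HasCompactSupport ψ := HasCompactSupport.of_support_subset_isCompact hcomp hψsub
  have hψts : tsupport ψ ⊆ A '' (tsupport f ×ˢ Set.Icc (-δ) (2 / 3)) :=
    closure_minimal hψsub hcomp.isClosed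
  -- the half space condition
  have hTν : ∀ x, (inner ℝ (-ν) x : ℝ) + inner ℝ ν (c y₀) = -(inner ℝ ν (x - c y₀) : ℝ) := by
    intro x; rw [inner_neg_left, inner_sub_right]; ring
  have hAν : ∀ y t, (inner ℝ ν (c y + t • ξ - c y₀) : ℝ) = t * q := by
    intro y t
    rw [add_sub_right_comm, inner_add_right, hcr.inner_sub_eq_zero, inner_smul_right, zero_add]
  have hHφ : ∀ x ∈ tsupport φ, (x ∈ K.carrier ↔ 0 < (inner ℝ (-ν) x : ℝ) + inner ℝ ν (c y₀)) := by
    intro x hx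
    rw [hTν, hK x (Metric.ball_subset_ball (by linarith) (hs hx))]
    simp only [Left.neg_pos_iff]
  have hψK : ∀ y ∈ tsupport f, ∀ t ∈ Set.Icc (-δ) (2 / 3), (c y + t • ξ ∈ K.carrier ↔ 0 < t) := by
    intro y hy t ht
    refine ⟨fun hx => ?_, fun h0 => (hvis (hfs y hy)).2 t ⟨h0, by linarith [ht.2]⟩⟩
    by_contra h0
    have h0' := not_lt.1 h0
    have hball : c y + t • ξ ∈ Metric.ball (c y₀) (2 * r) := by
      rw [Metric.mem_ball, dist_eq_norm, add_sub_right_comm]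
      refine (norm_add_le _ _).trans_lt ?_
      rw [← dist_eq_norm, c.dist_map, norm_smul, Real.norm_of_nonpos h0']
      have := Metric.mem_ball.1 (hfs y hy)
      nlinarith [norm_nonneg ξ, ht.1]
    rw [hK _ hball] at hx
    rw [hAν] at hx
    nlinarith
  have hHψ : ∀ x ∈ tsupport ψ, (x ∈ K.carrier ↔ 0 < (inner ℝ (-ν) x : ℝ) + inner ℝ ν (c y₀)) := by
    intro x hx
    obtain ⟨⟨y, t⟩, ⟨hy, ht⟩, rfl⟩ := hψts hx
    rw [hTν]
    simp only [hA]
    rw [hAν, hψK y hy t ht]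
    constructor <;> intro h0 <;> nlinarith
  -- the reduction to the direction `ξ` and to the function `ψ`
  have hψξ : ∀ x, fderiv ℝ ψ x ξ = f (P x) * deriv β (T x) := by
    intro x
    have h1 : HasDerivAt (fun s : ℝ => ψ (x + s • ξ)) (fderiv ℝ ψ x ξ) 0 := by
      have h2 : HasDerivAt (fun s : ℝ => x + s • ξ) ξ 0 := by
        simpa using ((hasDerivAt_id (0 : ℝ)).smul_const ξ).const_add x
      have h3 : HasFDerivAt ψ (fderiv ℝ ψ x) (x + (0 : ℝ) • ξ) := by
        rw [zero_smul, add_zero]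
        exact (hψ.differentiable (by simp) x).hasFDerivAt
      exact h3.comp_hasDerivAt (0 : ℝ) h2
    have h4 : (fun s : ℝ => ψ (x + s • ξ)) = fun s => f (P x) * β (T x + s) := by
      funext s
      have h5 : x + s • ξ = c (P x) + (T x + s) • ξ := by
        conv_lhs => rw [hPx x]
        rw [add_smul, add_assoc]
      simp only [hψdef]
      rw [h5, hPc, hTc]
    have h6 : HasDerivAt (fun s => f (P x) * β (T x + s)) (f (P x) * deriv β (T x)) 0 := by
      have h7 : HasDerivAt β (deriv β (T x)) (T x + 0) := by
        rw [add_zero]; exact (hβ.differentiable (by simp) _).hasDerivAt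
      simpa using (h7.comp_const_add (T x) 0).const_mul (f (P x))
    rw [h4] at h1
    exact h1.unique h6
  have hβ0 : β 0 = 1 := by rw [hβp 0 le_rfl, traceProfile_zero]
  have hξ : greenPairing K.carrier v G φ ξ = greenPairing K.carrier v G ψ ξ := by
    have h1 : greenPairing K.carrier v G (fun x => φ x + (-1) * ψ x) ξ = 0 := by
      have hcs : HasCompactSupport (fun x => (-1) * ψ x) := hψc.mul_left
      refine h.greenPairing_eq_zero_of_halfSpace hb hm (hφ.add (contDiff_const.mul hψ))
        (hc.add hcs) (τ := -ν) (b := inner ℝ ν (c y₀)) ?_ (Or.inr fun x hx => ?_)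
      · intro x hx
        rcases tsupport_add φ (fun x => (-1) * ψ x) hx with h2 | h2
        · exact hHφ x h2
        · exact hHψ x (tsupport_mul_subset_right h2)
      · rw [hTν, neg_eq_zero] at hx
        have h2 : T x = 0 := by
          have : (inner ℝ ν (x - c 0) : ℝ) = 0 := by
            have h3 := hcr.inner_sub_eq_zero y₀ 0
            rw [← sub_add_sub_cancel x (c y₀) (c 0), inner_add_right, hx, h3, add_zero]
          simp only [hTdef]; rw [this, zero_div]
        have h3 := hPx x
        change x = c (P x) + T x • ξ at h3
        rw [h2, zero_smul, add_zero] at h3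
        simp only [hψdef, hf]
        rw [h2, hβ0, ← h3]; ring
    rw [h.greenPairing_add hb hm hφ (contDiff_const.mul hψ)] at h1
    have h2 : greenPairing K.carrier v G (fun x => (-1) * ψ x) ξ =
        -greenPairing K.carrier v G ψ ξ := by
      unfold greenPairing
      rw [← integral_neg]
      congr 1; funext x
      rw [fderiv_const_mul (hψ.differentiable (by simp) x)]
      simp; ring
    linarith
  have ha : greenPairing K.carrier v G φ a =
      (inner ℝ ν a : ℝ) / q * greenPairing K.carrier v G φ ξ := by
    have h1 := h.greenPairing_dir_add hb hm hφ (a - ((inner ℝ ν a : ℝ) / q) • ξ) ξ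
      ((inner ℝ ν a : ℝ) / q)
    rw [sub_add_cancel] at h1
    rw [h1, h.greenPairing_eq_zero_of_halfSpace hb hm hφ hc hHφ (Or.inl ?_), zero_add]
    rw [inner_neg_left, inner_sub_right, inner_smul_right, div_mul_cancel₀ _ hq0, sub_self,
      neg_zero]
  -- Fubini
  have hfub : greenPairing K.carrier v G ψ ξ = |q| * ∫ y, f y * -K.obliqueTrace i ξ v G y := by
    unfold greenPairing
    rw [← integral_indicator hm, hcr.integral_oblique hq0
      ((integrable_indicator_iff hm).2 (h.integrable_pairing hb hm hψ ξ))]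
    congr 1
    refine integral_congr_ae (Filter.Eventually.of_forall fun y => ?_)
    simp only [obliqueTrace, neg_neg]
    rw [← integral_const_mul, ← integral_indicator measurableSet_Ioo]
    refine integral_congr_ae (Filter.Eventually.of_forall fun t => ?_)
    simp only []
    by_cases hy : y ∈ tsupport f
    swap
    · have hy0 : f y = 0 := image_eq_zero_of_notMem_tsupport hy
      have h1 : ψ (c y + t • ξ) = 0 := by simp only [hψdef]; rw [hPc, hy0, zero_mul]
      have h2 : fderiv ℝ ψ (c y + t • ξ) ξ = 0 := by rw [hψξ, hPc, hy0, zero_mul]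
      simp only [Set.indicator, hy0, zero_mul]
      rw [h1, h2]; simp
    have hval : ψ (c y + t • ξ) = f y * β t := by simp only [hψdef]; rw [hPc, hTc]
    have hder : fderiv ℝ ψ (c y + t • ξ) ξ = f y * deriv β t := by rw [hψξ, hPc, hTc]
    by_cases ht : t ∈ Set.Ioo (0 : ℝ) 1
    · rw [Set.indicator_of_mem ht,
        Set.indicator_of_mem ((hvis (hfs y hy)).2 t ⟨ht.1, ht.2.le⟩), hval, hder, hβp t ht.1.le]
      have h1 : β =ᶠ[𝓝 t] traceProfile := by
        filter_upwards [lt_mem_nhds ht.1] with s hs using hβp s hs.le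
      rw [h1.deriv_eq]; ring
    · rw [Set.indicator_of_notMem ht]
      by_cases hx : c y + t • ξ ∈ K.carrier
      swap
      · exact Set.indicator_of_notMem hx _
      rw [Set.indicator_of_mem hx]
      -- The line may meet `K` outside the parameters in `(0, 1)`, but such points are not in the
      -- support of `ψ`: there the coordinates are unique, the parameter is at most `2 / 3`, and it
      -- is positive inside `K`.
      have hnt : c y + t • ξ ∉ tsupport ψ := by
        intro h1
        obtain ⟨⟨y', t'⟩, ⟨hy', ht'⟩, he⟩ := hψts h1
        have h2 : t' = t := by
          have := congrArg T he
          simp only [hA] at this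
          rwa [hTc, hTc] at this
        have h3 : y' = y := by
          have := congrArg P he
          simp only [hA] at this
          rwa [hPc, hPc] at this
        subst h2; subst h3
        exact ht ⟨(hψK _ hy' _ ht').1 hx, by linarith [ht'.2]⟩
      rw [image_eq_zero_of_notMem_tsupport hnt, fderiv_of_notMem_tsupport (𝕜 := ℝ) hnt]
      simp
  rw [ha, hξ, hfub, abs_of_neg hn, setIntegral_eq_integral_of_forall_compl_eq_zero]
  · rw [← mul_assoc, ← integral_const_mul]
    congr 1; funext y
    simp only [hf]
    field_simp
  · intro y hy
    have : f y = 0 := by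
      by_contra h0
      exact hy (hvis (hfs y (subset_tsupport f h0))).1
    simp only [hf] at this
    rw [this]; simp

end PolytopalDomain

/-! ### Localizing the Gauss–Green formula and removing codimension two -/

open scoped Manifold in
theorem exists_smooth_one_nhds {m : ℕ} {C O : Set (EuclideanSpace ℝ (Fin m))} (hC : IsCompact C)
    (hO : IsOpen O) (hCO : C ⊆ O) : ∃ χ : EuclideanSpace ℝ (Fin m) → ℝ, ContDiff ℝ ∞ χ ∧
      HasCompactSupport χ ∧ tsupport χ ⊆ O ∧ (∀ᶠ x in 𝓝ˢ C, χ x = 1) ∧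
      ∀ x, 0 ≤ χ x ∧ χ x ≤ 1 := by
  obtain ⟨C', hC', hCC', hC'O⟩ := exists_compact_between hC hO hCO
  obtain ⟨f, hf1, hf0, hf⟩ := exists_contMDiffMap_one_nhds_of_subset_interior
    𝓘(ℝ, EuclideanSpace ℝ (Fin m)) (n := (⊤ : ℕ∞)) hC.isClosed hCC'
  have hs : Function.support f ⊆ C' := fun x hx => by
    by_contra h
    exact hx (hf0 x h)
  exact ⟨f, f.contMDiff.contDiff, HasCompactSupport.of_support_subset_isCompact hC' hs,
    (closure_minimal hs hC'.isClosed).trans hC'O, hf1, hf⟩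

theorem volume_hyperplane {V : Type*} [NormedAddCommGroup V] [InnerProductSpace ℝ V]
    [FiniteDimensional ℝ V] [MeasurableSpace V] [BorelSpace V] {p : V} (hp : p ≠ 0) (c : ℝ) :
    volume {y : V | (inner ℝ p y : ℝ) = c} = 0 := by
  by_cases hne : ∃ y₀ : V, (inner ℝ p y₀ : ℝ) = c
  swap
  · have : {y : V | (inner ℝ p y : ℝ) = c} = ∅ := by
      ext y; simp only [Set.mem_ofPred_eq, Set.mem_empty_iff_false, iff_false]
      exact fun h => hne ⟨y, h⟩
    rw [this, measure_empty]
  obtain ⟨y₀, hy₀⟩ := hne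
  have h1 : {y : V | (inner ℝ p y : ℝ) = c} =
      (fun y => y + -y₀) ⁻¹' ((LinearMap.ker (innerSL ℝ p).toLinearMap : Submodule ℝ V) : Set V) := by
    ext y
    simp [← sub_eq_add_neg, inner_sub_right, hy₀, sub_eq_zero]
  rw [h1, measure_preimage_add_right]
  refine Measure.addHaar_submodule _ _ fun h => ?_
  have h2 : p ∈ (LinearMap.ker (innerSL ℝ p).toLinearMap : Submodule ℝ V) := by rw [h]; trivial
  simp at h2
  exact hp h2

/-- The `ε`-neighbourhood of a bounded piece of an affine subspace of codimension two has measure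
of order `ε²`. -/
theorem exists_volume_inter_le_sq {d : ℕ} (hd : 2 ≤ d) {B : Set (EuclideanSpace ℝ (Fin d))}
    (hB : Bornology.IsBounded B) {u w : EuclideanSpace ℝ (Fin d)} (hu : ‖u‖ = 1) (hw : ‖w‖ = 1)
    (huw : (inner ℝ u w : ℝ) = 0) (α β : ℝ) : ∃ C, 0 ≤ C ∧ ∀ ε, 0 ≤ ε →
      volume (B ∩ {x | |(inner ℝ u x : ℝ) - α| ≤ ε ∧ |(inner ℝ w x : ℝ) - β| ≤ ε}) ≤
        ENNReal.ofReal (C * ε ^ 2) := by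
  obtain ⟨k, rfl⟩ : ∃ k, d = k + 2 := ⟨d - 2, by omega⟩
  let f : Fin (k + 2) → EuclideanSpace ℝ (Fin (k + 2)) := fun i => if i = 0 then u else w
  have hf : Orthonormal ℝ (({0, 1} : Set (Fin (k + 2))).domRestrict f) := by
    have h01 : (1 : Fin (k + 2)) ≠ 0 := by simp
    constructor
    · rintro ⟨i, rfl | rfl⟩
      · simpa [f, Set.domRestrict] using hu
      · simpa [f, h01, Set.domRestrict] using hw
    · rintro ⟨i, hi⟩ ⟨j, hj⟩ hij
      rcases hi with rfl | rfl <;> rcases hj with rfl | rfl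
      · exact absurd rfl hij
      · simpa [f, h01, Set.domRestrict] using huw
      · simpa [f, h01, Set.domRestrict, real_inner_comm] using huw
      · exact absurd rfl hij
  obtain ⟨b, hb⟩ := hf.exists_orthonormalBasis_extension_of_card_eq (by simp)
  have hb0 : b 0 = u := by rw [hb 0 (by simp)]; simp [f]
  have hb1 : b 1 = w := by rw [hb 1 (by simp)]; simp [f]
  obtain ⟨R, hR0, hR⟩ := hB.exists_pos_norm_le
  -- In an orthonormal basis extending `u, w`, the set lies in a box with two sides of length `2 *
  -- ε` and `k` sides of length `2 * R`.
  refine ⟨4 * (2 * R) ^ k, by positivity, fun ε hε => ?_⟩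
  let S : Fin (k + 2) → Set ℝ :=
    Fin.cons (Set.Icc (α - ε) (α + ε)) (Fin.cons (Set.Icc (β - ε) (β + ε))
      fun _ => Set.Icc (-R) R)
  have hmp : MeasurePreserving (fun x => WithLp.ofLp (b.repr x)) volume
      (volume : Measure (Fin (k + 2) → ℝ)) :=
    (PiLp.volume_preserving_ofLp (Fin (k + 2))).comp b.measurePreserving_repr
  have hsub : B ∩ {x | |(inner ℝ u x : ℝ) - α| ≤ ε ∧ |(inner ℝ w x : ℝ) - β| ≤ ε} ⊆
      (fun x => WithLp.ofLp (b.repr x)) ⁻¹' (Set.univ.pi S) := by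
    rintro x ⟨hx, h1, h2⟩
    simp only [Set.mem_preimage, Set.mem_univ_pi]
    intro i
    rw [b.repr_apply_apply]
    refine Fin.cases ?_ (fun i => Fin.cases ?_ (fun i => ?_) i) i
    · rw [hb0]; have := abs_le.1 h1
      exact ⟨by linarith, by linarith⟩
    · have : (Fin.succ 0 : Fin (k + 2)) = 1 := rfl
      rw [this, hb1]; have := abs_le.1 h2
      exact ⟨by linarith, by linarith⟩
    · have h3 := abs_real_inner_le_norm (b i.succ.succ) x
      rw [b.norm_eq_one, one_mul] at h3
      exact abs_le.1 (h3.trans (hR x hx))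
  refine (measure_mono hsub).trans ?_
  have hSm : MeasurableSet (Set.univ.pi S) := by
    refine MeasurableSet.univ_pi fun i => ?_
    refine Fin.cases ?_ (fun i => Fin.cases ?_ (fun i => ?_) i) i
    · exact measurableSet_Icc
    · exact measurableSet_Icc
    · exact measurableSet_Icc
  rw [hmp.measure_preimage hSm.nullMeasurableSet, volume_pi_pi, Fin.prod_univ_succ,
    Fin.prod_univ_succ]
  have e0 : volume (S 0) = ENNReal.ofReal (2 * ε) := by
    change volume (Set.Icc (α - ε) (α + ε)) = _
    rw [Real.volume_Icc]; congr 1; ring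
  have e1 : volume (S (Fin.succ 0)) = ENNReal.ofReal (2 * ε) := by
    change volume (Set.Icc (β - ε) (β + ε)) = _
    rw [Real.volume_Icc]; congr 1; ring
  have e2 : ∀ i : Fin k, volume (S i.succ.succ) = ENNReal.ofReal (2 * R) := by
    intro i
    change volume (Set.Icc (-R) R) = _
    rw [Real.volume_Icc]; congr 1; ring
  simp only [e2]
  rw [e0, e1]
  rw [Finset.prod_const, Finset.card_univ, Fintype.card_fin, ← ENNReal.ofReal_pow (by positivity),
    ← ENNReal.ofReal_mul (by positivity), ← ENNReal.ofReal_mul (by positivity)]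
  apply ENNReal.ofReal_le_ofReal
  nlinarith

theorem integral_mul_sq_le {α : Type*} [MeasurableSpace α] {μ : Measure α} {f g : α → ℝ}
    (hf : MemLp f 2 μ) (hg : MemLp g 2 μ) :
    (∫ x, |f x| * |g x| ∂μ) ^ 2 ≤ (∫ x, f x ^ 2 ∂μ) * ∫ x, g x ^ 2 ∂μ := by
  have h := integral_mul_le_Lp_mul_Lq_of_nonneg (μ := μ) (p := 2) (q := 2)
    Real.HolderConjugate.two_two (f := fun x => |f x|) (g := fun x => |g x|)
    (Filter.Eventually.of_forall fun x => abs_nonneg _)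
    (Filter.Eventually.of_forall fun x => abs_nonneg _)
    (by rw [ENNReal.ofReal_ofNat]; exact hf.abs) (by rw [ENNReal.ofReal_ofNat]; exact hg.abs)
  have h1 : 0 ≤ ∫ x, f x ^ 2 ∂μ := integral_nonneg fun x => sq_nonneg _
  have h2 : 0 ≤ ∫ x, g x ^ 2 ∂μ := integral_nonneg fun x => sq_nonneg _
  have e1 : ∀ f : α → ℝ, ∫ x, |f x| ^ (2 : ℝ) ∂μ = ∫ x, f x ^ 2 ∂μ := fun f => by
    congr 1; funext x; rw [Real.rpow_two, sq_abs]
  rw [e1, e1, ← Real.sqrt_eq_rpow, ← Real.sqrt_eq_rpow] at h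
  have h0 : 0 ≤ ∫ x, |f x| * |g x| ∂μ := integral_nonneg fun x => by positivity
  calc _ ≤ (√(∫ x, f x ^ 2 ∂μ) * √(∫ x, g x ^ 2 ∂μ)) ^ 2 := by gcongr
    _ = _ := by rw [mul_pow, Real.sq_sqrt h1, Real.sq_sqrt h2]

namespace PolytopalDomain

variable {d n : ℕ} (K : PolytopalDomain d n)

/-- The boundary side of the Gauss-Green formula. -/
noncomputable def boundaryPairing (g : Fin n → EuclideanSpace ℝ (Fin (d - 1)) → ℝ)
    (φ : EuclideanSpace ℝ (Fin d) → ℝ) (a : EuclideanSpace ℝ (Fin d)) : ℝ :=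
  ∑ i, ∫ y in K.face i, g i y * φ (K.chart i y) * inner ℝ (K.normal i) a

/-- The Gauss-Green formula with boundary values `g`, for test functions supported in `O`. -/
def HasGreenOn (v : EuclideanSpace ℝ (Fin d) → ℝ)
    (G : EuclideanSpace ℝ (Fin d) → EuclideanSpace ℝ (Fin d))
    (g : Fin n → EuclideanSpace ℝ (Fin (d - 1)) → ℝ) (O : Set (EuclideanSpace ℝ (Fin d))) : Prop :=
  ∀ φ : EuclideanSpace ℝ (Fin d) → ℝ, ContDiff ℝ ∞ φ → HasCompactSupport φ → tsupport φ ⊆ O →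
    ∀ a, greenPairing K.carrier v G φ a = K.boundaryPairing g φ a

variable {K} {v : EuclideanSpace ℝ (Fin d) → ℝ}
  {G : EuclideanSpace ℝ (Fin d) → EuclideanSpace ℝ (Fin d)}
  {g : Fin n → EuclideanSpace ℝ (Fin (d - 1)) → ℝ}

theorem integrable_boundary (hg : ∀ i, MemLp (g i) 2 (volume.restrict (K.face i)))
    {φ : EuclideanSpace ℝ (Fin d) → ℝ} (hφ : Continuous φ) (a : EuclideanSpace ℝ (Fin d))
    (i : Fin n) : Integrable (fun y => g i y * φ (K.chart i y) * inner ℝ (K.normal i) a)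
      (volume.restrict (K.face i)) :=
  (integrable_mul_of_isBounded (K.face_region i).isBounded (K.face_region i).isOpen.measurableSet
    (hg i) (hφ.comp (K.chart i).continuous)).mul_const _

theorem boundaryPairing_add (hg : ∀ i, MemLp (g i) 2 (volume.restrict (K.face i)))
    {φ ψ : EuclideanSpace ℝ (Fin d) → ℝ} (hφ : Continuous φ) (hψ : Continuous ψ)
    (a : EuclideanSpace ℝ (Fin d)) : K.boundaryPairing g (fun x => φ x + ψ x) a =
      K.boundaryPairing g φ a + K.boundaryPairing g ψ a := by
  unfold boundaryPairing
  rw [← Finset.sum_add_distrib]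
  refine Finset.sum_congr rfl fun i _ => ?_
  rw [← integral_add (integrable_boundary hg hφ a i) (integrable_boundary hg hψ a i)]
  congr 1; funext y; ring

/-- A partition of unity: the part of the support of `φ` outside `O₂` is compact in `O₁`. With `χ`
equal to one near it and supported in `O₁`, the function `χ φ` is admissible for `O₁` and `(1 - χ)
φ` for `O₂`. -/
theorem HasGreenOn.union (h : IsSobolevPair K.carrier v G)
    (hg : ∀ i, MemLp (g i) 2 (volume.restrict (K.face i))) {O₁ O₂ : Set (EuclideanSpace ℝ (Fin d))}
    (hO₁ : IsOpen O₁) (hO₂ : IsOpen O₂) (h₁ : K.HasGreenOn v G g O₁) (h₂ : K.HasGreenOn v G g O₂) :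
    K.HasGreenOn v G g (O₁ ∪ O₂) := by
  intro φ hφ hc hs a
  have hC : IsCompact (tsupport φ \ O₂) := hc.isCompact.diff hO₂
  obtain ⟨χ, hχ, hχc, hχs, hχ1, -⟩ := exists_smooth_one_nhds hC hO₁ (fun x hx =>
    (hs hx.1).resolve_right hx.2)
  have e1 := h₁ (fun x => χ x * φ x) (hχ.mul hφ) hχc.mul_right
    ((tsupport_mul_subset_left).trans hχs) a
  have hψ : ContDiff ℝ ∞ (fun x => (1 - χ x) * φ x) := (contDiff_const.sub hχ).mul hφ
  have e2 := h₂ (fun x => (1 - χ x) * φ x) hψ hc.mul_left (fun x hx => by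
    by_contra hx2
    have h3 : x ∈ tsupport φ := tsupport_mul_subset_right hx
    have h4 : ∀ᶠ z in 𝓝 x, χ z = 1 := hχ1.filter_mono (nhds_le_nhdsSet (Set.mem_sdiff_of_mem h3 hx2))
    have h5 : x ∉ tsupport (fun x => (1 - χ x) * φ x) := by
      rw [notMem_tsupport_iff_eventuallyEq]
      filter_upwards [h4] with z hz
      simp [hz]
    exact h5 hx) a
  have e3 : φ = fun x => χ x * φ x + (1 - χ x) * φ x := by funext x; ring
  rw [e3, h.greenPairing_add K.isBounded K.isOpen.measurableSet (hχ.mul hφ) hψ,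
    boundaryPairing_add hg (hχ.mul hφ).continuous hψ.continuous, e1, e2]

theorem HasGreenOn.of_locally (h : IsSobolevPair K.carrier v G)
    (hg : ∀ i, MemLp (g i) 2 (volume.restrict (K.face i))) {O : Set (EuclideanSpace ℝ (Fin d))}
    (hloc : ∀ x ∈ O, ∃ U, IsOpen U ∧ x ∈ U ∧ K.HasGreenOn v G g U) : K.HasGreenOn v G g O := by
  intro φ hφ hc hs a
  have key : ∃ U, IsOpen U ∧ tsupport φ ⊆ U ∧ K.HasGreenOn v G g U := by
    refine hc.isCompact.induction_on (p := fun s => ∃ U, IsOpen U ∧ s ⊆ U ∧ K.HasGreenOn v G g U)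
      ⟨∅, isOpen_empty, subset_rfl, ?_⟩ ?_ ?_ ?_
    · intro ψ _ _ hs a
      have h0 : ψ = fun _ => 0 := by
        funext x; exact image_eq_zero_of_notMem_tsupport fun hx => hs hx
      simp [h0, greenPairing, boundaryPairing]
    · rintro s t hst ⟨U, h1, h2, h3⟩
      exact ⟨U, h1, hst.trans h2, h3⟩
    · rintro s t ⟨U, h1, h2, h3⟩ ⟨U', h1', h2', h3'⟩
      exact ⟨U ∪ U', h1.union h1', Set.union_subset_union h2 h2', h3.union h hg h1 h1' h3'⟩
    · intro x hx
      obtain ⟨U, h1, h2, h3⟩ := hloc x (hs hx)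
      exact ⟨U, mem_nhdsWithin_of_mem_nhds (h1.mem_nhds h2), U, h1, subset_rfl, h3⟩
  obtain ⟨U, -, h2, h3⟩ := key
  exact h3 φ hφ hc h2 a

/-- Affine subspaces of codimension two are negligible on the faces. -/
theorem volume_preimage_chart_codim_two (hd : 1 ≤ d) {u w : EuclideanSpace ℝ (Fin d)}
    (hu : ‖u‖ = 1) (hw : ‖w‖ = 1) (huw : (inner ℝ u w : ℝ) = 0) (α β : ℝ) (i : Fin n) :
    volume {y | (inner ℝ u (K.chart i y) : ℝ) = α ∧ (inner ℝ w (K.chart i y) : ℝ) = β} = 0 := by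
  have hcr := K.isHyperplaneChart hd i
  set c := K.chart i
  set ν := K.normal i
  let L : EuclideanSpace ℝ (Fin (d - 1)) →L[ℝ] EuclideanSpace ℝ (Fin d) :=
    c.linearIsometry.toContinuousLinearMap
  have hform : ∀ (u : EuclideanSpace ℝ (Fin d)) y,
      (inner ℝ u (c y) : ℝ) = inner ℝ (L.adjoint u) y + inner ℝ u (c 0) := by
    intro u y
    have h1 := c.apply_add 0 y
    rw [zero_add] at h1
    rw [h1, inner_add_right, ContinuousLinearMap.adjoint_inner_left, add_comm]
    rfl
  have hker : ∀ u : EuclideanSpace ℝ (Fin d), L.adjoint u = 0 → u = (inner ℝ ν u : ℝ) • ν := by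
    intro u h0
    obtain ⟨τ, hτ⟩ := hcr.exists_eq_add u
    have h1 : (inner ℝ u (c.linearIsometry τ) : ℝ) = 0 := by
      have : (inner ℝ u (L τ) : ℝ) = 0 := by
        rw [← ContinuousLinearMap.adjoint_inner_left, h0, inner_zero_left]
      exact this
    rw [hτ, inner_add_left, inner_smul_left, hcr.inner_normal, mul_zero, add_zero,
      inner_self_eq_zero] at h1
    rw [h1, zero_add] at hτ
    exact hτ
  -- If both equations were constant along the plane of the face, the orthogonal unit vectors `u`
  -- and `w` would both be multiples of the normal.
  have hcase : L.adjoint u ≠ 0 ∨ L.adjoint w ≠ 0 := by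
    by_contra hcon
    push Not at hcon
    have h1 := hker u hcon.1
    have h2 := hker w hcon.2
    rw [h1, h2, inner_smul_left, inner_smul_right, real_inner_self_eq_norm_sq, hcr.norm_normal]
      at huw
    simp only [conj_trivial, one_pow, mul_one, mul_eq_zero] at huw
    rcases huw with h3 | h3
    · rw [h3, zero_smul] at h1; simp [h1] at hu
    · rw [h3, zero_smul] at h2; simp [h2] at hw
  rcases hcase with h1 | h1
  · refine measure_mono_null (fun y hy => ?_) (volume_hyperplane h1 (α - inner ℝ u (c 0)))
    have := hy.1
    rw [hform] at this
    simp only [Set.mem_ofPred_eq]; linarith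
  · refine measure_mono_null (fun y hy => ?_) (volume_hyperplane h1 (β - inner ℝ w (c 0)))
    have := hy.2
    rw [hform] at this
    simp only [Set.mem_ofPred_eq]; linarith

end PolytopalDomain

namespace PolytopalDomain

variable {d n : ℕ} {K : PolytopalDomain d n} {v : EuclideanSpace ℝ (Fin d) → ℝ}
  {G : EuclideanSpace ℝ (Fin d) → EuclideanSpace ℝ (Fin d)}
  {g : Fin n → EuclideanSpace ℝ (Fin (d - 1)) → ℝ}

/-- A cutoff at distance of order `1 / e_k` from a subspace of codimension two has a gradient of
size `e_k` on a bounded set of measure of order `e_k⁻²`. The gradients are thus bounded in `L²`, and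
paired with `v` on the shrinking neighbourhoods they give terms that tend to zero. The other terms
converge by dominated convergence, since the subspace is negligible in `K` and on the faces. -/
theorem HasGreenOn.of_diff_codim_two (hd : 2 ≤ d) (h : IsSobolevPair K.carrier v G)
    (hg : ∀ i, MemLp (g i) 2 (volume.restrict (K.face i))) {u w : EuclideanSpace ℝ (Fin d)}
    (hu : ‖u‖ = 1) (hw : ‖w‖ = 1) (huw : (inner ℝ u w : ℝ) = 0) (α β : ℝ)
    {O : Set (EuclideanSpace ℝ (Fin d))}
    (hO : K.HasGreenOn v G g (O \ {x | (inner ℝ u x : ℝ) = α ∧ (inner ℝ w x : ℝ) = β})) :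
    K.HasGreenOn v G g O := by
  intro φ hφ hc hs a
  have hb := K.isBounded
  have hm := K.isOpen.measurableSet
  obtain ⟨χ, hχ, hχ0, hχ1, hχb, hχd, M, hM0, hM⟩ := exists_cutoff
  set U : EuclideanSpace ℝ (Fin d) → ℝ := fun x => (inner ℝ u x : ℝ) - α with hU
  set W : EuclideanSpace ℝ (Fin d) → ℝ := fun x => (inner ℝ w x : ℝ) - β with hW
  set ρ : EuclideanSpace ℝ (Fin d) → ℝ := fun x => U x ^ 2 + W x ^ 2 with hρ
  set Z : Set (EuclideanSpace ℝ (Fin d)) :=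
    {x | (inner ℝ u x : ℝ) = α ∧ (inner ℝ w x : ℝ) = β} with hZ
  have hUs : ContDiff ℝ ∞ U := (contDiff_const.inner ℝ contDiff_id).sub contDiff_const
  have hWs : ContDiff ℝ ∞ W := (contDiff_const.inner ℝ contDiff_id).sub contDiff_const
  have hρs : ContDiff ℝ ∞ ρ := (hUs.pow 2).add (hWs.pow 2)
  have hZρ : ∀ x, x ∉ Z → 0 < ρ x := by
    intro x hx
    by_contra h0
    have h1 : ρ x ≤ 0 := not_lt.1 h0
    simp only [hρ] at h1
    have h2 : U x = 0 := by nlinarith [sq_nonneg (U x), sq_nonneg (W x)]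
    have h3 : W x = 0 := by nlinarith [sq_nonneg (U x), sq_nonneg (W x)]
    exact hx ⟨sub_eq_zero.1 h2, sub_eq_zero.1 h3⟩
  let e : ℕ → ℝ := fun k => (k : ℝ) + 1
  have he : ∀ k, 0 < e k := fun k => by positivity
  let X : ℕ → EuclideanSpace ℝ (Fin d) → ℝ := fun k x => χ (e k ^ 2 * ρ x)
  have hX : ∀ k, ContDiff ℝ ∞ (X k) := fun k => hχ.comp (contDiff_const.mul hρs)
  have hX1 : ∀ k x, |X k x| ≤ 1 := fun k x =>
    abs_le.2 ⟨by linarith [(hχb (e k ^ 2 * ρ x)).1], (hχb _).2⟩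
  -- The threshold `8` leaves the box `N k` below: in it `|U|` and `|W|` are at most `2 / e k`, so
  -- `e k ^ 2 * ρ ≤ 4 + 4`. It also exceeds `2`, beyond which `χ` is constant.
  have hlarge : ∀ x, x ∉ Z → ∀ᶠ k in Filter.atTop, 8 < e k ^ 2 * ρ x := by
    intro x hx
    obtain ⟨N, hN⟩ := exists_nat_gt (8 / ρ x)
    filter_upwards [Filter.eventually_ge_atTop N] with k hk
    have h1 : (N : ℝ) ≤ k := by exact_mod_cast hk
    have h2 : 8 / ρ x < e k := by simp only [e]; linarith
    rw [div_lt_iff₀ (hZρ x hx)] at h2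
    have h3 : 1 ≤ e k := by simp only [e]; linarith [Nat.cast_nonneg (α := ℝ) k]
    nlinarith [mul_pos (he k) (hZρ x hx)]
  have hXlim : ∀ x, x ∉ Z → ∀ᶠ k in Filter.atTop, X k x = 1 := by
    intro x hx
    filter_upwards [hlarge x hx] with k hk
    exact hχ1 _ (by linarith)
  have hXd : ∀ k x, fderiv ℝ (X k) x a =
      deriv χ (e k ^ 2 * ρ x) * (e k ^ 2 * (2 * U x * inner ℝ u a + 2 * W x * inner ℝ w a)) := by
    intro k x
    have h1 : HasFDerivAt U (innerSL ℝ u) x := ((innerSL ℝ u).hasFDerivAt (x := x)).sub_const α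
    have h2 : HasFDerivAt W (innerSL ℝ w) x := ((innerSL ℝ w).hasFDerivAt (x := x)).sub_const β
    have h3 : HasDerivAt χ (deriv χ (e k ^ 2 * ρ x)) (e k ^ 2 * ρ x) :=
      (hχ.differentiable (by simp) _).hasDerivAt
    have h4 := h3.comp_hasFDerivAt x (((h1.pow 2).add (h2.pow 2)).const_mul (e k ^ 2))
    have h5 : fderiv ℝ (X k) x = _ := h4.fderiv
    rw [h5]; simp; ring
  -- the gradient of the cutoff
  obtain ⟨Cφ, hCφ⟩ := hc.exists_bound_of_continuous hφ.continuous
  have hCφ0 : 0 ≤ Cφ := (norm_nonneg _).trans (hCφ 0)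
  set N : ℕ → Set (EuclideanSpace ℝ (Fin d)) :=
    fun k => {x | |(inner ℝ u x : ℝ) - α| ≤ 2 / e k ∧ |(inner ℝ w x : ℝ) - β| ≤ 2 / e k} with hN
  have hNm : ∀ k, MeasurableSet (N k) := fun k =>
    ((isClosed_le hUs.continuous.abs continuous_const).inter
      (isClosed_le hWs.continuous.abs continuous_const)).measurableSet
  set C : ℝ := Cφ * M * (4 * |(inner ℝ u a : ℝ)| + 4 * |(inner ℝ w a : ℝ)|) with hC
  have hC0 : 0 ≤ C := by positivity
  have hgrad : ∀ k x, |φ x * fderiv ℝ (X k) x a| ≤ (N k).indicator (fun _ => C * e k) x := by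
    intro k x
    by_cases h2 : 2 < e k ^ 2 * ρ x
    · rw [hXd, hχd _ h2]
      simp only [zero_mul, mul_zero, abs_zero]
      exact Set.indicator_nonneg (fun _ _ => by have := he k; positivity) x
    have h3 := not_lt.1 h2
    have hUb : |U x| ≤ 2 / e k := by
      apply abs_le_of_sq_le_sq _ (by have := he k; positivity)
      rw [div_pow, le_div_iff₀ (by have := he k; positivity)]
      simp only [hρ] at h3
      nlinarith [mul_nonneg (sq_nonneg (e k)) (sq_nonneg (W x))]
    have hWb : |W x| ≤ 2 / e k := by
      apply abs_le_of_sq_le_sq _ (by have := he k; positivity)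
      rw [div_pow, le_div_iff₀ (by have := he k; positivity)]
      simp only [hρ] at h3
      nlinarith [mul_nonneg (sq_nonneg (e k)) (sq_nonneg (U x))]
    have hmem : x ∈ N k := ⟨hUb, hWb⟩
    rw [Set.indicator_of_mem hmem, hXd, abs_mul, abs_mul, abs_mul, abs_of_nonneg (sq_nonneg (e k))]
    have h4 : |2 * U x * (inner ℝ u a : ℝ) + 2 * W x * (inner ℝ w a : ℝ)| ≤
        2 * (2 / e k) * |(inner ℝ u a : ℝ)| + 2 * (2 / e k) * |(inner ℝ w a : ℝ)| := by
      refine (abs_add_le _ _).trans ?_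
      rw [abs_mul, abs_mul, abs_mul, abs_mul, abs_two]
      gcongr
    have h5 := hM (e k ^ 2 * ρ x)
    have h6 : |φ x| ≤ Cφ := hCφ x
    have hek := he k
    calc |φ x| * (|deriv χ (e k ^ 2 * ρ x)| *
          (e k ^ 2 * |2 * U x * (inner ℝ u a : ℝ) + 2 * W x * (inner ℝ w a : ℝ)|))
        ≤ Cφ * (M * (e k ^ 2 *
          (2 * (2 / e k) * |(inner ℝ u a : ℝ)| + 2 * (2 / e k) * |(inner ℝ w a : ℝ)|))) := by
          gcongr
      _ = C * e k := by rw [hC]; field_simp; ring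
  obtain ⟨C₂, hC₂0, hC₂⟩ := exists_volume_inter_le_sq hd hb hu hw huw α β
  have hZnull : volume Z = 0 :=
    measure_mono_null (fun x hx => hx.1)
      (volume_hyperplane (p := u) (fun h0 => by simp [h0] at hu) α)
  have hae : ∀ᵐ x ∂(volume.restrict K.carrier), x ∉ Z :=
    ae_restrict_of_ae (measure_eq_zero_iff_ae_notMem.1 hZnull)
  have hdc : Continuous (fun x => fderiv ℝ φ x a) :=
    (hφ.continuous_fderiv (by simp)).clm_apply continuous_const
  have hXdc : ∀ k, Continuous (fun x => fderiv ℝ (X k) x a) := fun k =>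
    ((hX k).continuous_fderiv (by simp)).clm_apply continuous_const
  -- the part with the gradient of the cutoff tends to zero
  have hvN : Filter.Tendsto (fun k => ∫ x in K.carrier, ((N k).indicator v x) ^ 2) Filter.atTop
      (𝓝 0) := by
    have h0 : ∫ x in K.carrier, (0 : ℝ) = 0 := by simp
    rw [← h0]
    refine tendsto_integral_of_dominated_convergence (fun x => v x ^ 2)
      (fun k => ((h.measurable.indicator (hNm k)).pow_const 2).aestronglyMeasurable)
      h.memLp.integrable_sq (fun k => Filter.Eventually.of_forall fun x => ?_) ?_
    · by_cases hx : x ∈ N k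
      · rw [Set.indicator_of_mem hx, Real.norm_of_nonneg (sq_nonneg _)]
      · rw [Set.indicator_of_notMem hx]; simp; positivity
    · filter_upwards [hae] with x hx
      refine tendsto_const_nhds.congr' ?_
      filter_upwards [hlarge x hx] with k hk
      have : x ∉ N k := by
        rintro ⟨h1, h2⟩
        have h1' : U x ^ 2 ≤ (2 / e k) ^ 2 := by rw [← sq_abs]; gcongr
        have h2' : W x ^ 2 ≤ (2 / e k) ^ 2 := by rw [← sq_abs]; gcongr
        have hek := he k
        rw [div_pow, le_div_iff₀ (by positivity)] at h1' h2'
        simp only [hρ] at hk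
        nlinarith
      rw [Set.indicator_of_notMem this]; simp
  have hpart : Filter.Tendsto (fun k => ∫ x in K.carrier, v x * (φ x * fderiv ℝ (X k) x a))
      Filter.atTop (𝓝 0) := by
    have hsq : ∀ k, (∫ x in K.carrier, v x * (φ x * fderiv ℝ (X k) x a)) ^ 2 ≤
        (∫ x in K.carrier, ((N k).indicator v x) ^ 2) * (C ^ 2 * C₂ * 4) := by
      intro k
      have : IsFiniteMeasure (volume.restrict K.carrier) :=
        ⟨by rw [Measure.restrict_apply_univ]; exact hb.measure_lt_top⟩
      have hek := he k
      have hf2 : MemLp ((N k).indicator v) 2 (volume.restrict K.carrier) :=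
        h.memLp.indicator (hNm k)
      have hg2 : MemLp ((N k).indicator fun _ => C * e k) 2 (volume.restrict K.carrier) :=
        (memLp_const _).indicator (hNm k)
      have h1 := integral_mul_sq_le hf2 hg2
      have h2 : |∫ x in K.carrier, v x * (φ x * fderiv ℝ (X k) x a)| ≤
          ∫ x in K.carrier, |(N k).indicator v x| * |(N k).indicator (fun _ => C * e k) x| := by
        refine (abs_integral_le_integral_abs).trans ?_
        refine integral_mono_of_nonneg (Filter.Eventually.of_forall fun x => abs_nonneg _)
          (hf2.abs.integrable_mul hg2.abs) (Filter.Eventually.of_forall fun x => ?_)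
        have h3 := hgrad k x
        simp only []
        rw [abs_mul]
        by_cases hx : x ∈ N k
        · rw [Set.indicator_of_mem hx] at h3 ⊢
          rw [Set.indicator_of_mem hx]
          exact mul_le_mul_of_nonneg_left (h3.trans (le_abs_self _)) (abs_nonneg _)
        · rw [Set.indicator_of_notMem hx] at h3 ⊢
          have : |φ x * fderiv ℝ (X k) x a| = 0 := le_antisymm h3 (abs_nonneg _)
          rw [this]; simp
      -- This is where codimension two enters: the square `(C * e k) ^ 2` of the gradient bound is
      -- compensated by the measure `C₂ * (2 / e k) ^ 2`.
      have h4 : ∫ x in K.carrier, ((N k).indicator (fun _ => C * e k) x) ^ 2 ≤ C ^ 2 * C₂ * 4 := by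
        have h5 : (fun x => ((N k).indicator (fun _ => C * e k) x) ^ 2) =
            (N k).indicator (fun _ => (C * e k) ^ 2) := by
          funext x
          by_cases hx : x ∈ N k
          · simp [Set.indicator_of_mem hx]
          · simp [Set.indicator_of_notMem hx]
        rw [h5, integral_indicator_const _ (hNm k), smul_eq_mul, measureReal_def,
          Measure.restrict_apply (hNm k), Set.inter_comm]
        have h6 := ENNReal.toReal_mono ENNReal.ofReal_ne_top (hC₂ (2 / e k) (by positivity))
        rw [ENNReal.toReal_ofReal (by positivity)] at h6
        calc _ ≤ (C₂ * (2 / e k) ^ 2) * (C * e k) ^ 2 := by gcongr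
          _ = _ := by field_simp; ring
      rw [← sq_abs]
      calc _ ≤ (∫ x in K.carrier,
              |(N k).indicator v x| * |(N k).indicator (fun _ => C * e k) x|) ^ 2 := by gcongr
        _ ≤ _ := h1
        _ ≤ _ := by gcongr
    have h7 := hvN.mul_const (C ^ 2 * C₂ * 4)
    rw [zero_mul] at h7
    have h8 := squeeze_zero (fun k => sq_nonneg _) hsq h7
    have h9 := h8.sqrt
    simp only [Real.sqrt_sq_eq_abs, Real.sqrt_zero] at h9
    exact (tendsto_zero_iff_abs_tendsto_zero _).2 h9
  have hmain : Filter.Tendsto (fun k => ∫ x in K.carrier,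
      (v x * fderiv ℝ φ x a + inner ℝ (G x) a * φ x) * X k x) Filter.atTop
      (𝓝 (greenPairing K.carrier v G φ a)) := by
    refine tendsto_integral_of_dominated_convergence
      (fun x => |v x * fderiv ℝ φ x a + (inner ℝ (G x) a : ℝ) * φ x|)
      (fun k => (h.integrable_pairing hb hm hφ a).aestronglyMeasurable.mul
        (hX k).continuous.aestronglyMeasurable) (h.integrable_pairing hb hm hφ a).abs
      (fun k => Filter.Eventually.of_forall fun x => ?_) ?_
    · rw [Real.norm_eq_abs, abs_mul]
      exact mul_le_of_le_one_right (abs_nonneg _) (hX1 k x)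
    · filter_upwards [hae] with x hx
      refine tendsto_const_nhds.congr' ?_
      filter_upwards [hXlim x hx] with k hk
      rw [hk, mul_one]
  have hsplit : ∀ k, greenPairing K.carrier v G (fun x => φ x * X k x) a =
      (∫ x in K.carrier, (v x * fderiv ℝ φ x a + inner ℝ (G x) a * φ x) * X k x) +
        ∫ x in K.carrier, v x * (φ x * fderiv ℝ (X k) x a) := by
    intro k
    have i1 : Integrable (fun x => (v x * fderiv ℝ φ x a + (inner ℝ (G x) a : ℝ) * φ x) * X k x)
        (volume.restrict K.carrier) :=
      (h.integrable_pairing hb hm hφ a).mul_bdd (c := 1) (hX k).continuous.aestronglyMeasurable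
        (Filter.Eventually.of_forall fun x => hX1 k x)
    have i2 : Integrable (fun x => v x * (φ x * fderiv ℝ (X k) x a)) (volume.restrict K.carrier) :=
      h.integrable_mul hb hm (hφ.continuous.mul (hXdc k))
    rw [greenPairing, ← integral_add i1 i2]
    congr 1; funext x
    have := fderiv_fun_mul (hφ.differentiable (by simp) x) ((hX k).differentiable (by simp) x)
    rw [this]; simp; ring
  have hleft : Filter.Tendsto (fun k => greenPairing K.carrier v G (fun x => φ x * X k x) a)
      Filter.atTop (𝓝 (greenPairing K.carrier v G φ a)) := by
    simp only [hsplit]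
    simpa using hmain.add hpart
  have hright : Filter.Tendsto (fun k => K.boundaryPairing g (fun x => φ x * X k x) a)
      Filter.atTop (𝓝 (K.boundaryPairing g φ a)) := by
    unfold boundaryPairing
    refine tendsto_finsetSum _ fun i _ => ?_
    refine tendsto_integral_of_dominated_convergence
      (fun y => |g i y * φ (K.chart i y) * inner ℝ (K.normal i) a|)
      (fun k => (integrable_boundary hg (hφ.mul (hX k)).continuous a i).aestronglyMeasurable)
      (integrable_boundary hg hφ.continuous a i).abs
      (fun k => Filter.Eventually.of_forall fun y => ?_) ?_
    · rw [Real.norm_eq_abs, ← mul_assoc, mul_right_comm, abs_mul]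
      exact mul_le_of_le_one_right (abs_nonneg _) (hX1 k _)
    · have h1 := volume_preimage_chart_codim_two (K := K) (by omega) hu hw huw α β i
      filter_upwards [ae_restrict_of_ae (measure_eq_zero_iff_ae_notMem.1 h1)] with y hy
      refine tendsto_const_nhds.congr' ?_
      filter_upwards [hXlim (K.chart i y) hy] with k hk
      rw [hk, mul_one]
  have heq : ∀ k, greenPairing K.carrier v G (fun x => φ x * X k x) a =
      K.boundaryPairing g (fun x => φ x * X k x) a := by
    intro k
    refine hO _ (hφ.mul (hX k)) hc.mul_right (fun x hx => ⟨hs (tsupport_mul_subset_left hx), ?_⟩) a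
    intro hxZ
    have h1 : X k =ᶠ[𝓝 x] fun _ => 0 := by
      have h2 : ∀ᶠ z in 𝓝 x, e k ^ 2 * ρ z < 1 := by
        refine (continuous_const.mul hρs.continuous).continuousAt.eventually_lt
          continuousAt_const ?_
        have h3 : U x = 0 := sub_eq_zero.2 hxZ.1
        have h4 : W x = 0 := sub_eq_zero.2 hxZ.2
        have h5 : ρ x = 0 := by simp only [hρ]; rw [h3, h4]; norm_num
        change e k ^ 2 * ρ x < 1
        rw [h5]; norm_num
      filter_upwards [h2] with z hz
      exact hχ0 _ hz.le
    have h5 : x ∉ tsupport (fun x => φ x * X k x) := by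
      rw [notMem_tsupport_iff_eventuallyEq]
      filter_upwards [h1] with z hz
      simp [hz]
    exact h5 hx
  simp only [heq] at hleft
  exact tendsto_nhds_unique hleft hright

theorem HasGreenOn.green_of_univ (h : K.HasGreenOn v G g Set.univ)
    {φ : EuclideanSpace ℝ (Fin d) → ℝ} (hφ : ContDiff ℝ ∞ φ) (a : EuclideanSpace ℝ (Fin d)) :
    greenPairing K.carrier v G φ a = K.boundaryPairing g φ a := by
  obtain ⟨χ, hχ, hχc, -, hχ1, -⟩ := exists_smooth_one_nhds K.isBounded.isCompact_closure
    isOpen_univ (Set.subset_univ _)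
  have hnear : ∀ x ∈ closure K.carrier, (fun x => χ x * φ x) =ᶠ[𝓝 x] φ := by
    intro x hx
    filter_upwards [hχ1.filter_mono (nhds_le_nhdsSet hx)] with z hz
    rw [hz, one_mul]
  have h1 := h (fun x => χ x * φ x) (hχ.mul hφ) hχc.mul_right (Set.subset_univ _) a
  have h2 : greenPairing K.carrier v G (fun x => χ x * φ x) a =
      greenPairing K.carrier v G φ a := by
    refine setIntegral_congr_fun K.isOpen.measurableSet fun x hx => ?_
    have h3 := hnear x (subset_closure hx)
    simp only []
    rw [h3.fderiv_eq, h3.eq_of_nhds]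
  have h4 : K.boundaryPairing g (fun x => χ x * φ x) a = K.boundaryPairing g φ a := by
    refine Finset.sum_congr rfl fun i _ => ?_
    refine setIntegral_congr_fun (K.face_region i).isOpen.measurableSet fun y hy => ?_
    have h3 := hnear _ (frontier_subset_closure (K.chart_mem_frontier (subset_closure hy)))
    have h5 := h3.eq_of_nhds
    simp only [] at h5 ⊢
    rw [h5]
  rw [← h2, h1, h4]

end PolytopalDomain

/-! ### The convex cells of the face planes and visibility -/

/-- Let `C` contain the ball of radius `r` about `x₀`, and cover the closure by finitely many balls
of radius `r` with centres `z`. If `x` is in the ball about `z`, the direction `x₀ - z` carries `x`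
into the ball about `x₀`, and a segment from a closure point to an interior point of a convex set
runs in the interior. -/
theorem Convex.exists_finite_directions {E : Type*} [NormedAddCommGroup E] [NormedSpace ℝ E]
    [FiniteDimensional ℝ E] {C : Set E} (hC : Convex ℝ C) (ho : IsOpen C) (hne : C.Nonempty)
    (hb : Bornology.IsBounded C) :
    ∃ Ξ : Set E, Ξ.Finite ∧ ∀ x ∈ closure C, ∃ ξ ∈ Ξ, ∀ t ∈ Set.Ioc (0 : ℝ) 1, x + t • ξ ∈ C := by
  obtain ⟨x₀, hx₀⟩ := hne
  obtain ⟨r, hr, hrC⟩ := Metric.isOpen_iff.1 ho x₀ hx₀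
  have : ProperSpace E := FiniteDimensional.proper ℝ E
  obtain ⟨t, -, htf, ht⟩ := hb.isCompact_closure.finite_cover_balls hr
  refine ⟨(fun z => x₀ - z) '' t, htf.image _, fun x hx => ?_⟩
  obtain ⟨z, hz, hxz⟩ := Set.mem_iUnion₂.1 (ht hx)
  refine ⟨x₀ - z, Set.mem_image_of_mem _ hz, fun s hs => ?_⟩
  have h1 : x₀ + (x - z) ∈ interior C := by
    rw [ho.interior_eq]
    apply hrC
    rw [Metric.mem_ball, dist_eq_norm, add_sub_cancel_left, ← dist_eq_norm]
    exact hxz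
  have h2 := hC.combo_closure_interior_mem_interior hx h1 (a := 1 - s) (b := s)
    (by linarith [hs.2]) hs.1 (by ring)
  rw [ho.interior_eq] at h2
  convert h2 using 1
  module

namespace PolytopalDomain

variable {d n : ℕ} (K : PolytopalDomain d n)

/-- The signed distance from the plane of the face number `i`. -/
noncomputable def height (i : Fin n) (x : EuclideanSpace ℝ (Fin d)) : ℝ :=
  inner ℝ (K.normal i) (x - K.chart i 0)

/-- A cell of the arrangement of the planes of the faces. -/
def cell (σ : Fin n → Bool) : Set (EuclideanSpace ℝ (Fin d)) :=
  {x | ∀ i, 0 < (bif σ i then 1 else -1) * K.height i x}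

variable {K}

theorem continuous_height (i : Fin n) : Continuous (K.height i) := by
  unfold height; fun_prop

theorem height_chart (i : Fin n) (y : EuclideanSpace ℝ (Fin (d - 1))) :
    K.height i (K.chart i y) = 0 := by
  have h := AffineIsometry.apply_add (K.chart i) 0 y
  rw [zero_add] at h
  rw [height, h, add_sub_cancel_left, K.inner_normal_linear]

theorem isOpen_cell (σ : Fin n → Bool) : IsOpen (K.cell σ) := by
  have : K.cell σ = ⋂ i, {x | 0 < (bif σ i then 1 else -1) * K.height i x} := by
    ext x; simp [cell]
  rw [this]
  exact isOpen_iInter_of_finite fun i =>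
    isOpen_lt continuous_const (continuous_const.mul (continuous_height i))

theorem convex_cell (σ : Fin n → Bool) : Convex ℝ (K.cell σ) := by
  intro x hx y hy a b ha hb hab i
  have h1 : K.height i (a • x + b • y) = a * K.height i x + b * K.height i y := by
    have : a • x + b • y - K.chart i 0 = a • (x - K.chart i 0) + b • (y - K.chart i 0) := by
      rw [smul_sub, smul_sub]
      have : K.chart i 0 = a • K.chart i 0 + b • K.chart i 0 := by rw [← add_smul, hab, one_smul]
      conv_lhs => rw [this]
      abel
    rw [height, this, inner_add_right, inner_smul_right, inner_smul_right]; rfl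
  rw [h1]
  have hx' := hx i
  have hy' := hy i
  set s : ℝ := bif σ i then 1 else -1
  have : s * (a * K.height i x + b * K.height i y) =
      a * (s * K.height i x) + b * (s * K.height i y) := by ring
  rw [this]
  rcases ha.eq_or_lt with h0 | h0
  · have hb1 : b = 1 := by linarith
    rw [← h0, hb1]; simpa using hy'
  · exact add_pos_of_pos_of_nonneg (mul_pos h0 hx') (mul_nonneg hb hy'.le)

theorem height_ne_zero_of_mem_cell {σ : Fin n → Bool} {x : EuclideanSpace ℝ (Fin d)}
    (hx : x ∈ K.cell σ) (i : Fin n) : K.height i x ≠ 0 :=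
  right_ne_zero_of_mul (hx i).ne'

theorem exists_height_eq_zero_of_mem_frontier {x : EuclideanSpace ℝ (Fin d)}
    (hx : x ∈ frontier K.carrier) : ∃ i, K.height i x = 0 := by
  rw [K.frontier_eq] at hx
  obtain ⟨i, y, -, rfl⟩ := Set.mem_iUnion.1 hx
  exact ⟨i, height_chart i y⟩

/-- Every boundary point of `K` is on the plane of some face, and cells avoid these planes; a
connected set that meets `K` but not its boundary stays inside. -/
theorem cell_subset {σ : Fin n → Bool} (h : (K.cell σ ∩ K.carrier).Nonempty) :
    K.cell σ ⊆ K.carrier := by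
  refine (convex_cell σ).isPreconnected.subset_of_closure_inter_subset K.isOpen h ?_
  rintro x ⟨hx1, hx2⟩
  by_contra hxK
  have h1 : x ∈ frontier K.carrier := by rw [K.isOpen.frontier_eq]; exact ⟨hx1, hxK⟩
  obtain ⟨i, hi⟩ := exists_height_eq_zero_of_mem_frontier h1
  exact height_ne_zero_of_mem_cell hx2 i hi

theorem exists_mem_cell {x : EuclideanSpace ℝ (Fin d)} (hx : ∀ i, K.height i x ≠ 0) :
    ∃ σ, x ∈ K.cell σ := by
  refine ⟨fun i => decide (0 < K.height i x), fun i => ?_⟩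
  by_cases h : 0 < K.height i x
  · simp [h]
  · have := lt_of_le_of_ne (not_lt.1 h) (hx i)
    simp [h, this]

theorem ae_height_ne_zero : ∀ᵐ x : EuclideanSpace ℝ (Fin d), ∀ i, K.height i x ≠ 0 := by
  rw [ae_all_iff]
  intro i
  have hn : K.normal i ≠ 0 := fun h => by simpa [h] using K.norm_normal i
  have := volume_hyperplane hn (inner ℝ (K.normal i) (K.chart i 0))
  filter_upwards [measure_eq_zero_iff_ae_notMem.1 this] with x hx h0
  apply hx
  rw [height, inner_sub_right, sub_eq_zero] at h0
  exact h0

/-- A face is visible from the inside in finitely many directions, up to finitely many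
hyperplanes. -/
theorem exists_finite_visible (hd : 1 ≤ d) : ∃ Ξ : Set (EuclideanSpace ℝ (Fin d)), Ξ.Finite ∧
    ∀ i, ∃ S : Set (EuclideanSpace ℝ (Fin (d - 1)) × ℝ), S.Finite ∧ (∀ p ∈ S, p.1 ≠ 0) ∧
      ∀ y ∈ closure (K.face i), (∀ p ∈ S, (inner ℝ p.1 y : ℝ) ≠ p.2) →
        ∃ ξ ∈ Ξ, y ∈ K.visible i ξ := by
  classical
  have hdir : ∀ σ : Fin n → Bool, ∃ Ξ : Set (EuclideanSpace ℝ (Fin d)), Ξ.Finite ∧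
      ((K.cell σ ∩ K.carrier).Nonempty → ∀ x ∈ closure (K.cell σ), ∃ ξ ∈ Ξ,
        ∀ t ∈ Set.Ioc (0 : ℝ) 1, x + t • ξ ∈ K.carrier) := by
    intro σ
    by_cases h : (K.cell σ ∩ K.carrier).Nonempty
    · obtain ⟨Ξ, h1, h2⟩ := (convex_cell σ).exists_finite_directions (isOpen_cell σ)
        (h.mono Set.inter_subset_left) (K.isBounded.subset (cell_subset h))
      refine ⟨Ξ, h1, fun _ x hx => ?_⟩
      obtain ⟨ξ, hξ, h3⟩ := h2 x hx
      exact ⟨ξ, hξ, fun t ht => cell_subset h (h3 t ht)⟩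
    · exact ⟨∅, Set.finite_empty, fun h' => absurd h' h⟩
  choose Ξ hΞ hΞ' using hdir
  refine ⟨⋃ σ, Ξ σ, Set.finite_iUnion hΞ, fun i => ?_⟩
  have hcr := K.isHyperplaneChart hd i
  obtain ⟨S, hS, hS0, hSf⟩ := (K.face_region i).flat_frontier
  let L : EuclideanSpace ℝ (Fin (d - 1)) →L[ℝ] EuclideanSpace ℝ (Fin d) :=
    (K.chart i).linearIsometry.toContinuousLinearMap
  -- In the coordinates of face `i`, the plane of face `j` is the zero set of the affine function
  -- encoded by `q j`. It is a proper hyperplane unless the linear part vanishes, which happens when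
  -- the two planes are parallel; only the proper ones are excluded.
  let q : Fin n → EuclideanSpace ℝ (Fin (d - 1)) × ℝ :=
    fun j => (L.adjoint (K.normal j), -K.height j (K.chart i 0))
  have hq : ∀ j y, K.height j (K.chart i y) = inner ℝ (q j).1 y - (q j).2 := by
    intro j y
    have h := AffineIsometry.apply_add (K.chart i) 0 y
    rw [zero_add] at h
    simp only [q]
    rw [ContinuousLinearMap.adjoint_inner_left, height, h, add_sub_right_comm, inner_add_right,
      sub_neg_eq_add, add_comm]
    rfl
  refine ⟨S ∪ (Set.range q ∩ {p | p.1 ≠ 0}), hS.union ((Set.finite_range q).inter_of_left _),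
    ?_, fun y hy hyS => ?_⟩
  · rintro p (hp | hp)
    · exact hS0 p hp
    · exact hp.2
  have hyF : y ∈ K.face i := by
    by_contra hyF
    have h1 : y ∈ frontier (K.face i) := by
      rw [(K.face_region i).isOpen.frontier_eq]; exact ⟨hy, hyF⟩
    obtain ⟨p, hp, hpy⟩ := Set.mem_iUnion₂.1 (hSf h1)
    exact hyS p (Or.inl hp) hpy
  -- the cell on the inner side of the face
  have hside : ∀ j, ∃ s : Bool, ∀ᶠ t : ℝ in 𝓝[>] 0,
      0 < (bif s then 1 else -1) * K.height j (K.chart i y - t • K.normal i) := by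
    intro j
    have hexp : ∀ t : ℝ, K.height j (K.chart i y - t • K.normal i) =
        K.height j (K.chart i y) - t * inner ℝ (K.normal j) (K.normal i) := by
      intro t
      rw [height, height, sub_right_comm, inner_sub_right, inner_smul_right]
    by_cases h0 : K.height j (K.chart i y) = 0
    -- A point of plane `j` outside the excluded hyperplanes occurs only if plane `j` is parallel to
    -- face `i`. Then the normals are not orthogonal, and a step along `-K.normal i` leaves plane
    -- `j` to a definite side.
    · have hL : L.adjoint (K.normal j) = 0 := by
        by_contra hne
        rw [hq, sub_eq_zero] at h0
        exact hyS (q j) (Or.inr ⟨⟨j, rfl⟩, hne⟩) h0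
      have hnn : (inner ℝ (K.normal j) (K.normal i) : ℝ) ≠ 0 := by
        intro hz
        obtain ⟨τ, hτ⟩ := hcr.exists_eq_add (K.normal j)
        rw [real_inner_comm, hz, zero_smul, add_zero] at hτ
        have h1 : (inner ℝ (K.normal j) (L τ) : ℝ) = 0 := by
          rw [← ContinuousLinearMap.adjoint_inner_left, hL, inner_zero_left]
        have h3 : L τ = K.normal j := hτ.symm
        rw [h3] at h1
        rw [real_inner_self_eq_norm_sq, K.norm_normal] at h1
        norm_num at h1
      refine ⟨decide ((inner ℝ (K.normal j) (K.normal i) : ℝ) < 0), ?_⟩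
      filter_upwards [self_mem_nhdsWithin] with t ht
      have ht0 : 0 < t := ht
      rw [hexp, h0, zero_sub]
      rcases lt_or_gt_of_ne hnn with h1 | h1
      · simp only [h1, decide_true, cond_true]; nlinarith
      · simp only [not_lt.2 h1.le, decide_false, cond_false]; nlinarith
    · refine ⟨decide (0 < K.height j (K.chart i y)), ?_⟩
      have hcont : Filter.Tendsto (fun t : ℝ => K.height j (K.chart i y - t • K.normal i)) (𝓝[>] 0)
          (𝓝 (K.height j (K.chart i y))) := by
        have : Continuous fun t : ℝ => K.height j (K.chart i y - t • K.normal i) :=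
          (continuous_height j).comp (by fun_prop)
        have h1 := this.tendsto 0
        rw [zero_smul, sub_zero] at h1
        exact h1.mono_left nhdsWithin_le_nhds
      rcases lt_or_gt_of_ne h0 with h1 | h1
      · filter_upwards [hcont.eventually (gt_mem_nhds h1)] with t ht
        simp only [not_lt.2 h1.le, decide_false, cond_false]; linarith
      · filter_upwards [hcont.eventually (lt_mem_nhds h1)] with t ht
        simp only [h1, decide_true, cond_true]; linarith
  choose σ hσ using hside
  have hcell : ∀ᶠ t : ℝ in 𝓝[>] 0, K.chart i y - t • K.normal i ∈ K.cell σ :=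
    Filter.eventually_all.2 hσ
  have hlim : Filter.Tendsto (fun t : ℝ => K.chart i y - t • K.normal i) (𝓝[>] 0)
      (𝓝 (K.chart i y)) := by
    have : Continuous fun t : ℝ => K.chart i y - t • K.normal i := by fun_prop
    have h1 := this.tendsto 0
    simp only [zero_smul, sub_zero] at h1
    exact h1.mono_left nhdsWithin_le_nhds
  have hK : ∀ᶠ t : ℝ in 𝓝[>] 0, K.chart i y - t • K.normal i ∈ K.carrier := by
    filter_upwards [hlim.eventually (K.one_sided i y hyF), self_mem_nhdsWithin] with t ht ht0
    rw [ht, sub_sub_cancel_left, inner_neg_right, inner_smul_right, real_inner_self_eq_norm_sq,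
      K.norm_normal]
    have : 0 < t := ht0
    linarith
  obtain ⟨t, ht⟩ := (hcell.and hK).exists
  have hcl : K.chart i y ∈ closure (K.cell σ) := mem_closure_of_tendsto hlim hcell
  obtain ⟨ξ, hξ, h3⟩ := hΞ' σ ⟨_, ht⟩ _ hcl
  exact ⟨ξ, Set.mem_iUnion.2 ⟨σ, hξ⟩, hyF, h3⟩

end PolytopalDomain

/-! ### Square integrability and consistency of the oblique traces -/

theorem enorm_integral_sq_le {α F : Type*} [MeasurableSpace α] {μ : Measure α}
    [IsProbabilityMeasure μ] [NormedAddCommGroup F] [NormedSpace ℝ F] {f : α → F}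
    (hf : AEStronglyMeasurable f μ) : ‖∫ x, f x ∂μ‖ₑ ^ 2 ≤ ∫⁻ x, ‖f x‖ₑ ^ 2 ∂μ := by
  have h1 : ‖∫ x, f x ∂μ‖ₑ ≤ eLpNorm f 1 μ := by
    rw [eLpNorm_one_eq_lintegral_enorm]; exact enorm_integral_le_lintegral_enorm f
  have h2 : eLpNorm f 1 μ ≤ eLpNorm f 2 μ :=
    eLpNorm_le_eLpNorm_of_exponent_le (by norm_num) hf
  have h3 : eLpNorm f 2 μ ^ 2 = ∫⁻ x, ‖f x‖ₑ ^ 2 ∂μ := by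
    have := eLpNorm_nnreal_pow_eq_lintegral (f := f) (μ := μ) (p := 2) (by norm_num)
    simpa using this
  calc _ ≤ eLpNorm f 2 μ ^ 2 := by gcongr; exact h1.trans h2
    _ = _ := h3

theorem memLp_two_iff_lintegral {α F : Type*} [MeasurableSpace α] {μ : Measure α}
    [NormedAddCommGroup F] {f : α → F} (hf : AEStronglyMeasurable f μ) :
    MemLp f 2 μ ↔ ∫⁻ x, ‖f x‖ₑ ^ 2 ∂μ < ⊤ := by
  have h3 : eLpNorm f 2 μ ^ 2 = ∫⁻ x, ‖f x‖ₑ ^ 2 ∂μ := by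
    have := eLpNorm_nnreal_pow_eq_lintegral (f := f) (μ := μ) (p := 2) (by norm_num)
    simpa using this
  rw [← h3]
  constructor
  · intro h; exact ENNReal.pow_lt_top h.2
  · intro h
    refine ⟨hf, ?_⟩
    by_contra h0
    rw [not_lt, top_le_iff] at h0
    rw [h0] at h
    simp at h

/-- Functions on finitely many sets which agree on the intersections can be glued. -/
theorem exists_glued_memLp {α ι : Type*} [MeasurableSpace α] {μ : Measure α} {E : ι → Set α}
    (hE : ∀ ξ, MeasurableSet (E ξ)) {f : ι → α → ℝ} (hf : ∀ ξ, MemLp (f ξ) 2 (μ.restrict (E ξ)))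
    (hff : ∀ ξ ξ', ∀ᵐ x ∂μ, x ∈ E ξ → x ∈ E ξ' → f ξ x = f ξ' x) {Ξ : Set ι} (hΞ : Ξ.Finite) :
    ∃ g : α → ℝ, MemLp g 2 μ ∧ ∀ ξ ∈ Ξ, ∀ᵐ x ∂(μ.restrict (E ξ)), g x = f ξ x := by
  classical
  induction Ξ, hΞ using Set.Finite.induction_on with
  | empty => exact ⟨0, MemLp.zero, by simp⟩
  | @insert ξ s _ _ ih =>
    obtain ⟨g, hg, hgs⟩ := ih
    refine ⟨(E ξ).piecewise (f ξ) g, ?_, ?_⟩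
    · exact MemLp.piecewise (hE ξ) (hf ξ) (hg.restrict _)
    · rintro ξ' (rfl | hξ')
      · filter_upwards [ae_restrict_mem (hE ξ')] with x hx
        exact Set.piecewise_eq_of_mem _ _ _ hx
      · filter_upwards [ae_restrict_mem (hE ξ'), hgs ξ' hξ', ae_restrict_of_ae (hff ξ ξ')]
          with x hx h1 h2
        by_cases hxξ : x ∈ E ξ
        · rw [Set.piecewise_eq_of_mem _ _ _ hxξ]; exact h2 hxξ hx
        · rw [Set.piecewise_eq_of_notMem _ _ _ hxξ]; exact h1

namespace PolytopalDomain

variable {d n : ℕ} {K : PolytopalDomain d n} {v : EuclideanSpace ℝ (Fin d) → ℝ}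
  {G : EuclideanSpace ℝ (Fin d) → EuclideanSpace ℝ (Fin d)}
  {g : Fin n → EuclideanSpace ℝ (Fin (d - 1)) → ℝ}

theorem measurable_obliqueTrace (hv : Measurable v) (hG : Measurable G) (i : Fin n)
    (ξ : EuclideanSpace ℝ (Fin d)) : Measurable (K.obliqueTrace i ξ v G) := by
  have hA : Measurable fun p : EuclideanSpace ℝ (Fin (d - 1)) × ℝ => K.chart i p.1 + p.2 • ξ :=
    (((K.chart i).continuous.comp continuous_fst).add
      (continuous_snd.smul continuous_const)).measurable
  have hη := contDiff_traceProfile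
  have h1 : Measurable fun p : EuclideanSpace ℝ (Fin (d - 1)) × ℝ =>
      v (K.chart i p.1 + p.2 • ξ) * deriv traceProfile p.2 +
        (inner ℝ (G (K.chart i p.1 + p.2 • ξ)) ξ : ℝ) * traceProfile p.2 :=
    ((hv.comp hA).mul ((hη.continuous_deriv (by simp)).measurable.comp measurable_snd)).add
      (((hG.comp hA).inner measurable_const).mul (hη.continuous.measurable.comp measurable_snd))
  have h2 := h1.stronglyMeasurable.integral_prod_right' (ν := volume.restrict (Set.Ioo (0 : ℝ) 1))
  exact h2.measurable.neg

/-- Jensen's inequality on the unit segment bounds the square of the trace by an integral of `v ^ 2`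
and `‖G‖ ^ 2` along the segment. The segments from visible points run in `K`, so the oblique change
of variables bounds the total by an integral over `K`. -/
theorem memLp_obliqueTrace (hd : 1 ≤ d) (h : IsSobolevPair K.carrier v G) (i : Fin n)
    (ξ : EuclideanSpace ℝ (Fin d)) :
    MemLp (K.obliqueTrace i ξ v G) 2 (volume.restrict (K.visible i ξ)) := by
  have hm := K.isOpen.measurableSet
  have hvm := (isOpen_visible (K := K) hd i ξ).measurableSet
  have hTm := measurable_obliqueTrace (K := K) h.measurable h.measurable_grad i ξ
  rcases (K.visible i ξ).eq_empty_or_nonempty with h0 | ⟨y₀, hy₀⟩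
  · rw [h0, Measure.restrict_empty]
    exact ⟨hTm.aestronglyMeasurable, by simp⟩
  have hq := (inner_neg_of_mem_visible hy₀).ne
  have hcr := K.isHyperplaneChart hd i
  rw [memLp_two_iff_lintegral hTm.aestronglyMeasurable]
  have hη := contDiff_traceProfile
  have hη' := hη.continuous_deriv (by simp)
  obtain ⟨C₁, hC₁⟩ := (isCompact_Icc (a := (0 : ℝ)) (b := 1)).exists_bound_of_continuousOn
    hη'.continuousOn
  obtain ⟨C₂, hC₂⟩ := (isCompact_Icc (a := (0 : ℝ)) (b := 1)).exists_bound_of_continuousOn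
    hη.continuous.continuousOn
  set H : EuclideanSpace ℝ (Fin d) → ENNReal :=
    K.carrier.indicator fun x => ENNReal.ofReal (2 * (C₁ * v x) ^ 2 + 2 * (C₂ * ‖ξ‖ * ‖G x‖) ^ 2)
    with hH
  have hHm : Measurable H := by
    refine Measurable.indicator ?_ hm
    exact (((h.measurable.const_mul _).pow_const 2).const_mul 2 |>.add
      (((h.measurable_grad.norm.const_mul _).pow_const 2).const_mul 2)).ennreal_ofReal
  have hHfin : ∫⁻ x, H x < ⊤ := by
    rw [hH, lintegral_indicator hm]
    have i1 : Integrable (fun x => 2 * (C₁ * v x) ^ 2 + 2 * (C₂ * ‖ξ‖ * ‖G x‖) ^ 2)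
        (volume.restrict K.carrier) :=
      ((h.memLp.const_mul C₁).integrable_sq.const_mul 2).add
        ((h.memLp_grad.norm.const_mul (C₂ * ‖ξ‖)).integrable_sq.const_mul 2)
    exact i1.lintegral_lt_top
  have hprob : IsProbabilityMeasure (volume.restrict (Set.Ioo (0 : ℝ) 1)) :=
    ⟨by simp⟩
  have hA : Measurable fun p : EuclideanSpace ℝ (Fin (d - 1)) × ℝ => K.chart i p.1 + p.2 • ξ :=
    (((K.chart i).continuous.comp continuous_fst).add
      (continuous_snd.smul continuous_const)).measurable
  have hbound : ∀ y ∈ K.visible i ξ, ‖K.obliqueTrace i ξ v G y‖ₑ ^ 2 ≤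
      ∫⁻ t : ℝ, H (K.chart i y + t • ξ) := by
    intro y hy
    have hAy : Measurable fun t : ℝ => K.chart i y + t • ξ := by fun_prop
    rw [obliqueTrace, enorm_neg]
    refine (enorm_integral_sq_le ?_).trans ?_
    · exact (((h.measurable.comp hAy).mul hη'.measurable).add
        (((h.measurable_grad.comp hAy).inner measurable_const).mul
          hη.continuous.measurable)).aestronglyMeasurable
    refine le_trans ?_ (setLIntegral_le_lintegral (Set.Ioo (0 : ℝ) 1) _)
    refine setLIntegral_mono (hHm.comp hAy) fun t ht => ?_
    have hx := hy.2 t ⟨ht.1, ht.2.le⟩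
    rw [hH, Set.indicator_of_mem hx, Real.enorm_eq_ofReal_abs, ← ENNReal.ofReal_pow (abs_nonneg _),
      sq_abs]
    apply ENNReal.ofReal_le_ofReal
    set a := v (K.chart i y + t • ξ)
    set b := G (K.chart i y + t • ξ)
    have e1 : |deriv traceProfile t| ≤ C₁ := hC₁ t ⟨ht.1.le, ht.2.le⟩
    have e2 : |traceProfile t| ≤ C₂ := hC₂ t ⟨ht.1.le, ht.2.le⟩
    have e3 : (a * deriv traceProfile t) ^ 2 ≤ (C₁ * a) ^ 2 := by
      rw [mul_comm, mul_pow, mul_pow, ← sq_abs (deriv traceProfile t)]; gcongr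
    have e4 : ((inner ℝ b ξ : ℝ) * traceProfile t) ^ 2 ≤ (C₂ * ‖ξ‖ * ‖b‖) ^ 2 := by
      rw [← sq_abs, abs_mul]
      have := abs_real_inner_le_norm b ξ
      calc (|(inner ℝ b ξ : ℝ)| * |traceProfile t|) ^ 2 ≤ ((‖b‖ * ‖ξ‖) * C₂) ^ 2 := by gcongr
        _ = _ := by ring
    nlinarith [sq_nonneg (a * deriv traceProfile t - (inner ℝ b ξ : ℝ) * traceProfile t)]
  calc ∫⁻ y in K.visible i ξ, ‖K.obliqueTrace i ξ v G y‖ₑ ^ 2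
      ≤ ∫⁻ y in K.visible i ξ, ∫⁻ t : ℝ, H (K.chart i y + t • ξ) :=
        setLIntegral_mono' hvm hbound
    _ ≤ ∫⁻ y, ∫⁻ t : ℝ, H (K.chart i y + t • ξ) := setLIntegral_le_lintegral _ _
    _ = ∫⁻ p : EuclideanSpace ℝ (Fin (d - 1)) × ℝ, H (K.chart i p.1 + p.2 • ξ) :=
        (lintegral_prod _ (hHm.comp hA).aemeasurable).symm
    _ = _ := hcr.lintegral_oblique hq hHm
    _ < ⊤ := ENNReal.mul_lt_top ENNReal.ofReal_lt_top hHfin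

/-- A test function on a face extends to a test function that vanishes on the other faces. -/
theorem exists_extension (hd : 1 ≤ d) (i : Fin n) {O : Set (EuclideanSpace ℝ (Fin d))}
    (hO : IsOpen O) {ψ : EuclideanSpace ℝ (Fin (d - 1)) → ℝ} (hψ : ContDiff ℝ ∞ ψ)
    (hc : HasCompactSupport ψ) (hs : tsupport ψ ⊆ K.face i)
    (hsO : ∀ y ∈ tsupport ψ, K.chart i y ∈ O) :
    ∃ φ : EuclideanSpace ℝ (Fin d) → ℝ, ContDiff ℝ ∞ φ ∧ HasCompactSupport φ ∧ tsupport φ ⊆ O ∧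
      (∀ y, φ (K.chart i y) = ψ y) ∧ ∀ j, j ≠ i → ∀ y ∈ K.face j, φ (K.chart j y) = 0 := by
  have hcr := K.isHyperplaneChart hd i
  have hnn : (inner ℝ (K.normal i) (K.normal i) : ℝ) ≠ 0 := by
    rw [real_inner_self_eq_norm_sq, K.norm_normal]; norm_num
  obtain ⟨P, hP, -, hPc⟩ := hcr.exists_obliqueProjection hnn
  have hcl : IsClosed (⋃ j : {j // j ≠ i}, K.chart j '' closure (K.face j)) :=
    isClosed_iUnion_of_finite fun j =>
      ((K.face_region j).isBounded.isCompact_closure.image (K.chart j).continuous).isClosed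
  have hC : IsCompact (K.chart i '' tsupport ψ) := hc.isCompact.image (K.chart i).continuous
  obtain ⟨χ, hχ, hχc, hχs, hχ1, -⟩ := exists_smooth_one_nhds hC (hO.sdiff hcl) (by
    rintro _ ⟨y, hy, rfl⟩
    refine ⟨hsO y hy, fun hmem => ?_⟩
    obtain ⟨⟨j, hj⟩, hmem⟩ := Set.mem_iUnion.1 hmem
    exact K.chart_notMem_image_closure hd (Ne.symm hj) (hs hy) hmem)
  have hPy : ∀ y, P (K.chart i y) = y := fun y => by simpa using hPc y 0
  refine ⟨fun x => χ x * ψ (P x), hχ.mul (hψ.comp hP), hχc.mul_right,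
    (tsupport_mul_subset_left).trans (hχs.trans Set.sdiff_subset), fun y => ?_, fun j hj y hy => ?_⟩
  · simp only [hPy]
    by_cases hy : y ∈ tsupport ψ
    · rw [hχ1.self_of_nhdsSet _ (Set.mem_image_of_mem _ hy), one_mul]
    · rw [image_eq_zero_of_notMem_tsupport hy, mul_zero]
  · have : χ (K.chart j y) = 0 := by
      apply image_eq_zero_of_notMem_tsupport
      intro hmem
      exact (hχs hmem).2 (Set.mem_iUnion.2 ⟨⟨j, hj⟩, y, subset_closure hy, rfl⟩)
    simp only [this, zero_mul]

/-- Near a point visible in both directions, both traces represent the same Green pairing with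
direction `K.normal i`. Every test function on a small ball of the face extends to an admissible
one, so the difference is orthogonal to all of them. -/
theorem obliqueTrace_ae_eq (hd : 1 ≤ d) (h : IsSobolevPair K.carrier v G) (i : Fin n)
    (ξ ξ' : EuclideanSpace ℝ (Fin d)) : ∀ᵐ y, y ∈ K.visible i ξ → y ∈ K.visible i ξ' →
      K.obliqueTrace i ξ v G y = K.obliqueTrace i ξ' v G y := by
  set N : Set (EuclideanSpace ℝ (Fin (d - 1))) := {y | y ∈ K.visible i ξ ∧ y ∈ K.visible i ξ' ∧
    K.obliqueTrace i ξ v G y ≠ K.obliqueTrace i ξ' v G y} with hN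
  have hnull : volume N = 0 := by
    refine measure_null_of_locally_null _ fun y₀ hy₀ => ?_
    obtain ⟨r, hr, hK, hvis, -⟩ := exists_ball_visible hd hy₀.1
    obtain ⟨r', hr', hK', hvis', -⟩ := exists_ball_visible hd hy₀.2.1
    set s := min r r' with hs
    have hs0 : 0 < s := lt_min hr hr'
    refine ⟨N ∩ Metric.ball y₀ s, inter_mem_nhdsWithin _ (Metric.ball_mem_nhds _ hs0), ?_⟩
    have hvs : Metric.ball y₀ s ⊆ K.visible i ξ :=
      (Metric.ball_subset_ball (min_le_left _ _)).trans hvis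
    have hvs' : Metric.ball y₀ s ⊆ K.visible i ξ' :=
      (Metric.ball_subset_ball (min_le_right _ _)).trans hvis'
    have hfin : IsFiniteMeasure (volume.restrict (Metric.ball y₀ s)) :=
      ⟨by rw [Measure.restrict_apply_univ]; exact measure_ball_lt_top⟩
    have i1 : IntegrableOn (K.obliqueTrace i ξ v G) (Metric.ball y₀ s) :=
      ((memLp_obliqueTrace hd h i ξ).mono_measure
        (Measure.restrict_mono hvs le_rfl)).integrable (by norm_num)
    have i2 : IntegrableOn (K.obliqueTrace i ξ' v G) (Metric.ball y₀ s) :=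
      ((memLp_obliqueTrace hd h i ξ').mono_measure
        (Measure.restrict_mono hvs' le_rfl)).integrable (by norm_num)
    have key : ∀ᵐ y, y ∈ Metric.ball y₀ s →
        K.obliqueTrace i ξ v G y - K.obliqueTrace i ξ' v G y = 0 := by
      refine Metric.isOpen_ball.ae_eq_zero_of_integral_contDiff_smul_eq_zero
        (i1.sub i2).locallyIntegrableOn fun ψ hψ hψc hψs => ?_
      obtain ⟨φ, hφ, hφc, hφs, hφi, -⟩ := exists_extension hd i
        (Metric.isOpen_ball (x := K.chart i y₀) (ε := s)) hψ hψc
        (fun y hy => (hvs (hψs hy)).1) (fun y hy => by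
          rw [Metric.mem_ball, (K.chart i).dist_map]; exact hψs hy)
      have e1 := greenPairing_eq_obliqueTrace hd h hr (inner_neg_of_mem_visible hy₀.1) hK hvis hφ hφc
        (hφs.trans (Metric.ball_subset_ball (min_le_left _ _))) (K.normal i)
      have e2 := greenPairing_eq_obliqueTrace hd h hr' (inner_neg_of_mem_visible hy₀.2.1) hK' hvis'
        hφ hφc (hφs.trans (Metric.ball_subset_ball (min_le_right _ _))) (K.normal i)
      rw [e1] at e2
      simp only [hφi, real_inner_self_eq_norm_sq, K.norm_normal, one_pow, mul_one] at e2
      have red : ∀ f : EuclideanSpace ℝ (Fin (d - 1)) → ℝ, ∫ y in K.face i, f y * ψ y =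
          ∫ y in Metric.ball y₀ s, f y * ψ y := by
        intro f
        rw [setIntegral_eq_integral_of_forall_compl_eq_zero,
          setIntegral_eq_integral_of_forall_compl_eq_zero]
        · intro y hy
          rw [image_eq_zero_of_notMem_tsupport fun h0 => hy (hψs h0), mul_zero]
        · intro y hy
          rw [image_eq_zero_of_notMem_tsupport fun h0 => hy (hvs (hψs h0)).1, mul_zero]
      rw [red, red] at e2
      obtain ⟨Cψ, hCψ⟩ := hψc.exists_bound_of_continuous hψ.continuous
      have j1 : IntegrableOn (fun y => K.obliqueTrace i ξ v G y * ψ y) (Metric.ball y₀ s) :=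
        Integrable.mul_bdd (c := Cψ) i1 hψ.continuous.aestronglyMeasurable
          (Filter.Eventually.of_forall hCψ)
      have j2 : IntegrableOn (fun y => K.obliqueTrace i ξ' v G y * ψ y) (Metric.ball y₀ s) :=
        Integrable.mul_bdd (c := Cψ) i2 hψ.continuous.aestronglyMeasurable
          (Filter.Eventually.of_forall hCψ)
      have e3 : ∫ y, ψ y • (K.obliqueTrace i ξ v G y - K.obliqueTrace i ξ' v G y) =
          ∫ y in Metric.ball y₀ s,
            (K.obliqueTrace i ξ v G y * ψ y - K.obliqueTrace i ξ' v G y * ψ y) := by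
        rw [setIntegral_eq_integral_of_forall_compl_eq_zero]
        · congr 1; funext y; rw [smul_eq_mul]; ring
        · intro y hy
          rw [image_eq_zero_of_notMem_tsupport fun h0 => hy (hψs h0)]; ring
      rw [e3, integral_sub j1 j2, e2, sub_self]
    refine measure_mono_null (fun y hy => ?_) (ae_iff.1 key)
    simp only [Set.mem_ofPred_eq, Classical.not_imp]
    exact ⟨hy.2, sub_ne_zero.2 hy.1.2.2⟩
  filter_upwards [measure_eq_zero_iff_ae_notMem.1 hnull] with y hy h1 h2
  by_contra h3
  exact hy ⟨h1, h2, h3⟩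

end PolytopalDomain

/-! ### Existence of boundary values and the divergence theorem for smooth functions -/

namespace PolytopalDomain

variable {d n : ℕ} {K : PolytopalDomain d n} {v : EuclideanSpace ℝ (Fin d) → ℝ}
  {G : EuclideanSpace ℝ (Fin d) → EuclideanSpace ℝ (Fin d)}
  {g : Fin n → EuclideanSpace ℝ (Fin (d - 1)) → ℝ}

theorem boundaryPairing_eq_zero {φ : EuclideanSpace ℝ (Fin d) → ℝ}
    (hφ : ∀ i, ∀ y ∈ K.face i, φ (K.chart i y) = 0) (a : EuclideanSpace ℝ (Fin d)) :
    K.boundaryPairing g φ a = 0 := by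
  refine Finset.sum_eq_zero fun i _ => ?_
  rw [setIntegral_congr_fun (g := fun _ => (0 : ℝ)) (K.face_region i).isOpen.measurableSet]
  · simp
  · intro y hy
    simp [hφ i y hy]

theorem boundaryPairing_eq_single {φ : EuclideanSpace ℝ (Fin d) → ℝ} {i : Fin n}
    (hφ : ∀ j, j ≠ i → ∀ y ∈ K.face j, φ (K.chart j y) = 0) (a : EuclideanSpace ℝ (Fin d)) :
    K.boundaryPairing g φ a =
      ∫ y in K.face i, g i y * φ (K.chart i y) * inner ℝ (K.normal i) a := by
  refine Finset.sum_eq_single i (fun j _ hj => ?_) (fun h => absurd (Finset.mem_univ i) h)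
  rw [setIntegral_congr_fun (g := fun _ => (0 : ℝ)) (K.face_region j).isOpen.measurableSet]
  · simp
  · intro y hy
    simp [hφ j hj y hy]

theorem hasGreenOn_ball (hd : 1 ≤ d) (h : IsSobolevPair K.carrier v G) {i : Fin n}
    {ξ : EuclideanSpace ℝ (Fin d)}
    (hgξ : ∀ᵐ y ∂(volume.restrict (K.visible i ξ)), g i y = K.obliqueTrace i ξ v G y)
    {y₀ : EuclideanSpace ℝ (Fin (d - 1))} (hy₀ : y₀ ∈ K.visible i ξ) :
    ∃ U, IsOpen U ∧ K.chart i y₀ ∈ U ∧ K.HasGreenOn v G g U := by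
  obtain ⟨r, hr, hK, hvis, hdisj⟩ := exists_ball_visible hd hy₀
  refine ⟨_, Metric.isOpen_ball, Metric.mem_ball_self hr, fun φ hφ hc hs a => ?_⟩
  rw [greenPairing_eq_obliqueTrace hd h hr (inner_neg_of_mem_visible hy₀) hK hvis hφ hc hs,
    boundaryPairing_eq_single (i := i)]
  · refine setIntegral_congr_ae (K.face_region i).isOpen.measurableSet ?_
    filter_upwards [(ae_restrict_iff' (isOpen_visible hd i ξ).measurableSet).1 hgξ] with y hy _
    by_cases hyv : y ∈ K.visible i ξ
    · rw [hy hyv]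
    · rw [image_eq_zero_of_notMem_tsupport (f := φ)]
      · simp
      · intro h1
        have h2 := hs h1
        rw [Metric.mem_ball, (K.chart i).dist_map] at h2
        exact hyv (hvis h2)
  · intro j hj y hy
    refine image_eq_zero_of_notMem_tsupport fun h1 => ?_
    exact Set.disjoint_left.1 (hdisj j hj) (hs h1) ⟨y, subset_closure hy, rfl⟩

theorem hasGreenOn_carrier (h : IsSobolevPair K.carrier v G) : K.HasGreenOn v G g K.carrier := by
  intro φ hφ hc hs a
  rw [h.greenPairing_eq_zero K.isBounded K.isOpen.measurableSet ⟨hφ, hc, hs⟩,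
    boundaryPairing_eq_zero]
  intro i y hy
  refine image_eq_zero_of_notMem_tsupport fun h1 => ?_
  exact K.notMem_carrier_of_mem_frontier (K.chart_mem_frontier (subset_closure hy)) (hs h1)

theorem hasGreenOn_compl_closure : K.HasGreenOn v G g (closure K.carrier)ᶜ := by
  intro φ hφ hc hs a
  rw [boundaryPairing_eq_zero]
  · rw [greenPairing, setIntegral_congr_fun (g := fun _ => (0 : ℝ)) K.isOpen.measurableSet]
    · simp
    · intro x hx
      have h1 : x ∉ tsupport φ := fun h1 => hs h1 (subset_closure hx)
      simp only []
      rw [image_eq_zero_of_notMem_tsupport h1, fderiv_of_notMem_tsupport (𝕜 := ℝ) h1]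
      simp
  · intro i y hy
    refine image_eq_zero_of_notMem_tsupport fun h1 => hs h1 ?_
    exact frontier_subset_closure (K.chart_mem_frontier (subset_closure hy))

/-- The affine subspace of codimension two given by two orthogonal equations. -/
def codimTwo (q : (EuclideanSpace ℝ (Fin d) × ℝ) × (EuclideanSpace ℝ (Fin d) × ℝ)) :
    Set (EuclideanSpace ℝ (Fin d)) :=
  {x | (inner ℝ q.1.1 x : ℝ) = q.1.2 ∧ (inner ℝ q.2.1 x : ℝ) = q.2.2}

theorem HasGreenOn.of_diff_biUnion (hd : 2 ≤ d) (h : IsSobolevPair K.carrier v G)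
    (hg : ∀ i, MemLp (g i) 2 (volume.restrict (K.face i)))
    {T : Set ((EuclideanSpace ℝ (Fin d) × ℝ) × (EuclideanSpace ℝ (Fin d) × ℝ))} (hT : T.Finite)
    (hTo : ∀ q ∈ T, ‖q.1.1‖ = 1 ∧ ‖q.2.1‖ = 1 ∧ (inner ℝ q.1.1 q.2.1 : ℝ) = 0)
    {O : Set (EuclideanSpace ℝ (Fin d))} (hO : K.HasGreenOn v G g (O \ ⋃ q ∈ T, codimTwo q)) :
    K.HasGreenOn v G g O := by
  induction T, hT using Set.Finite.induction_on generalizing O with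
  | empty => simpa using hO
  | @insert q s _ _ ih =>
    refine ih (fun q' hq' => hTo q' (Or.inr hq')) ?_
    obtain ⟨h1, h2, h3⟩ := hTo q (Or.inl rfl)
    refine HasGreenOn.of_diff_codim_two hd h hg h1 h2 h3 q.1.2 q.2.2 ?_
    convert hO using 1
    rw [Set.biUnion_insert, Set.union_comm, ← Set.sdiff_sdiff]
    rfl

/-- Boundary values which agree with the oblique traces satisfy the Gauss-Green formula. -/
theorem exists_directions_hasGreenOn (hd : 2 ≤ d) (K : PolytopalDomain d n) :
    ∃ Ξ : Set (EuclideanSpace ℝ (Fin d)), Ξ.Finite ∧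
      ∀ (v : EuclideanSpace ℝ (Fin d) → ℝ)
        (G : EuclideanSpace ℝ (Fin d) → EuclideanSpace ℝ (Fin d))
        (g : Fin n → EuclideanSpace ℝ (Fin (d - 1)) → ℝ), IsSobolevPair K.carrier v G →
        (∀ i, MemLp (g i) 2 (volume.restrict (K.face i))) →
        (∀ i, ∀ ξ ∈ Ξ, ∀ᵐ y ∂(volume.restrict (K.visible i ξ)),
          g i y = K.obliqueTrace i ξ v G y) → K.HasGreenOn v G g Set.univ := by
  have hd1 : 1 ≤ d := by omega
  obtain ⟨Ξ, hΞ, hvis⟩ := exists_finite_visible (K := K) hd1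
  refine ⟨Ξ, hΞ, fun v G g h hg hgΞ => ?_⟩
  choose S hS hS0 hSv using hvis
  -- The ambient description of a hyperplane `p` of face `i`: the equation of the plane of the face,
  -- together with that of `p` carried over by the chart and normalized. The two unit normals are
  -- orthogonal.
  let q : Fin n → EuclideanSpace ℝ (Fin (d - 1)) × ℝ →
      (EuclideanSpace ℝ (Fin d) × ℝ) × (EuclideanSpace ℝ (Fin d) × ℝ) := fun i p =>
    ((K.normal i, inner ℝ (K.normal i) (K.chart i 0)),
      (‖p.1‖⁻¹ • (K.chart i).linearIsometry p.1,
        ‖p.1‖⁻¹ * (p.2 + inner ℝ ((K.chart i).linearIsometry p.1) (K.chart i 0))))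
  refine HasGreenOn.of_diff_biUnion hd h hg (T := ⋃ i, q i '' S i)
    (Set.finite_iUnion fun i => (hS i).image _) ?_ ?_
  · intro r hr
    obtain ⟨i, p, hp, rfl⟩ := Set.mem_iUnion.1 hr
    have hp0 := hS0 i p hp
    refine ⟨K.norm_normal i, ?_, ?_⟩
    · simp only [q]
      rw [norm_smul, norm_inv, norm_norm, LinearIsometry.norm_map,
        inv_mul_cancel₀ (norm_ne_zero_iff.2 hp0)]
    · simp only [q]
      rw [inner_smul_right, K.inner_normal_linear, mul_zero]
  · refine HasGreenOn.of_locally h hg fun x hx => ?_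
    by_cases hxK : x ∈ K.carrier
    · exact ⟨_, K.isOpen, hxK, hasGreenOn_carrier h⟩
    by_cases hxc : x ∈ closure K.carrier
    swap
    · exact ⟨_, isClosed_closure.isOpen_compl, hxc, hasGreenOn_compl_closure⟩
    have hxf : x ∈ frontier K.carrier := by rw [K.isOpen.frontier_eq]; exact ⟨hxc, hxK⟩
    rw [K.frontier_eq] at hxf
    obtain ⟨i, y, hy, rfl⟩ := Set.mem_iUnion.1 hxf
    obtain ⟨ξ, hξ, hyξ⟩ := hSv i y hy fun p hp hpy => hx.2 (by
      refine Set.mem_biUnion (Set.mem_iUnion.2 ⟨i, p, hp, rfl⟩) ?_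
      have h1 := AffineIsometry.apply_add (K.chart i) 0 y
      rw [zero_add] at h1
      constructor
      · simp only [q]
        rw [h1, inner_add_right, K.inner_normal_linear, add_zero]
      · simp only [q]
        rw [h1, real_inner_smul_left, inner_add_right, LinearIsometry.inner_map_map, hpy]
        ring)
    exact hasGreenOn_ball hd1 h (hgΞ i ξ hξ) hyξ

theorem exists_hasGreenOn (hd : 2 ≤ d) (h : IsSobolevPair K.carrier v G) :
    ∃ g : Fin n → EuclideanSpace ℝ (Fin (d - 1)) → ℝ,
      (∀ i, MemLp (g i) 2 (volume.restrict (K.face i))) ∧ K.HasGreenOn v G g Set.univ := by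
  have hd1 : 1 ≤ d := by omega
  obtain ⟨Ξ, hΞ, hgreen⟩ := exists_directions_hasGreenOn hd K
  have hglue : ∀ i, ∃ g : EuclideanSpace ℝ (Fin (d - 1)) → ℝ, MemLp g 2 volume ∧
      ∀ ξ ∈ Ξ, ∀ᵐ y ∂(volume.restrict (K.visible i ξ)), g y = K.obliqueTrace i ξ v G y :=
    fun i => exists_glued_memLp (fun ξ => (isOpen_visible hd1 i ξ).measurableSet)
      (fun ξ => memLp_obliqueTrace hd1 h i ξ) (fun ξ ξ' => obliqueTrace_ae_eq hd1 h i ξ ξ') hΞ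
  choose g hg hgξ using hglue
  exact ⟨g, fun i => (hg i).restrict _, hgreen v G g h (fun i => (hg i).restrict _) hgξ⟩

theorem isSobolevPair_of_contDiff {w : EuclideanSpace ℝ (Fin d) → ℝ} (hw : ContDiff ℝ ∞ w) :
    IsSobolevPair K.carrier w (gradient w) := by
  have hfin : IsFiniteMeasure (volume.restrict K.carrier) :=
    ⟨by rw [Measure.restrict_apply_univ]; exact K.isBounded.measure_lt_top⟩
  have hgc : Continuous (gradient w) :=
    (InnerProductSpace.toDual ℝ (EuclideanSpace ℝ (Fin d))).symm.continuous.comp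
      (hw.continuous_fderiv (by simp))
  have hmem : ∀ {F : Type} [NormedAddCommGroup F] {f : EuclideanSpace ℝ (Fin d) → F},
      AEStronglyMeasurable f (volume.restrict K.carrier) → Continuous f →
      MemLp f 2 (volume.restrict K.carrier) := by
    intro F _ f hm hf
    obtain ⟨C, hC⟩ := K.isBounded.isCompact_closure.exists_bound_of_continuousOn hf.continuousOn
    refine MemLp.of_bound hm C ?_
    filter_upwards [ae_restrict_mem K.isOpen.measurableSet] with x hx using hC x (subset_closure hx)
  refine ⟨hw.continuous.measurable, hgc.measurable,
    hmem hw.continuous.aestronglyMeasurable hw.continuous, hmem hgc.aestronglyMeasurable hgc,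
    fun φ hφ a => ?_⟩
  have hin : ∀ x, (inner ℝ (gradient w x) a : ℝ) = fderiv ℝ w x a := fun x => by
    rw [gradient, InnerProductSpace.toDual_symm_apply]
  simp only [hin]
  have hwd : Continuous fun x => fderiv ℝ w x a :=
    (hw.continuous_fderiv (by simp)).clm_apply continuous_const
  have hφd : Continuous fun x => fderiv ℝ φ x a :=
    (hφ.1.continuous_fderiv (by simp)).clm_apply continuous_const
  have hφdc : HasCompactSupport fun x => fderiv ℝ φ x a := hφ.2.1.fderiv_apply ℝ a
  have key := integral_mul_fderiv_eq_neg_fderiv_mul_of_integrable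
    (μ := (volume : Measure (EuclideanSpace ℝ (Fin d)))) (f := w) (g := φ) (v := a)
    ((hwd.mul hφ.1.continuous).integrable_of_hasCompactSupport hφ.2.1.mul_left)
    ((hw.continuous.mul hφd).integrable_of_hasCompactSupport hφdc.mul_left)
    ((hw.continuous.mul hφ.1.continuous).integrable_of_hasCompactSupport hφ.2.1.mul_left)
    (fun x _ => hw.differentiable (by simp) x) (fun x _ => hφ.1.differentiable (by simp) x)
  rw [setIntegral_eq_integral_of_forall_compl_eq_zero,
    setIntegral_eq_integral_of_forall_compl_eq_zero, key]
  · intro x hx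
    rw [image_eq_zero_of_notMem_tsupport fun h => hx (hφ.2.2 h), mul_zero]
  · intro x hx
    rw [fderiv_of_notMem_tsupport (𝕜 := ℝ) fun h => hx (hφ.2.2 h)]; simp

/-- The integrand is the derivative of `w` times the profile along the segment, and the profile is
one at the start and zero at the end. -/
theorem obliqueTrace_of_contDiff {w : EuclideanSpace ℝ (Fin d) → ℝ} (hw : ContDiff ℝ ∞ w)
    (i : Fin n) (ξ : EuclideanSpace ℝ (Fin d)) (y : EuclideanSpace ℝ (Fin (d - 1))) :
    K.obliqueTrace i ξ w (gradient w) y = w (K.chart i y) := by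
  have hη := contDiff_traceProfile
  have hd : ∀ t : ℝ, HasDerivAt (fun t : ℝ => w (K.chart i y + t • ξ) * traceProfile t)
      (inner ℝ (gradient w (K.chart i y + t • ξ)) ξ * traceProfile t +
        w (K.chart i y + t • ξ) * deriv traceProfile t) t := by
    intro t
    have h1 : HasDerivAt (fun t : ℝ => K.chart i y + t • ξ) ξ t := by
      simpa using ((hasDerivAt_id t).smul_const ξ).const_add (K.chart i y)
    have h2 := (hw.differentiable (by simp) (K.chart i y + t • ξ)).hasFDerivAt.comp_hasDerivAt t h1
    have h3 := h2.mul (hη.differentiable (by simp) t).hasDerivAt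
    have h4 : (inner ℝ (gradient w (K.chart i y + t • ξ)) ξ : ℝ) =
        fderiv ℝ w (K.chart i y + t • ξ) ξ := by
      rw [gradient, InnerProductSpace.toDual_symm_apply]
    rw [h4]
    exact h3
  have hgc : Continuous (gradient w) :=
    (InnerProductSpace.toDual ℝ (EuclideanSpace ℝ (Fin d))).symm.continuous.comp
      (hw.continuous_fderiv (by simp))
  have hA : Continuous fun t : ℝ => K.chart i y + t • ξ := by fun_prop
  have hcont : Continuous fun t : ℝ => (inner ℝ (gradient w (K.chart i y + t • ξ)) ξ : ℝ) *
      traceProfile t + w (K.chart i y + t • ξ) * deriv traceProfile t :=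
    (((hgc.comp hA).inner continuous_const).mul hη.continuous).add
      ((hw.continuous.comp hA).mul (hη.continuous_deriv (by simp)))
  have hint := intervalIntegral.integral_eq_sub_of_hasDerivAt (a := 0) (b := 1)
    (fun t _ => hd t) (hcont.intervalIntegrable _ _)
  rw [traceProfile_eq_zero (t := 1) (by norm_num), traceProfile_zero] at hint
  simp only [zero_smul, add_zero, mul_one, mul_zero, zero_sub] at hint
  rw [obliqueTrace, ← integral_Ioc_eq_integral_Ioo, ← intervalIntegral.integral_of_le zero_le_one,
    ← neg_neg (w (K.chart i y)), ← hint]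
  congr 2
  funext t; ring

theorem hasGreenOn_of_contDiff (hd : 2 ≤ d) {w : EuclideanSpace ℝ (Fin d) → ℝ}
    (hw : ContDiff ℝ ∞ w) :
    K.HasGreenOn w (gradient w) (fun i y => w (K.chart i y)) Set.univ := by
  obtain ⟨Ξ, -, hgreen⟩ := exists_directions_hasGreenOn hd K
  refine hgreen _ _ _ (isSobolevPair_of_contDiff hw) (fun i => ?_) (fun i ξ _ =>
    Filter.Eventually.of_forall fun y => (obliqueTrace_of_contDiff hw i ξ y).symm)
  have hc : Continuous fun y => w (K.chart i y) := hw.continuous.comp (K.chart i).continuous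
  have hfin : IsFiniteMeasure (volume.restrict (K.face i)) :=
    ⟨by rw [Measure.restrict_apply_univ]; exact (K.face_region i).isBounded.measure_lt_top⟩
  obtain ⟨C, hC⟩ := (K.face_region i).isBounded.isCompact_closure.exists_bound_of_continuousOn
    hc.continuousOn
  refine MemLp.of_bound hc.aestronglyMeasurable C ?_
  filter_upwards [ae_restrict_mem (K.face_region i).isOpen.measurableSet] with y hy using
    hC y (subset_closure hy)

end PolytopalDomain

/-! ### Functionals on `L²` and uniqueness of weak gradients -/

section L2

variable {m : ℕ} {Ω : Set (EuclideanSpace ℝ (Fin m))}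

theorem exists_clm_integral_mul {c : EuclideanSpace ℝ (Fin m) → ℝ}
    (hc : MemLp c 2 (volume.restrict Ω)) :
    ∃ ℓ : L2 Ω ℝ →L[ℝ] ℝ, ∀ v : L2 Ω ℝ, ℓ v = ∫ x in Ω, v x * c x := by
  refine ⟨innerSL ℝ (hc.toLp c), fun v => ?_⟩
  rw [innerSL_apply_apply, L2.inner_def]
  refine integral_congr_ae ?_
  filter_upwards [hc.coeFn_toLp] with x hx
  rw [hx]; simp

theorem exists_clm_integral_inner {c : EuclideanSpace ℝ (Fin m) → EuclideanSpace ℝ (Fin m)}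
    (hc : MemLp c 2 (volume.restrict Ω)) :
    ∃ ℓ : L2 Ω (EuclideanSpace ℝ (Fin m)) →L[ℝ] ℝ,
      ∀ G : L2 Ω (EuclideanSpace ℝ (Fin m)), ℓ G = ∫ x in Ω, inner ℝ (G x) (c x) := by
  refine ⟨innerSL ℝ (hc.toLp c), fun v => ?_⟩
  rw [innerSL_apply_apply, L2.inner_def]
  refine integral_congr_ae ?_
  filter_upwards [hc.coeFn_toLp] with x hx
  rw [hx, real_inner_comm]

theorem memLp_of_isBounded (hb : Bornology.IsBounded Ω) (hm : MeasurableSet Ω) {F : Type}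
    [NormedAddCommGroup F] [SecondCountableTopology F]
    {f : EuclideanSpace ℝ (Fin m) → F} (hf : Continuous f) : MemLp f 2 (volume.restrict Ω) := by
  have hfin : IsFiniteMeasure (volume.restrict Ω) :=
    ⟨by rw [Measure.restrict_apply_univ]; exact hb.measure_lt_top⟩
  obtain ⟨C, hC⟩ := hb.isCompact_closure.exists_bound_of_continuousOn hf.continuousOn
  refine MemLp.of_bound hf.aestronglyMeasurable C ?_
  filter_upwards [ae_restrict_mem hm] with x hx using hC x (subset_closure hx)

/-- A function that is orthogonal to all test functions vanishes. -/
theorem L2.eq_zero_of_forall_testFunction (ho : IsOpen Ω) (hb : Bornology.IsBounded Ω)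
    {f : EuclideanSpace ℝ (Fin m) → ℝ} (hf : MemLp f 2 (volume.restrict Ω))
    (h : ∀ φ, IsTestFunction Ω φ → ∫ x in Ω, f x * φ x = 0) :
    f =ᵐ[volume.restrict Ω] 0 := by
  have hfin : IsFiniteMeasure (volume.restrict Ω) :=
    ⟨by rw [Measure.restrict_apply_univ]; exact hb.measure_lt_top⟩
  have i1 : IntegrableOn f Ω := hf.integrable (by norm_num)
  have key := ho.ae_eq_zero_of_integral_contDiff_smul_eq_zero (μ := volume)
    i1.locallyIntegrableOn fun φ hφ hc hs => by
      rw [← h φ ⟨hφ, hc, hs⟩, setIntegral_eq_integral_of_forall_compl_eq_zero]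
      · congr 1; funext x; rw [smul_eq_mul, mul_comm]
      · intro x hx
        rw [image_eq_zero_of_notMem_tsupport fun h => hx (hs h), mul_zero]
  exact (ae_restrict_iff' ho.measurableSet).2 key

theorem HasWeakGradient.unique (ho : IsOpen Ω) (hb : Bornology.IsBounded Ω) {v : L2 Ω ℝ}
    {G G' : L2 Ω (EuclideanSpace ℝ (Fin m))} (h : HasWeakGradient v G)
    (h' : HasWeakGradient v G') : G = G' := by
  have key : ∀ j, (fun x => (inner ℝ (G x - G' x) (EuclideanSpace.single j (1 : ℝ)) : ℝ))
      =ᵐ[volume.restrict Ω] 0 := by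
    intro j
    refine L2.eq_zero_of_forall_testFunction ho hb
      (memLp_inner_const ((Lp.memLp G).sub (Lp.memLp G')) _) fun φ hφ => ?_
    have e := (h φ hφ (EuclideanSpace.single j 1)).symm.trans (h' φ hφ (EuclideanSpace.single j 1))
    have i1 := integrable_mul_of_isBounded hb ho.measurableSet
      (memLp_inner_const (Lp.memLp G) (EuclideanSpace.single j 1)) hφ.1.continuous
    have i2 := integrable_mul_of_isBounded hb ho.measurableSet
      (memLp_inner_const (Lp.memLp G') (EuclideanSpace.single j 1)) hφ.1.continuous
    simp only [inner_sub_left, sub_mul]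
    rw [integral_sub i1 i2, neg_injective e, sub_self]
  apply Lp.ext
  filter_upwards [ae_all_iff.2 key] with x hx
  ext j
  have := hx j
  simp only [EuclideanSpace.inner_single_right] at this
  simpa [sub_eq_zero] using this

end L2

/-! ### The trace and the Hilbert space `H¹(K)` -/

namespace PolytopalDomain

variable {d n : ℕ} {K : PolytopalDomain d n}

theorem isSobolevPair_coe {v : L2 K.carrier ℝ} {G : L2 K.carrier (EuclideanSpace ℝ (Fin d))}
    (h : HasWeakGradient v G) : IsSobolevPair K.carrier v G :=
  ⟨(Lp.stronglyMeasurable v).measurable, (Lp.stronglyMeasurable G).measurable, Lp.memLp v,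
    Lp.memLp G, h⟩

/-- The interior side of the Gauss–Green formula is the same for both families. Extensions of face
test functions that vanish on the other faces, with the direction `K.normal i`, isolate the values
on face `i`. -/
theorem IsTrace.unique (hd : 1 ≤ d) {v : L2 K.carrier ℝ} {g g' : ∀ i, L2 (K.face i) ℝ}
    (h : K.IsTrace v g) (h' : K.IsTrace v g') : g = g' := by
  obtain ⟨G, hG, hg⟩ := h
  obtain ⟨G', hG', hg'⟩ := h'
  have hGG := hG.unique K.isOpen K.isBounded hG'
  subst hGG
  funext i
  have key : (fun y => g i y - g' i y) =ᵐ[volume.restrict (K.face i)] 0 := by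
    refine L2.eq_zero_of_forall_testFunction (K.face_region i).isOpen (K.face_region i).isBounded
      ((Lp.memLp (g i)).sub (Lp.memLp (g' i))) fun ψ hψ => ?_
    obtain ⟨φ, hφ, -, -, hφi, hφj⟩ := exists_extension hd i isOpen_univ hψ.1 hψ.2.1 hψ.2.2
      (fun _ _ => trivial)
    have e : K.boundaryPairing (fun i => g i) φ (K.normal i) =
        K.boundaryPairing (fun i => g' i) φ (K.normal i) :=
      (hg φ hφ (K.normal i)).symm.trans (hg' φ hφ (K.normal i))
    rw [boundaryPairing_eq_single hφj, boundaryPairing_eq_single hφj] at e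
    simp only [hφi, real_inner_self_eq_norm_sq, K.norm_normal, one_pow, mul_one] at e
    have hm := (K.face_region i).isOpen.measurableSet
    have hb := (K.face_region i).isBounded
    simp only [sub_mul]
    rw [integral_sub (integrable_mul_of_isBounded hb hm (Lp.memLp (g i)) hψ.1.continuous)
      (integrable_mul_of_isBounded hb hm (Lp.memLp (g' i)) hψ.1.continuous), e, sub_self]
  apply Lp.ext
  filter_upwards [key] with y hy
  exact sub_eq_zero.1 hy

theorem exists_isTrace (hd : 2 ≤ d) {v : L2 K.carrier ℝ}
    {G : L2 K.carrier (EuclideanSpace ℝ (Fin d))} (h : HasWeakGradient v G) :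
    ∃ g, K.IsTrace v g := by
  obtain ⟨g, hg, hgreen⟩ := exists_hasGreenOn hd (isSobolevPair_coe h)
  refine ⟨fun i => (hg i).toLp (g i), G, h, fun φ hφ a => ?_⟩
  refine (hgreen.green_of_univ hφ a).trans (Finset.sum_congr rfl fun i _ => integral_congr_ae ?_)
  filter_upwards [(hg i).coeFn_toLp] with y hy
  rw [hy]

theorem IsTrace.trace_eq (hd : 1 ≤ d) {v : L2 K.carrier ℝ} {g : ∀ i, L2 (K.face i) ℝ}
    (h : K.IsTrace v g) : K.trace v = g := by
  have hex : ∃ g, K.IsTrace v g := ⟨g, h⟩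
  unfold trace
  rw [dif_pos hex]
  exact hex.choose_spec.unique hd h

theorem isTrace_trace (hd : 2 ≤ d) {v : L2 K.carrier ℝ}
    {G : L2 K.carrier (EuclideanSpace ℝ (Fin d))} (h : HasWeakGradient v G) :
    K.IsTrace v (K.trace v) := by
  have hex := exists_isTrace hd h
  unfold trace
  rw [dif_pos hex]
  exact hex.choose_spec

theorem greenPairing_eq_trace (hd : 2 ≤ d) {v : L2 K.carrier ℝ}
    {G : L2 K.carrier (EuclideanSpace ℝ (Fin d))} (h : HasWeakGradient v G)
    {φ : EuclideanSpace ℝ (Fin d) → ℝ} (hφ : ContDiff ℝ ∞ φ) (a : EuclideanSpace ℝ (Fin d)) :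
    greenPairing K.carrier v G φ a = K.boundaryPairing (fun i => K.trace v i) φ a := by
  obtain ⟨G', hG', hg⟩ := isTrace_trace hd h
  have hGG := h.unique K.isOpen K.isBounded hG'
  subst hGG
  exact hg φ hφ a

/-- The boundary values of a smooth function are its trace. -/
theorem exists_smooth_trace (hd : 2 ≤ d) (K : PolytopalDomain d n)
    {w : EuclideanSpace ℝ (Fin d) → ℝ} (hw : ContDiff ℝ ∞ w) :
    ∃ (v : L2 K.carrier ℝ) (G : L2 K.carrier (EuclideanSpace ℝ (Fin d))), HasWeakGradient v G ∧
      v =ᵐ[volume.restrict K.carrier] w ∧ G =ᵐ[volume.restrict K.carrier] gradient w ∧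
      ∀ i, K.trace v i =ᵐ[volume.restrict (K.face i)] fun y => w (K.chart i y) := by
  have hs := isSobolevPair_of_contDiff (K := K) hw
  have hv := hs.memLp.coeFn_toLp
  have hG := hs.memLp_grad.coeFn_toLp
  have hgm : ∀ i, MemLp (fun y => w (K.chart i y)) 2 (volume.restrict (K.face i)) := fun i =>
    memLp_of_isBounded (K.face_region i).isBounded (K.face_region i).isOpen.measurableSet
      (hw.continuous.comp (K.chart i).continuous)
  have hweak : HasWeakGradient (hs.memLp.toLp w) (hs.memLp_grad.toLp (gradient w)) := by
    intro φ hφ a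
    have h1 := hs.weak φ hφ a
    have e1 : ∫ x in K.carrier, hs.memLp.toLp w x * fderiv ℝ φ x a =
        ∫ x in K.carrier, w x * fderiv ℝ φ x a := by
      refine integral_congr_ae ?_
      filter_upwards [hv] with x hx
      rw [hx]
    have e2 : ∫ x in K.carrier, (inner ℝ (hs.memLp_grad.toLp (gradient w) x) a : ℝ) * φ x =
        ∫ x in K.carrier, (inner ℝ (gradient w x) a : ℝ) * φ x := by
      refine integral_congr_ae ?_
      filter_upwards [hG] with x hx
      rw [hx]
    rw [e1, e2, h1]
  refine ⟨_, _, hweak, hv, hG, ?_⟩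
  have htr : K.IsTrace (hs.memLp.toLp w) (fun i => (hgm i).toLp _) := by
    refine ⟨_, hweak, fun φ hφ a => ?_⟩
    have h1 := (hasGreenOn_of_contDiff (K := K) hd hw).green_of_univ hφ a
    refine (integral_congr_ae ?_).trans (h1.trans (Finset.sum_congr rfl fun i _ =>
      integral_congr_ae ?_))
    · filter_upwards [hv, hG] with x hx hx'
      rw [hx, hx']
    · filter_upwards [(hgm i).coeFn_toLp] with y hy
      rw [hy]
  intro i
  rw [htr.trace_eq (by omega)]
  exact (hgm i).coeFn_toLp

variable (K)

/-- The Sobolev space `H¹(K)` as a space of pairs of a function and its weak gradient. -/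
def sobolev : Submodule ℝ (WithLp 2 (L2 K.carrier ℝ × L2 K.carrier (EuclideanSpace ℝ (Fin d)))) where
  carrier := {p | HasWeakGradient p.fst p.snd}
  zero_mem' := by
    intro φ _ a
    have e1 : ∫ x in K.carrier, ((0 : L2 K.carrier ℝ) x) * fderiv ℝ φ x a = 0 := by
      rw [integral_eq_zero_of_ae]
      filter_upwards [Lp.coeFn_zero ℝ 2 (volume.restrict K.carrier)] with x hx
      rw [hx, Pi.zero_apply, zero_mul]
    have e2 : ∫ x in K.carrier,
        (inner ℝ ((0 : L2 K.carrier (EuclideanSpace ℝ (Fin d))) x) a : ℝ) * φ x = 0 := by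
      rw [integral_eq_zero_of_ae]
      filter_upwards [Lp.coeFn_zero (EuclideanSpace ℝ (Fin d)) 2 (volume.restrict K.carrier)]
        with x hx
      rw [hx, Pi.zero_apply, inner_zero_left, zero_mul]; rfl
    change ∫ x in K.carrier, ((0 : L2 K.carrier ℝ) x) * fderiv ℝ φ x a =
      -∫ x in K.carrier, (inner ℝ ((0 : L2 K.carrier (EuclideanSpace ℝ (Fin d))) x) a : ℝ) * φ x
    rw [e1, e2, neg_zero]
  add_mem' := by
    intro p q hp hq φ hφ a
    have hb := K.isBounded
    have hm := K.isOpen.measurableSet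
    have hdc : Continuous fun x => fderiv ℝ φ x a :=
      (hφ.1.continuous_fderiv (by simp)).clm_apply continuous_const
    have e1 : ∫ x in K.carrier, ((p.fst + q.fst : L2 K.carrier ℝ) x) * fderiv ℝ φ x a =
        (∫ x in K.carrier, p.fst x * fderiv ℝ φ x a) +
          ∫ x in K.carrier, q.fst x * fderiv ℝ φ x a := by
      rw [← integral_add (integrable_mul_of_isBounded hb hm (Lp.memLp p.fst) hdc)
        (integrable_mul_of_isBounded hb hm (Lp.memLp q.fst) hdc)]
      refine integral_congr_ae ?_
      filter_upwards [Lp.coeFn_add p.fst q.fst] with x hx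
      rw [hx, Pi.add_apply, add_mul]
    have e2 : ∫ x in K.carrier, (inner ℝ
          ((p.snd + q.snd : L2 K.carrier (EuclideanSpace ℝ (Fin d))) x) a : ℝ) * φ x =
        (∫ x in K.carrier, (inner ℝ (p.snd x) a : ℝ) * φ x) +
          ∫ x in K.carrier, (inner ℝ (q.snd x) a : ℝ) * φ x := by
      rw [← integral_add (integrable_mul_of_isBounded hb hm
          (memLp_inner_const (Lp.memLp p.snd) a) hφ.1.continuous)
        (integrable_mul_of_isBounded hb hm (memLp_inner_const (Lp.memLp q.snd) a)
          hφ.1.continuous)]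
      refine integral_congr_ae ?_
      filter_upwards [Lp.coeFn_add p.snd q.snd] with x hx
      rw [hx, Pi.add_apply, inner_add_left, add_mul]
    have h1 := hp φ hφ a
    have h2 := hq φ hφ a
    change ∫ x in K.carrier, ((p.fst + q.fst : L2 K.carrier ℝ) x) * fderiv ℝ φ x a =
      -∫ x in K.carrier, (inner ℝ
          ((p.snd + q.snd : L2 K.carrier (EuclideanSpace ℝ (Fin d))) x) a : ℝ) * φ x
    rw [e1, e2, h1, h2, neg_add]
  smul_mem' := by
    intro r p hp φ hφ a
    have e1 : ∫ x in K.carrier, ((r • p.fst : L2 K.carrier ℝ) x) * fderiv ℝ φ x a =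
        r * ∫ x in K.carrier, p.fst x * fderiv ℝ φ x a := by
      rw [← integral_const_mul]
      refine integral_congr_ae ?_
      filter_upwards [Lp.coeFn_smul r p.fst] with x hx
      rw [hx, Pi.smul_apply, smul_eq_mul, mul_assoc]
    have e2 : ∫ x in K.carrier, (inner ℝ
          ((r • p.snd : L2 K.carrier (EuclideanSpace ℝ (Fin d))) x) a : ℝ) * φ x =
        r * ∫ x in K.carrier, (inner ℝ (p.snd x) a : ℝ) * φ x := by
      rw [← integral_const_mul]
      refine integral_congr_ae ?_
      filter_upwards [Lp.coeFn_smul r p.snd] with x hx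
      rw [hx, Pi.smul_apply, real_inner_smul_left, mul_assoc]
    have h1 := hp φ hφ a
    change ∫ x in K.carrier, ((r • p.fst : L2 K.carrier ℝ) x) * fderiv ℝ φ x a =
      -∫ x in K.carrier, (inner ℝ
          ((r • p.snd : L2 K.carrier (EuclideanSpace ℝ (Fin d))) x) a : ℝ) * φ x
    rw [e1, e2, h1, mul_neg]

/-- The defining equations are equalities of bounded functionals. Closedness makes `H¹(K)` complete,
as Lax–Milgram requires. -/
theorem isClosed_sobolev :
    IsClosed (K.sobolev : Set (WithLp 2 (L2 K.carrier ℝ × L2 K.carrier (EuclideanSpace ℝ (Fin d))))) := by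
  have heq : (K.sobolev : Set (WithLp 2 (L2 K.carrier ℝ × L2 K.carrier
      (EuclideanSpace ℝ (Fin d))))) = ⋂ (φ) (_ : IsTestFunction K.carrier φ)
      (a : EuclideanSpace ℝ (Fin d)), {p | ∫ x in K.carrier, p.fst x * fderiv ℝ φ x a =
        -∫ x in K.carrier, (inner ℝ (p.snd x) a : ℝ) * φ x} := by
    ext p
    simp only [Set.mem_iInter]
    rfl
  rw [heq]
  refine isClosed_iInter fun φ => isClosed_iInter fun hφ => isClosed_iInter fun a => ?_
  have hdc : Continuous fun x => fderiv ℝ φ x a :=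
    (hφ.1.continuous_fderiv (by simp)).clm_apply continuous_const
  obtain ⟨ℓ₁, h₁⟩ := exists_clm_integral_mul
    (memLp_of_isBounded K.isBounded K.isOpen.measurableSet hdc)
  obtain ⟨ℓ₂, h₂⟩ := exists_clm_integral_inner (c := fun x => φ x • a)
    (memLp_of_isBounded K.isBounded K.isOpen.measurableSet (hφ.1.continuous.smul continuous_const))
  have h₂' : ∀ G : L2 K.carrier (EuclideanSpace ℝ (Fin d)),
      ℓ₂ G = ∫ x in K.carrier, (inner ℝ (G x) a : ℝ) * φ x := fun G => by
    rw [h₂]; congr 1; funext x; rw [inner_smul_right, mul_comm]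
  simp only [← h₁, ← h₂']
  exact isClosed_eq (ℓ₁.continuous.comp (WithLp.continuous_fst ..))
    (ℓ₂.continuous.comp (WithLp.continuous_snd ..)).neg

instance : CompleteSpace K.sobolev := K.isClosed_sobolev.completeSpace_coe

end PolytopalDomain

/-! ### Linearity and boundedness of the trace -/

namespace PolytopalDomain

variable {d n : ℕ} {K : PolytopalDomain d n}

theorem boundaryPairing_coe_add (g g' : ∀ i, L2 (K.face i) ℝ) {φ : EuclideanSpace ℝ (Fin d) → ℝ}
    (hφ : Continuous φ) (a : EuclideanSpace ℝ (Fin d)) :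
    K.boundaryPairing (fun i => (g i + g' i : L2 (K.face i) ℝ)) φ a =
      K.boundaryPairing (fun i => g i) φ a + K.boundaryPairing (fun i => g' i) φ a := by
  unfold boundaryPairing
  rw [← Finset.sum_add_distrib]
  refine Finset.sum_congr rfl fun i _ => ?_
  rw [← integral_add (integrable_boundary (g := fun i => g i) (fun i => Lp.memLp (g i)) hφ a i)
    (integrable_boundary (g := fun i => g' i) (fun i => Lp.memLp (g' i)) hφ a i)]
  refine integral_congr_ae ?_
  filter_upwards [Lp.coeFn_add (g i) (g' i)] with y hy
  rw [hy, Pi.add_apply]; ring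

theorem boundaryPairing_coe_smul (r : ℝ) (g : ∀ i, L2 (K.face i) ℝ)
    (φ : EuclideanSpace ℝ (Fin d) → ℝ) (a : EuclideanSpace ℝ (Fin d)) :
    K.boundaryPairing (fun i => (r • g i : L2 (K.face i) ℝ)) φ a =
      r * K.boundaryPairing (fun i => g i) φ a := by
  unfold boundaryPairing
  rw [Finset.mul_sum]
  refine Finset.sum_congr rfl fun i _ => ?_
  rw [← integral_const_mul]
  refine integral_congr_ae ?_
  filter_upwards [Lp.coeFn_smul r (g i)] with y hy
  rw [hy, Pi.smul_apply, smul_eq_mul]; ring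

variable (K) in
/-- The pairing with a smooth function as a functional on pairs of a function and a field. -/
theorem exists_clm_greenPairing {φ : EuclideanSpace ℝ (Fin d) → ℝ} (hφ : ContDiff ℝ ∞ φ)
    (a : EuclideanSpace ℝ (Fin d)) :
    ∃ ℓ : WithLp 2 (L2 K.carrier ℝ × L2 K.carrier (EuclideanSpace ℝ (Fin d))) →L[ℝ] ℝ,
      ∀ p, ℓ p = greenPairing K.carrier p.fst p.snd φ a := by
  have hb := K.isBounded
  have hm := K.isOpen.measurableSet
  have hdc : Continuous fun x => fderiv ℝ φ x a :=
    (hφ.continuous_fderiv (by simp)).clm_apply continuous_const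
  obtain ⟨ℓ₁, h₁⟩ := exists_clm_integral_mul (memLp_of_isBounded hb hm hdc)
  obtain ⟨ℓ₂, h₂⟩ := exists_clm_integral_inner (c := fun x => φ x • a)
    (memLp_of_isBounded hb hm (hφ.continuous.smul continuous_const))
  refine ⟨ℓ₁.comp (WithLp.fstL 2 ℝ _ _) + ℓ₂.comp (WithLp.sndL 2 ℝ _ _), fun p => ?_⟩
  rw [greenPairing, integral_add (integrable_mul_of_isBounded hb hm (Lp.memLp p.fst) hdc)
    (integrable_mul_of_isBounded hb hm (memLp_inner_const (Lp.memLp p.snd) a) hφ.continuous)]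
  change ℓ₁ p.fst + ℓ₂ p.snd = _
  rw [h₁, h₂]
  congr 2
  funext x
  rw [inner_smul_right, mul_comm]

theorem trace_add (hd : 2 ≤ d) (p q : K.sobolev) :
    K.trace (p.1.fst + q.1.fst) = K.trace p.1.fst + K.trace q.1.fst := by
  refine IsTrace.trace_eq (by omega) ⟨p.1.snd + q.1.snd, (p + q).2, fun φ hφ a => ?_⟩
  obtain ⟨ℓ, hℓ⟩ := K.exists_clm_greenPairing hφ a
  have e1 := hℓ (p.1 + q.1)
  rw [map_add, hℓ, hℓ, greenPairing_eq_trace hd p.2 hφ, greenPairing_eq_trace hd q.2 hφ,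
    ← boundaryPairing_coe_add _ _ hφ.continuous] at e1
  exact e1.symm

theorem trace_smul (hd : 2 ≤ d) (r : ℝ) (p : K.sobolev) :
    K.trace (r • p.1.fst) = r • K.trace p.1.fst := by
  refine IsTrace.trace_eq (by omega) ⟨r • p.1.snd, (r • p).2, fun φ hφ a => ?_⟩
  obtain ⟨ℓ, hℓ⟩ := K.exists_clm_greenPairing hφ a
  have e1 := hℓ (r • p.1)
  rw [map_smul, hℓ, greenPairing_eq_trace hd p.2 hφ, smul_eq_mul,
    ← boundaryPairing_coe_smul] at e1
  exact e1.symm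

variable (K) in
/-- The trace as a linear map on `H¹(K)`. -/
noncomputable def traceLinear (hd : 2 ≤ d) : K.sobolev →ₗ[ℝ] (∀ i, L2 (K.face i) ℝ) where
  toFun p := K.trace p.1.fst
  map_add' p q := trace_add hd p q
  map_smul' r p := trace_smul hd r p

/-- By the closed graph theorem no trace inequality is needed: the Gauss–Green formula for each
fixed smooth `φ` passes to limits on both sides, so the limit of the traces is the trace of the
limit. -/
theorem continuous_traceLinear (hd : 2 ≤ d) : Continuous (K.traceLinear hd) := by
  refine (K.traceLinear hd).continuous_of_seq_closed_graph fun u p g hu hg => ?_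
  refine ((IsTrace.trace_eq (by omega) ⟨p.1.snd, p.2, fun φ hφ a => ?_⟩ :
    K.trace p.1.fst = g)).symm
  obtain ⟨ℓ, hℓ⟩ := K.exists_clm_greenPairing hφ a
  have hface : ∀ i, ∃ m : L2 (K.face i) ℝ →L[ℝ] ℝ, ∀ g, m g =
      ∫ y in K.face i, g y * φ (K.chart i y) * inner ℝ (K.normal i) a := by
    intro i
    obtain ⟨m, hm⟩ := exists_clm_integral_mul
      (c := fun y => φ (K.chart i y) * (inner ℝ (K.normal i) a : ℝ))
      (memLp_of_isBounded (K.face_region i).isBounded (K.face_region i).isOpen.measurableSet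
        ((hφ.continuous.comp (K.chart i).continuous).mul continuous_const))
    exact ⟨m, fun g => by rw [hm]; simp only [mul_assoc]⟩
  choose m hm using hface
  have l1 : Filter.Tendsto (fun k => ℓ (u k).1) Filter.atTop (𝓝 (ℓ p.1)) :=
    (ℓ.continuous.comp continuous_subtype_val).continuousAt.tendsto.comp hu
  have l2 : Filter.Tendsto (fun k => ∑ i, m i (K.traceLinear hd (u k) i)) Filter.atTop
      (𝓝 (∑ i, m i (g i))) := by
    refine tendsto_finsetSum _ fun i _ => ?_
    exact ((m i).continuous.comp (continuous_apply i)).continuousAt.tendsto.comp hg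
  have l3 : ∀ k, ℓ (u k).1 = ∑ i, m i (K.traceLinear hd (u k) i) := by
    intro k
    rw [hℓ, greenPairing_eq_trace hd (u k).2 hφ]
    exact Finset.sum_congr rfl fun i _ => (hm i _).symm
  simp only [l3] at l1
  have l4 := tendsto_nhds_unique l1 l2
  rw [hℓ] at l4
  exact l4.trans (Finset.sum_congr rfl fun i _ => hm i _)

/-- Integration of the trace against a continuous function is a bounded functional on `H¹(K)`. -/
theorem exists_clm_trace (hd : 2 ≤ d) (i : Fin n) {c : EuclideanSpace ℝ (Fin (d - 1)) → ℝ}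
    (hc : Continuous c) : ∃ ℓ : K.sobolev →L[ℝ] ℝ, ∀ p : K.sobolev,
      ℓ p = ∫ y in K.face i, K.trace p.1.fst i y * c y := by
  obtain ⟨m, hm⟩ := exists_clm_integral_mul (memLp_of_isBounded (K.face_region i).isBounded
    (K.face_region i).isOpen.measurableSet hc)
  exact ⟨m.comp ((ContinuousLinearMap.proj i).comp
    ⟨K.traceLinear hd, continuous_traceLinear hd⟩), fun p => hm _⟩

end PolytopalDomain

/-! ### Translation estimates and the Poincaré inequality on convex sets -/

section Translation

variable {m : ℕ} {Ω : Set (EuclideanSpace ℝ (Fin m))} {v : EuclideanSpace ℝ (Fin m) → ℝ}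
  {G : EuclideanSpace ℝ (Fin m) → EuclideanSpace ℝ (Fin m)}

/-- The fundamental theorem of calculus for Sobolev functions on segments inside a convex set. -/
theorem IsSobolevPair.ae_sub_eq_integral (h : IsSobolevPair Ω v G) (hΩ : IsOpen Ω)
    (hb : Bornology.IsBounded Ω) {C : Set (EuclideanSpace ℝ (Fin m))} (hC : Convex ℝ C)
    (ho : IsOpen C) (hCΩ : C ⊆ Ω) (z : EuclideanSpace ℝ (Fin m)) :
    ∀ᵐ x, x ∈ C ∩ (fun x => x + z) ⁻¹' C →
      v (x + z) - v x = ∫ t in Set.Ioo (0 : ℝ) 1, inner ℝ (Ω.indicator G (x + t • z)) z := by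
  have hfin : IsFiniteMeasure (volume.restrict Ω) :=
    ⟨by rw [Measure.restrict_apply_univ]; exact hb.measure_lt_top⟩
  have hm := hΩ.measurableSet
  set v₀ := Ω.indicator v with hv₀
  set q : EuclideanSpace ℝ (Fin m) → ℝ := fun x => inner ℝ (Ω.indicator G x) z with hq
  have hqi : q = Ω.indicator fun x => (inner ℝ (G x) z : ℝ) := by
    funext x
    by_cases hx : x ∈ Ω
    · simp [hq, Set.indicator_of_mem hx]
    · simp [hq, Set.indicator_of_notMem hx]
  have iv : Integrable v₀ := (integrable_indicator_iff hm).2 (h.memLp.integrable (by norm_num))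
  have iq : Integrable q := by
    rw [hqi]
    exact (integrable_indicator_iff hm).2
      ((memLp_inner_const h.memLp_grad z).integrable (by norm_num))
  have hqm : Measurable q := (h.measurable_grad.indicator hm).inner measurable_const
  set μ : Measure ℝ := volume.restrict (Set.Ioo (0 : ℝ) 1) with hμ
  have hμf : IsFiniteMeasure μ := ⟨by simp [hμ]⟩
  set U := C ∩ (fun x => x + z) ⁻¹' C with hU
  have hUo : IsOpen U := ho.inter (ho.preimage (by fun_prop))
  have hUΩ : U ⊆ Ω := Set.inter_subset_left.trans hCΩ
  -- the shear
  have hshear : MeasurePreserving (fun p : EuclideanSpace ℝ (Fin m) × ℝ => (p.1 + p.2 • z, p.2))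
      (volume.prod μ) (volume.prod μ) := by
    have h1 : MeasurePreserving (fun p : ℝ × EuclideanSpace ℝ (Fin m) => (p.1, p.2 + p.1 • z))
        (μ.prod volume) (μ.prod volume) := by
      refine MeasurePreserving.skew_product (g := fun t y => y + t • z) (MeasurePreserving.id _)
        (by fun_prop) (Filter.Eventually.of_forall fun t => ?_)
      exact map_add_right_eq_self volume (t • z)
    exact Measure.measurePreserving_swap.comp (h1.comp Measure.measurePreserving_swap)
  have iqs : Integrable (fun p : EuclideanSpace ℝ (Fin m) × ℝ => q (p.1 + p.2 • z))
      (volume.prod μ) :=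
    hshear.integrable_comp_of_integrable (iq.comp_fst μ)
  set D : EuclideanSpace ℝ (Fin m) → ℝ := fun x => v₀ (x + z) - v₀ x - ∫ t, q (x + t • z) ∂μ
    with hD
  have ivz : Integrable (fun x => v₀ (x + z)) := iv.comp_add_right z
  have iqI : Integrable (fun x => ∫ t, q (x + t • z) ∂μ) := iqs.integral_prod_left
  have iD : Integrable D := (ivz.sub iv).sub iqI
  have key : ∀ᵐ x, x ∈ U → D x = 0 := by
    -- Test with `φ` supported in `U` and move the translation onto `φ`: the difference `φ (x - z) -
    -- φ x` is an integral of derivatives of the shifts `φ (x - t • z)`. These are supported in `C`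
    -- by convexity, so the weak gradient may be inserted for each `t`.
    refine hUo.ae_eq_zero_of_integral_contDiff_smul_eq_zero
      (iD.locallyIntegrable.locallyIntegrableOn U) fun φ hφ hc hs => ?_
    obtain ⟨B, hB⟩ := hc.exists_bound_of_continuous hφ.continuous
    set φ' : EuclideanSpace ℝ (Fin m) → ℝ := fun x => fderiv ℝ φ x z with hφ'
    have hφ'c : Continuous φ' := (hφ.continuous_fderiv (by simp)).clm_apply continuous_const
    have hφ's : HasCompactSupport φ' := hc.fderiv_apply ℝ z
    obtain ⟨B', hB'⟩ := hφ's.exists_bound_of_continuous hφ'c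
    have hshift : Continuous fun p : EuclideanSpace ℝ (Fin m) × ℝ => p.1 - p.2 • z := by fun_prop
    -- the weak form for the shifted test functions
    have hweak : ∀ t ∈ Set.Ioo (0 : ℝ) 1,
        ∫ x, v₀ x * φ' (x - t • z) = -∫ x, q (x + t • z) * φ x := by
      intro t ht
      have htest : IsTestFunction Ω fun x => φ (x - t • z) := by
        refine ⟨hφ.comp (contDiff_id.sub contDiff_const),
          hc.comp_homeomorph (Homeomorph.subRight (t • z)), fun x hx => hCΩ ?_⟩
        have h1 : x - t • z ∈ tsupport φ :=
          tsupport_comp_subset_preimage φ (f := fun x => x - t • z) (by fun_prop) hx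
        have h2 := hs h1
        have h3 := hC h2.1 h2.2 (by linarith [ht.2] : (0 : ℝ) ≤ 1 - t) ht.1.le (by ring)
        convert h3 using 1
        module
      have h1 := h.weak _ htest z
      have h2 : ∀ x, fderiv ℝ (fun x => φ (x - t • z)) x z = φ' (x - t • z) := by
        intro x
        rw [fderiv_comp_sub]
      simp only [h2] at h1
      have h3 : ∫ x, v₀ x * φ' (x - t • z) = ∫ x in Ω, v x * φ' (x - t • z) := by
        rw [← integral_indicator hm]
        congr 1; funext x
        by_cases hx : x ∈ Ω
        · simp [hv₀, Set.indicator_of_mem hx]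
        · simp [hv₀, Set.indicator_of_notMem hx]
      have h4 : ∫ x, q (x + t • z) * φ x = ∫ x in Ω, (inner ℝ (G x) z : ℝ) * φ (x - t • z) := by
        rw [← integral_indicator hm, ← integral_sub_right_eq_self _ (t • z)]
        congr 1; funext x
        rw [sub_add_cancel, hqi]
        by_cases hx : x ∈ Ω
        · simp [Set.indicator_of_mem hx]
        · simp [Set.indicator_of_notMem hx]
      rw [h3, h4, h1]
    have hline : ∀ x, φ (x - z) - φ x = -∫ t, φ' (x - t • z) ∂μ := by
      intro x
      have hd : ∀ t : ℝ, HasDerivAt (fun t : ℝ => φ (x - t • z)) (-φ' (x - t • z)) t := by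
        intro t
        have h1 : HasDerivAt (fun t : ℝ => x - t • z) (-z) t := by
          simpa using ((hasDerivAt_id t).smul_const z).const_sub x
        have h2 := (hφ.differentiable (by simp) (x - t • z)).hasFDerivAt.comp_hasDerivAt t h1
        rw [map_neg] at h2
        exact h2
      have hcont : Continuous fun t : ℝ => -φ' (x - t • z) := by fun_prop
      have h3 := intervalIntegral.integral_eq_sub_of_hasDerivAt (a := 0) (b := 1)
        (fun t _ => hd t) (hcont.intervalIntegrable _ _)
      rw [intervalIntegral.integral_of_le zero_le_one, integral_Ioc_eq_integral_Ioo,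
        integral_neg] at h3
      simp only [one_smul, zero_smul, sub_zero] at h3
      exact h3.symm
    have f1 : ∫ x, v₀ x * ∫ t, φ' (x - t • z) ∂μ = ∫ t, (∫ x, v₀ x * φ' (x - t • z)) ∂μ := by
      have i1 : Integrable (fun p : EuclideanSpace ℝ (Fin m) × ℝ => v₀ p.1 * φ' (p.1 - p.2 • z))
          (volume.prod μ) :=
        (iv.comp_fst μ).mul_bdd (c := B') (hφ'c.comp hshift).aestronglyMeasurable
          (Filter.Eventually.of_forall fun p => hB' _)
      simp only [← integral_const_mul]
      exact integral_integral_swap i1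
    have f2 : ∫ x, (∫ t, q (x + t • z) ∂μ) * φ x = ∫ t, (∫ x, q (x + t • z) * φ x) ∂μ := by
      have i1 : Integrable (fun p : EuclideanSpace ℝ (Fin m) × ℝ => q (p.1 + p.2 • z) * φ p.1)
          (volume.prod μ) :=
        iqs.mul_bdd (c := B) (hφ.continuous.comp continuous_fst).aestronglyMeasurable
          (Filter.Eventually.of_forall fun p => hB _)
      simp only [← integral_mul_const]
      exact integral_integral_swap i1
    have f3 : ∫ t, (∫ x, v₀ x * φ' (x - t • z)) ∂μ = -∫ t, (∫ x, q (x + t • z) * φ x) ∂μ := by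
      rw [← integral_neg]
      exact setIntegral_congr_fun measurableSet_Ioo hweak
    have j1 : Integrable fun x => v₀ (x + z) * φ x :=
      ivz.mul_bdd (c := B) hφ.continuous.aestronglyMeasurable (Filter.Eventually.of_forall hB)
    have j2 : Integrable fun x => v₀ x * φ x :=
      iv.mul_bdd (c := B) hφ.continuous.aestronglyMeasurable (Filter.Eventually.of_forall hB)
    have j3 : Integrable fun x => (∫ t, q (x + t • z) ∂μ) * φ x :=
      iqI.mul_bdd (c := B) hφ.continuous.aestronglyMeasurable (Filter.Eventually.of_forall hB)
    have j4 : Integrable fun x => v₀ x * φ (x - z) :=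
      iv.mul_bdd (c := B) (hφ.continuous.comp (by fun_prop)).aestronglyMeasurable
        (Filter.Eventually.of_forall fun x => hB _)
    have e1 : ∫ x, v₀ (x + z) * φ x = ∫ x, v₀ x * φ (x - z) := by
      rw [← integral_sub_right_eq_self _ z]
      simp only [sub_add_cancel]
    have e2 : ∫ x, φ x • D x = (∫ x, v₀ (x + z) * φ x) - (∫ x, v₀ x * φ x) -
        ∫ x, (∫ t, q (x + t • z) ∂μ) * φ x := by
      have j12 : Integrable fun x => v₀ (x + z) * φ x - v₀ x * φ x := j1.sub j2
      rw [← integral_sub j1 j2, ← integral_sub j12 j3]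
      congr 1; funext x
      simp only [hD, smul_eq_mul]; ring
    have e3 : (∫ x, v₀ x * φ (x - z)) - (∫ x, v₀ x * φ x) =
        -∫ x, v₀ x * ∫ t, φ' (x - t • z) ∂μ := by
      rw [← integral_sub j4 j2, ← integral_neg]
      congr 1; funext x
      rw [← mul_sub, hline]; ring
    rw [e2, e1, e3, f1, f2, f3]; ring
  filter_upwards [key] with x hx hxU
  have h1 := hx hxU
  simp only [hD, hv₀] at h1
  rw [Set.indicator_of_mem (hUΩ hxU), Set.indicator_of_mem (hCΩ hxU.2)] at h1
  exact sub_eq_zero.1 h1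

/-- Jensen's inequality is applied to the integral over the segment; after Tonelli, translation
invariance makes the inner integral independent of `t`. -/
theorem IsSobolevPair.lintegral_translate_le (h : IsSobolevPair Ω v G) (hΩ : IsOpen Ω)
    (hb : Bornology.IsBounded Ω) {C : Set (EuclideanSpace ℝ (Fin m))} (hC : Convex ℝ C)
    (ho : IsOpen C) (hCΩ : C ⊆ Ω) (z : EuclideanSpace ℝ (Fin m)) :
    ∫⁻ x in C ∩ (fun x => x + z) ⁻¹' C, ‖v (x + z) - v x‖ₑ ^ 2 ≤
      ‖z‖ₑ ^ 2 * ∫⁻ x in Ω, ‖G x‖ₑ ^ 2 := by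
  set G₀ := Ω.indicator G with hG₀
  have hG₀m : Measurable G₀ := h.measurable_grad.indicator hΩ.measurableSet
  have hU : MeasurableSet (C ∩ (fun x => x + z) ⁻¹' C) :=
    (ho.inter (ho.preimage (by fun_prop))).measurableSet
  set μ : Measure ℝ := volume.restrict (Set.Ioo (0 : ℝ) 1) with hμ
  have hprob : IsProbabilityMeasure μ := ⟨by simp [hμ]⟩
  have hmeas : Measurable fun p : EuclideanSpace ℝ (Fin m) × ℝ => ‖G₀ (p.1 + p.2 • z)‖ₑ ^ 2 := by
    have : Measurable fun p : EuclideanSpace ℝ (Fin m) × ℝ => p.1 + p.2 • z := by fun_prop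
    exact (hG₀m.comp this).enorm.pow_const 2
  calc ∫⁻ x in C ∩ (fun x => x + z) ⁻¹' C, ‖v (x + z) - v x‖ₑ ^ 2
      ≤ ∫⁻ x in C ∩ (fun x => x + z) ⁻¹' C, ‖z‖ₑ ^ 2 * ∫⁻ t, ‖G₀ (x + t • z)‖ₑ ^ 2 ∂μ := by
        refine lintegral_mono_ae ?_
        rw [ae_restrict_iff' hU]
        filter_upwards [h.ae_sub_eq_integral hΩ hb hC ho hCΩ z] with x hx hxU
        rw [hx hxU]
        have hGx : Measurable fun t : ℝ => G₀ (x + t • z) := hG₀m.comp (by fun_prop)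
        refine (enorm_integral_sq_le (hGx.inner measurable_const).aestronglyMeasurable).trans ?_
        rw [← lintegral_const_mul _ (hGx.enorm.pow_const 2)]
        refine lintegral_mono fun t => ?_
        rw [← mul_pow]
        gcongr
        rw [mul_comm]
        have := norm_inner_le_norm (𝕜 := ℝ) (G₀ (x + t • z)) z
        rw [← ofReal_norm, ← ofReal_norm, ← ofReal_norm,
          ← ENNReal.ofReal_mul (norm_nonneg _)]
        exact ENNReal.ofReal_le_ofReal this
    _ ≤ ∫⁻ x, ‖z‖ₑ ^ 2 * ∫⁻ t, ‖G₀ (x + t • z)‖ₑ ^ 2 ∂μ := setLIntegral_le_lintegral _ _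
    _ = ‖z‖ₑ ^ 2 * ∫⁻ x, ∫⁻ t, ‖G₀ (x + t • z)‖ₑ ^ 2 ∂μ :=
        lintegral_const_mul _ hmeas.lintegral_prod_right'
    _ = ‖z‖ₑ ^ 2 * ∫⁻ t, (∫⁻ x, ‖G₀ (x + t • z)‖ₑ ^ 2) ∂μ := by
        rw [lintegral_lintegral_swap hmeas.aemeasurable]
    _ = ‖z‖ₑ ^ 2 * ∫⁻ x in Ω, ‖G x‖ₑ ^ 2 := by
        congr 1
        have e : ∀ t : ℝ, ∫⁻ x, ‖G₀ (x + t • z)‖ₑ ^ 2 = ∫⁻ x in Ω, ‖G x‖ₑ ^ 2 := by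
          intro t
          rw [lintegral_add_right_eq_self (fun x => ‖G₀ x‖ₑ ^ 2) (t • z),
            ← lintegral_indicator hΩ.measurableSet]
          congr 1; funext x
          by_cases hx : x ∈ Ω
          · simp [hG₀, Set.indicator_of_mem hx]
          · simp [hG₀, Set.indicator_of_notMem hx]
        simp only [e, lintegral_const, measure_univ, mul_one]

/-- The Poincaré inequality on convex sets. -/
theorem exists_lintegral_sub_le_of_convex (hΩ : IsOpen Ω) (hb : Bornology.IsBounded Ω)
    {C : Set (EuclideanSpace ℝ (Fin m))} (hC : Convex ℝ C) (ho : IsOpen C) (hCΩ : C ⊆ Ω) :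
    ∃ c : ENNReal, c ≠ ⊤ ∧ ∀ v G, IsSobolevPair Ω v G →
      ∫⁻ x in C, ∫⁻ y in C, ‖v x - v y‖ₑ ^ 2 ≤ c * ∫⁻ x in Ω, ‖G x‖ₑ ^ 2 := by
  obtain ⟨R, hR0, hR⟩ := (hb.subset hCΩ).exists_pos_norm_le
  -- All differences `z = y - x` of points of `C` lie in `B`. The substitution `y = x + z` reduces
  -- the double integral to the translation estimate, integrated over `z ∈ B`.
  set B : Set (EuclideanSpace ℝ (Fin m)) := Metric.closedBall 0 (2 * R) with hB
  refine ⟨ENNReal.ofReal (2 * R) ^ 2 * volume B,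
    ENNReal.mul_ne_top (ENNReal.pow_ne_top ENNReal.ofReal_ne_top)
      measure_closedBall_lt_top.ne, fun v G h => ?_⟩
  have hCm := ho.measurableSet
  set N := ∫⁻ x in Ω, ‖G x‖ₑ ^ 2
  have hfm : Measurable fun p : EuclideanSpace ℝ (Fin m) × EuclideanSpace ℝ (Fin m) =>
      C.indicator (fun x => (C.indicator fun y => ‖v x - v y‖ₑ ^ 2) (x + p.2)) p.1 := by
    have h1 : (fun p : EuclideanSpace ℝ (Fin m) × EuclideanSpace ℝ (Fin m) =>
        C.indicator (fun x => (C.indicator fun y => ‖v x - v y‖ₑ ^ 2) (x + p.2)) p.1) =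
        (Prod.fst ⁻¹' C ∩ (fun p => p.1 + p.2) ⁻¹' C).indicator
          fun p => ‖v p.1 - v (p.1 + p.2)‖ₑ ^ 2 := by
      funext p
      by_cases h1 : p.1 ∈ C <;> by_cases h2 : p.1 + p.2 ∈ C <;> simp [Set.indicator, h1, h2]
    rw [h1]
    refine Measurable.indicator ?_ ((measurable_fst hCm).inter
      ((show Measurable fun p : EuclideanSpace ℝ (Fin m) × EuclideanSpace ℝ (Fin m) =>
        p.1 + p.2 by fun_prop) hCm))
    exact ((h.measurable.comp measurable_fst).sub
      (h.measurable.comp (measurable_fst.add measurable_snd))).enorm.pow_const 2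
  calc ∫⁻ x in C, ∫⁻ y in C, ‖v x - v y‖ₑ ^ 2
      = ∫⁻ x, ∫⁻ z, C.indicator (fun x => (C.indicator fun y => ‖v x - v y‖ₑ ^ 2) (x + z)) x := by
        rw [← lintegral_indicator hCm]
        congr 1; funext x
        by_cases hx : x ∈ C
        · simp only [Set.indicator_of_mem hx]
          rw [lintegral_add_left_eq_self (C.indicator fun y => ‖v x - v y‖ₑ ^ 2) x,
            lintegral_indicator hCm]
        · simp [Set.indicator_of_notMem hx]
    _ = ∫⁻ z, ∫⁻ x, C.indicator (fun x => (C.indicator fun y => ‖v x - v y‖ₑ ^ 2) (x + z)) x :=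
        lintegral_lintegral_swap hfm.aemeasurable
    _ = ∫⁻ z, ∫⁻ x in C ∩ (fun x => x + z) ⁻¹' C, ‖v (x + z) - v x‖ₑ ^ 2 := by
        congr 1; funext z
        rw [← lintegral_indicator (ho.inter (ho.preimage (by fun_prop))).measurableSet]
        congr 1; funext x
        by_cases h1 : x ∈ C <;> by_cases h2 : x + z ∈ C <;>
          simp [Set.indicator, h1, h2, enorm_sub_rev]
    _ ≤ ∫⁻ z, B.indicator (fun _ => ENNReal.ofReal (2 * R) ^ 2 * N) z := by
        refine lintegral_mono fun z => ?_
        by_cases hz : z ∈ B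
        · rw [Set.indicator_of_mem hz]
          refine (h.lintegral_translate_le hΩ hb hC ho hCΩ z).trans ?_
          gcongr
          rw [← ofReal_norm]
          exact ENNReal.ofReal_le_ofReal (by simpa [hB] using hz)
        · have : C ∩ (fun x => x + z) ⁻¹' C = ∅ := by
            rw [Set.eq_empty_iff_forall_notMem]
            rintro x ⟨h1, h2⟩
            apply hz
            rw [hB, mem_closedBall_zero_iff]
            calc ‖z‖ = ‖(x + z) - x‖ := by rw [add_sub_cancel_left]
              _ ≤ ‖x + z‖ + ‖x‖ := norm_sub_le _ _
              _ ≤ 2 * R := by linarith [hR _ h1, hR _ h2]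
          rw [this, Measure.restrict_empty, lintegral_zero_measure]
          exact zero_le
    _ = ENNReal.ofReal (2 * R) ^ 2 * volume B * N := by
        rw [lintegral_indicator Metric.isClosed_closedBall.measurableSet, setLIntegral_const]
        ring

end Translation

/-! ### Chaining of increments and the Poincaré inequality on `K` -/

theorem ENNReal.add_sq_le (a b : ENNReal) : (a + b) ^ 2 ≤ 2 * (a ^ 2 + b ^ 2) := by
  have := ENNReal.rpow_add_le_mul_rpow_add_rpow a b (p := 2) (by norm_num)
  norm_num at this
  exact_mod_cast this

namespace PolytopalDomain

variable {d n : ℕ} {K : PolytopalDomain d n}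

/-- The double integral over `A × B` of the squared increments of a Sobolev function is controlled
by its gradient. -/
def IncrementBound (K : PolytopalDomain d n) (A B : Set (EuclideanSpace ℝ (Fin d))) : Prop :=
  ∃ c : ENNReal, c ≠ ⊤ ∧ ∀ v G, IsSobolevPair K.carrier v G →
    ∫⁻ x in A, ∫⁻ y in B, ‖v x - v y‖ₑ ^ 2 ≤ c * ∫⁻ x in K.carrier, ‖G x‖ₑ ^ 2

theorem measurable_increment {v : EuclideanSpace ℝ (Fin d) → ℝ} (hv : Measurable v) :
    Measurable fun p : EuclideanSpace ℝ (Fin d) × EuclideanSpace ℝ (Fin d) =>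
      ‖v p.1 - v p.2‖ₑ ^ 2 :=
  ((hv.comp measurable_fst).sub (hv.comp measurable_snd)).enorm.pow_const 2

namespace IncrementBound

variable {A B C A' B' : Set (EuclideanSpace ℝ (Fin d))}

theorem symm (h : IncrementBound K A B) : IncrementBound K B A := by
  obtain ⟨c, hc, h⟩ := h
  refine ⟨c, hc, fun v G hv => ?_⟩
  rw [lintegral_lintegral_swap (measurable_increment hv.measurable).aemeasurable]
  simpa only [enorm_sub_rev] using h v G hv

theorem mono (h : IncrementBound K A B) (hA : A' ⊆ A) (hB : B' ⊆ B) : IncrementBound K A' B' := by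
  obtain ⟨c, hc, h⟩ := h
  refine ⟨c, hc, fun v G hv => le_trans ?_ (h v G hv)⟩
  exact (lintegral_mono fun x => lintegral_mono_set hB).trans (lintegral_mono_set hA)

/-- The inequality `|v x - v z|² ≤ 2 |v x - v y|² + 2 |v z - v y|²` is averaged over the
intermediate point `y ∈ B`, which requires `B` to have positive finite measure. -/
theorem trans (hAB : IncrementBound K A B) (hBC : IncrementBound K B C) (hA : volume A ≠ ⊤)
    (hC : volume C ≠ ⊤) (hB0 : volume B ≠ 0) (hB : volume B ≠ ⊤) : IncrementBound K A C := by
  obtain ⟨c, hc, hAB⟩ := hAB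
  obtain ⟨c', hc', hCB⟩ := hBC.symm
  refine ⟨(volume B)⁻¹ * (2 * volume C * c + 2 * volume A * c'),
    ENNReal.mul_ne_top (ENNReal.inv_ne_top.2 hB0) (ENNReal.add_ne_top.2
      ⟨ENNReal.mul_ne_top (ENNReal.mul_ne_top (by simp) hC) hc,
        ENNReal.mul_ne_top (ENNReal.mul_ne_top (by simp) hA) hc'⟩), fun v G hv => ?_⟩
  have hm := measurable_increment hv.measurable
  have hsec : ∀ x, Measurable fun y => ‖v x - v y‖ₑ ^ 2 := fun x => hm.comp measurable_prodMk_left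
  set F : EuclideanSpace ℝ (Fin d) → ENNReal := fun x => ∫⁻ y in B, ‖v x - v y‖ₑ ^ 2 with hF
  have hFm : Measurable F := hm.lintegral_prod_right'
  have hpt : ∀ x z, volume B * ‖v x - v z‖ₑ ^ 2 ≤ 2 * F x + 2 * F z := by
    intro x z
    have h1 : volume B * ‖v x - v z‖ₑ ^ 2 = ∫⁻ _ in B, ‖v x - v z‖ₑ ^ 2 := by
      rw [setLIntegral_const, mul_comm]
    rw [h1, hF, ← lintegral_const_mul _ (hsec x), ← lintegral_const_mul _ (hsec z),
      ← lintegral_add_left ((hsec x).const_mul 2)]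
    refine lintegral_mono fun y => ?_
    rw [← mul_add]
    have h2 : ‖v x - v z‖ₑ ≤ ‖v x - v y‖ₑ + ‖v z - v y‖ₑ := by
      rw [enorm_sub_rev (v z)]
      simpa using enorm_add_le (v x - v y) (v y - v z)
    exact (pow_le_pow_left' h2 2).trans (ENNReal.add_sq_le _ _)
  have h3 : volume B * ∫⁻ x in A, ∫⁻ z in C, ‖v x - v z‖ₑ ^ 2 ≤
      2 * volume C * (∫⁻ x in A, F x) + 2 * volume A * ∫⁻ z in C, F z := by
    rw [← lintegral_const_mul _ hm.lintegral_prod_right']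
    calc ∫⁻ x in A, volume B * ∫⁻ z in C, ‖v x - v z‖ₑ ^ 2
        ≤ ∫⁻ x in A, (2 * volume C * F x + 2 * ∫⁻ z in C, F z) := by
          refine lintegral_mono fun x => ?_
          rw [← lintegral_const_mul _ (hsec x)]
          refine (lintegral_mono fun z => hpt x z).trans ?_
          rw [lintegral_add_left measurable_const, setLIntegral_const,
            lintegral_const_mul _ hFm]
          exact le_of_eq (by ring)
      _ = _ := by
          rw [lintegral_add_right _ measurable_const, setLIntegral_const,
            lintegral_const_mul _ hFm]
          ring
  set N := ∫⁻ x in K.carrier, ‖G x‖ₑ ^ 2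
  calc ∫⁻ x in A, ∫⁻ z in C, ‖v x - v z‖ₑ ^ 2
      = (volume B)⁻¹ * (volume B * ∫⁻ x in A, ∫⁻ z in C, ‖v x - v z‖ₑ ^ 2) := by
        rw [← mul_assoc, ENNReal.inv_mul_cancel hB0 hB, one_mul]
    _ ≤ (volume B)⁻¹ * (2 * volume C * (c * N) + 2 * volume A * (c' * N)) := by
        gcongr
        refine h3.trans ?_
        gcongr
        · exact hAB v G hv
        · exact hCB v G hv
    _ = _ := by ring

theorem of_convex_of_inter {C C' : Set (EuclideanSpace ℝ (Fin d))} (hC : Convex ℝ C)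
    (hC' : Convex ℝ C') (ho : IsOpen C) (ho' : IsOpen C') (hK : C ⊆ K.carrier)
    (hK' : C' ⊆ K.carrier) (h : (C ∩ C').Nonempty) : IncrementBound K C C' := by
  have hfin : ∀ {S : Set (EuclideanSpace ℝ (Fin d))}, S ⊆ K.carrier → volume S ≠ ⊤ :=
    fun hS => (K.isBounded.subset hS).measure_lt_top.ne
  have h1 : IncrementBound K C C :=
    exists_lintegral_sub_le_of_convex K.isOpen K.isBounded hC ho hK
  have h2 : IncrementBound K C' C' :=
    exists_lintegral_sub_le_of_convex K.isOpen K.isBounded hC' ho' hK'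
  exact (h1.mono subset_rfl Set.inter_subset_left).trans (h2.mono Set.inter_subset_right subset_rfl)
    (hfin hK) (hfin hK') ((ho.inter ho').measure_pos _ h).ne'
    (hfin (Set.inter_subset_left.trans hK))

/-- Connectedness of `K` supplies a chain of balls from one set to the other. The relation between
`x` and `y` used in the induction quantifies over all convex open subsets of `K` around the two
points; this makes it symmetric, transitive through a ball about the middle point, and true for
nearby points. -/
theorem of_convex {C C' : Set (EuclideanSpace ℝ (Fin d))} (hC : Convex ℝ C)
    (hC' : Convex ℝ C') (ho : IsOpen C) (ho' : IsOpen C') (hK : C ⊆ K.carrier)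
    (hK' : C' ⊆ K.carrier) (h : C.Nonempty) (h' : C'.Nonempty) : IncrementBound K C C' := by
  have hfin : ∀ {S : Set (EuclideanSpace ℝ (Fin d))}, S ⊆ K.carrier → volume S ≠ ⊤ :=
    fun hS => (K.isBounded.subset hS).measure_lt_top.ne
  obtain ⟨x, hx⟩ := h
  obtain ⟨y, hy⟩ := h'
  have hball : ∀ z ∈ K.carrier, ∃ r > 0, Metric.ball z r ⊆ K.carrier :=
    fun z hz => Metric.isOpen_iff.1 K.isOpen z hz
  have key := K.isConnected.isPreconnected.induction₂
    (fun x y => ∀ C C', Convex ℝ C → Convex ℝ C' → IsOpen C → IsOpen C' → C ⊆ K.carrier →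
      C' ⊆ K.carrier → x ∈ C → y ∈ C' → IncrementBound K C C') ?_ ?_ ?_ (hK hx) (hK' hy)
  · exact key C C' hC hC' ho ho' hK hK' hx hy
  · intro x hx
    obtain ⟨r, hr, hrK⟩ := hball x hx
    filter_upwards [mem_nhdsWithin_of_mem_nhds (Metric.ball_mem_nhds x hr)]
    intro y hy C C' hC hC' ho ho' hK hK' hxC hyC
    exact (of_convex_of_inter hC (convex_ball x r) ho Metric.isOpen_ball hK hrK
      ⟨x, hxC, Metric.mem_ball_self hr⟩).trans
      (of_convex_of_inter (convex_ball x r) hC' Metric.isOpen_ball ho' hrK hK' ⟨y, hy, hyC⟩)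
      (hfin hK) (hfin hK') (Metric.measure_ball_pos _ _ hr).ne' (hfin hrK)
  · intro x y z _ hy _ hxy hyz C C' hC hC' ho ho' hK hK' hxC hzC
    obtain ⟨r, hr, hrK⟩ := hball y hy
    exact (hxy C _ hC (convex_ball y r) ho Metric.isOpen_ball hK hrK hxC
      (Metric.mem_ball_self hr)).trans
      (hyz _ C' (convex_ball y r) hC' Metric.isOpen_ball ho' hrK hK' (Metric.mem_ball_self hr) hzC)
      (hfin hK) (hfin hK') (Metric.measure_ball_pos _ _ hr).ne' (hfin hrK)
  · intro x y _ _ hxy C C' hC hC' ho ho' hK hK' hxC hyC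
    exact (hxy C' C hC' hC ho' ho hK' hK hyC hxC).symm

theorem iUnion {ι : Type*} [Fintype ι] {A : ι → Set (EuclideanSpace ℝ (Fin d))}
    (h : ∀ i, IncrementBound K (A i) B) : IncrementBound K (⋃ i, A i) B := by
  choose c hc h using h
  refine ⟨∑ i, c i, ENNReal.sum_ne_top.2 fun i _ => hc i, fun v G hv => ?_⟩
  refine (lintegral_iUnion_le _ _).trans ?_
  rw [tsum_fintype, Finset.sum_mul]
  exact Finset.sum_le_sum fun i _ => h i v G hv

end IncrementBound

/-- Up to the null set of the face planes, `K` is the union of the finitely many convex cells that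
it meets, and `of_convex` handles each pair of them. -/
theorem incrementBound_carrier (K : PolytopalDomain d n) :
    IncrementBound K K.carrier K.carrier := by
  set A : (Fin n → Bool) → Set (EuclideanSpace ℝ (Fin d)) := fun σ => K.cell σ ∩ K.carrier
  have h1 : ∀ σ τ, IncrementBound K (A σ) (A τ) := by
    intro σ τ
    rcases (A σ).eq_empty_or_nonempty with h | h
    · exact ⟨0, by simp, fun v G _ => by simp [h]⟩
    rcases (A τ).eq_empty_or_nonempty with h' | h'
    · exact ⟨0, by simp, fun v G _ => by simp [h']⟩
    exact (IncrementBound.of_convex (convex_cell σ) (convex_cell τ) (isOpen_cell σ)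
      (isOpen_cell τ) (cell_subset h) (cell_subset h') (h.mono Set.inter_subset_left)
      (h'.mono Set.inter_subset_left)).mono Set.inter_subset_left Set.inter_subset_left
  have h2 : IncrementBound K (⋃ σ, A σ) (⋃ σ, A σ) :=
    IncrementBound.iUnion fun σ => (IncrementBound.iUnion fun τ => h1 τ σ).symm
  have h3 : K.carrier ≤ᵐ[volume] ⋃ σ, A σ := by
    filter_upwards [ae_height_ne_zero (K := K)] with x hx hxK
    obtain ⟨σ, hσ⟩ := exists_mem_cell hx
    exact Set.mem_iUnion.2 ⟨σ, hσ, hxK⟩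
  obtain ⟨c, hc, h⟩ := h2
  exact ⟨c, hc, fun v G hv => le_trans ((lintegral_mono fun x => lintegral_mono_set' h3).trans
    (lintegral_mono_set' h3)) (h v G hv)⟩

end PolytopalDomain

theorem enorm_L2_sq {m : ℕ} {Ω : Set (EuclideanSpace ℝ (Fin m))} {F : Type} [NormedAddCommGroup F]
    (f : L2 Ω F) : ‖f‖ₑ ^ 2 = ∫⁻ x in Ω, ‖f x‖ₑ ^ 2 := by
  have := eLpNorm_nnreal_pow_eq_lintegral (f := f) (μ := volume.restrict Ω) (p := 2) (by norm_num)
  rw [Lp.enorm_def]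
  simpa using this

namespace PolytopalDomain

variable {d n : ℕ}

/-- The Poincaré inequality. -/
theorem exists_poincare (K : PolytopalDomain d n) {one : L2 K.carrier ℝ}
    (hone : one =ᵐ[volume.restrict K.carrier] 1) :
    ∃ C : ℝ, 0 ≤ C ∧ ∀ p : K.sobolev, ∃ r : ℝ, ‖p.1.fst - r • one‖ ≤ C * ‖p.1.snd‖ := by
  obtain ⟨c, hc, h⟩ := incrementBound_carrier K
  have hμ0 : volume K.carrier ≠ 0 := (K.isOpen.measure_pos _ K.isConnected.nonempty).ne'
  have hμ : volume K.carrier ≠ ⊤ := K.isBounded.measure_lt_top.ne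
  set μ := volume.restrict K.carrier with hμd
  have hfin : IsFiniteMeasure μ := ⟨by rw [hμd, Measure.restrict_apply_univ]; exact hμ.lt_top⟩
  have hne : NeZero μ := ⟨by rw [hμd, Ne, Measure.restrict_eq_zero]; exact hμ0⟩
  set e : ENNReal := (volume K.carrier)⁻¹ * c with he
  have het : e ≠ ⊤ := ENNReal.mul_ne_top (ENNReal.inv_ne_top.2 hμ0) hc
  refine ⟨√e.toReal, Real.sqrt_nonneg _, fun p => ⟨⨍ y, p.1.fst y ∂μ, ?_⟩⟩
  set v := p.1.fst
  set G := p.1.snd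
  set r := ⨍ y, v y ∂μ with hr
  have hv : Integrable v μ := (Lp.memLp v).integrable (by norm_num)
  have hsob := isSobolevPair_coe p.2
  -- As `r` is the mean of `v`, the difference `v x - r` is the mean of `v x - v y` over `y`, and
  -- Jensen's inequality applies.
  have hpt : ∀ x, ‖v x - r‖ₑ ^ 2 ≤ (volume K.carrier)⁻¹ * ∫⁻ y in K.carrier, ‖v x - v y‖ₑ ^ 2 := by
    intro x
    have e1 : v x - r = ∫ y, (v x - v y) ∂((μ Set.univ)⁻¹ • μ) := by
      rw [integral_sub (integrable_const _) (hv.smul_measure (by simpa [hμd] using hμ0))]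
      simp [hr, average]
    rw [e1]
    refine (enorm_integral_sq_le ?_).trans ?_
    · exact (measurable_const.sub hsob.measurable).aestronglyMeasurable
    · rw [lintegral_smul_measure, hμd, Measure.restrict_apply_univ, smul_eq_mul]
  have hbd : ‖v - r • one‖ₑ ^ 2 ≤ e * ‖G‖ₑ ^ 2 := by
    rw [enorm_L2_sq, enorm_L2_sq]
    calc ∫⁻ x in K.carrier, ‖(v - r • one : L2 K.carrier ℝ) x‖ₑ ^ 2
        = ∫⁻ x in K.carrier, ‖v x - r‖ₑ ^ 2 := by
          refine lintegral_congr_ae ?_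
          filter_upwards [Lp.coeFn_sub v (r • one), Lp.coeFn_smul r one, hone] with x h1 h2 h3
          rw [h1, Pi.sub_apply, h2, Pi.smul_apply, h3]; simp
      _ ≤ ∫⁻ x in K.carrier, (volume K.carrier)⁻¹ * ∫⁻ y in K.carrier, ‖v x - v y‖ₑ ^ 2 :=
          lintegral_mono fun x => hpt x
      _ = (volume K.carrier)⁻¹ * ∫⁻ x in K.carrier, ∫⁻ y in K.carrier, ‖v x - v y‖ₑ ^ 2 :=
          lintegral_const_mul _ (measurable_increment hsob.measurable).lintegral_prod_right'
      _ ≤ (volume K.carrier)⁻¹ * (c * ∫⁻ x in K.carrier, ‖G x‖ₑ ^ 2) := by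
          gcongr; exact h v G hsob
      _ = e * ∫⁻ x in K.carrier, ‖G x‖ₑ ^ 2 := by rw [he, mul_assoc]
  have hreal : ‖v - r • one‖ ^ 2 ≤ e.toReal * ‖G‖ ^ 2 := by
    have := ENNReal.toReal_mono (ENNReal.mul_ne_top het (by simp)) hbd
    simpa using this
  refine le_of_sq_le_sq ?_ (by positivity)
  rw [mul_pow, Real.sq_sqrt ENNReal.toReal_nonneg]
  exact hreal

end PolytopalDomain

/-! ### Polynomials and scaled monomials -/

section Polynomials

variable {m : ℕ} {ℓ : ℤ} {D U : Set (EuclideanSpace ℝ (Fin m))}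

theorem polyDegLE_eq_restrictSupport (m : ℕ) (ℓ : ℤ) :
    PolyDegLE m ℓ =
      (MvPolynomial.restrictSupport ℝ {s : Fin m →₀ ℕ | ((∑ j, s j : ℕ) : ℤ) ≤ ℓ} :
        Set (MvPolynomial (Fin m) ℝ)) := rfl

theorem prod_pow_mem_polyDegLE {f : Fin m → MvPolynomial (Fin m) ℝ}
    (hf : ∀ j, (f j).totalDegree ≤ 1) {s : Fin m → ℕ} (hs : ((∑ j, s j : ℕ) : ℤ) ≤ ℓ) :
    ∏ j, f j ^ s j ∈ PolyDegLE m ℓ := by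
  intro t ht
  have h1 := MvPolynomial.le_totalDegree ht
  rw [Finsupp.sum_fintype _ _ (fun _ => rfl)] at h1
  have h2 : (∏ j, f j ^ s j).totalDegree ≤ ∑ j, s j := by
    refine (MvPolynomial.totalDegree_finsetProd _ _).trans (Finset.sum_le_sum fun j _ => ?_)
    refine (MvPolynomial.totalDegree_pow _ _).trans ?_
    exact (Nat.mul_le_mul_left _ (hf j)).trans (mul_one _).le
  exact le_trans (by exact_mod_cast h1.trans h2) hs

theorem finite_multiIndexLE (m : ℕ) (ℓ : ℤ) : Finite (MultiIndexLE m ℓ) := by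
  refine Set.Finite.to_subtype (s := {s : Fin m → ℕ | ((∑ j, s j : ℕ) : ℤ) ≤ ℓ})
    ((Set.finite_Iic (fun _ => ℓ.toNat)).subset fun s hs j => ?_)
  have h1 : s j ≤ ∑ j, s j := Finset.single_le_sum (fun _ _ => Nat.zero_le _) (Finset.mem_univ j)
  have h2 : ((∑ j, s j : ℕ) : ℤ) ≤ ℓ := hs
  zify
  exact (le_trans (by exact_mod_cast h1) h2).trans (Int.self_le_toNat ℓ)

noncomputable instance (m : ℕ) (ℓ : ℤ) : Fintype (MultiIndexLE m ℓ) :=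
  have := finite_multiIndexLE m ℓ
  Fintype.ofFinite _

theorem continuous_scaledMonomial (D : Set (EuclideanSpace ℝ (Fin m))) (s : Fin m → ℕ) :
    Continuous (scaledMonomial D s) := by
  unfold scaledMonomial
  fun_prop

theorem scaledMonomial_zero (D : Set (EuclideanSpace ℝ (Fin m))) (x) :
    scaledMonomial D 0 x = 1 := by
  simp [scaledMonomial]

/-- Combinations of scaled monomials are polynomials. -/
theorem exists_polyDegLE_eval_eq (D : Set (EuclideanSpace ℝ (Fin m)))
    (c : MultiIndexLE m ℓ → ℝ) : ∃ p ∈ PolyDegLE m ℓ, ∀ x : EuclideanSpace ℝ (Fin m),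
      p.eval x = ∑ s, c s * scaledMonomial D s.1 x := by
  set f : Fin m → MvPolynomial (Fin m) ℝ := fun j => MvPolynomial.C (Metric.diam D)⁻¹ *
    (MvPolynomial.X j - MvPolynomial.C ((⨍ z in D, z) j)) with hf
  have hfd : ∀ j, (f j).totalDegree ≤ 1 := by
    intro j
    refine (MvPolynomial.totalDegree_mul _ _).trans ?_
    rw [MvPolynomial.totalDegree_C, zero_add]
    exact (MvPolynomial.totalDegree_sub_C_le _ _).trans (MvPolynomial.totalDegree_X _).le
  refine ⟨∑ s : MultiIndexLE m ℓ, c s • ∏ j, f j ^ s.1 j, ?_, fun x => ?_⟩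
  · rw [polyDegLE_eq_restrictSupport]
    exact Submodule.sum_mem _ fun s _ => Submodule.smul_mem _ _ (prod_pow_mem_polyDegLE hfd s.2)
  · rw [map_sum]
    refine Finset.sum_congr rfl fun s _ => ?_
    rw [MvPolynomial.smul_eval, map_prod]
    simp only [scaledMonomial, hf, map_pow, map_mul, map_sub, MvPolynomial.eval_C,
      MvPolynomial.eval_X, inv_mul_eq_div]

/-- Polynomials are combinations of scaled monomials. -/
theorem exists_eval_eq_sum_scaledMonomial (hD : Metric.diam D ≠ 0)
    {p : MvPolynomial (Fin m) ℝ} (hp : p ∈ PolyDegLE m ℓ) :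
    ∃ c : MultiIndexLE m ℓ → ℝ, ∀ x : EuclideanSpace ℝ (Fin m),
      p.eval x = ∑ s, c s * scaledMonomial D s.1 x := by
  set f : Fin m → MvPolynomial (Fin m) ℝ := fun j => MvPolynomial.C (Metric.diam D) *
    MvPolynomial.X j + MvPolynomial.C ((⨍ z in D, z) j) with hf
  have hfd : ∀ j, (f j).totalDegree ≤ 1 := by
    intro j
    refine (MvPolynomial.totalDegree_add _ _).trans (max_le ?_ ?_)
    · refine (MvPolynomial.totalDegree_mul _ _).trans ?_
      rw [MvPolynomial.totalDegree_C, zero_add]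
      exact (MvPolynomial.totalDegree_X _).le
    · simp
  -- The polynomial `p` in the scaled variable: `f j` expresses `x j` as diameter times scaled
  -- coordinate plus centre. Such an affine substitution does not raise the degree, and the
  -- coefficients of `q` are those sought.
  set q : MvPolynomial (Fin m) ℝ := ∑ s ∈ p.support, p.coeff s • ∏ j, f j ^ s j with hq
  have hqm : q ∈ PolyDegLE m ℓ := by
    rw [polyDegLE_eq_restrictSupport]
    exact Submodule.sum_mem _ fun s hs =>
      Submodule.smul_mem _ _ (prod_pow_mem_polyDegLE hfd (hp s hs))
  refine ⟨fun s => q.coeff (Finsupp.equivFunOnFinite.symm s.1), fun x => ?_⟩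
  set y : Fin m → ℝ := fun j => (x j - (⨍ z in D, z) j) / Metric.diam D with hy
  have h1 : p.eval x = q.eval y := by
    rw [hq, map_sum, MvPolynomial.eval_eq']
    refine Finset.sum_congr rfl fun s _ => ?_
    rw [MvPolynomial.smul_eval, map_prod]
    congr 1
    refine Finset.prod_congr rfl fun j _ => ?_
    simp only [hf, hy, map_pow, map_mul, map_add, MvPolynomial.eval_C, MvPolynomial.eval_X]
    congr 1
    field_simp
    ring
  rw [h1, MvPolynomial.eval_eq']
  set e : MultiIndexLE m ℓ → (Fin m →₀ ℕ) := fun s => Finsupp.equivFunOnFinite.symm s.1 with he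
  have hinj : Function.Injective e := fun s t hst =>
    Subtype.ext (Finsupp.equivFunOnFinite.symm.injective hst)
  have h2 : ∑ s : MultiIndexLE m ℓ, q.coeff (e s) * scaledMonomial D s.1 x =
      ∑ t ∈ Finset.univ.map ⟨e, hinj⟩, q.coeff t * ∏ i, y i ^ t i := by
    rw [Finset.sum_map]
    rfl
  rw [h2]
  refine Finset.sum_subset (fun t ht => ?_) fun t _ ht => ?_
  · exact Finset.mem_map.2 ⟨⟨t, hqm t ht⟩, Finset.mem_univ _, Finsupp.ext fun _ => rfl⟩
  · rw [MvPolynomial.notMem_support_iff.1 ht, zero_mul]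

/-- In the scaled variable the sum is a polynomial with coefficients `c` that vanishes on a nonempty
open set. Such a set contains a product of infinite sets, so the polynomial is zero. -/
theorem eq_zero_of_sum_scaledMonomial_eq_zero (hD : Metric.diam D ≠ 0) (hU : IsOpen U)
    (hne : U.Nonempty) {c : MultiIndexLE m ℓ → ℝ}
    (h : ∀ x ∈ U, ∑ s, c s * scaledMonomial D s.1 x = 0) : c = 0 := by
  classical
  set P : MvPolynomial (Fin m) ℝ := ∑ s : MultiIndexLE m ℓ,
    MvPolynomial.monomial (Finsupp.equivFunOnFinite.symm s.1) (c s) with hP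
  set a : EuclideanSpace ℝ (Fin m) := ⨍ z in D, z
  have heval : ∀ y : Fin m → ℝ, P.eval y =
      ∑ s, c s * scaledMonomial D s.1 (a + Metric.diam D • WithLp.toLp 2 y) := by
    intro y
    rw [hP, map_sum]
    refine Finset.sum_congr rfl fun s _ => ?_
    rw [MvPolynomial.eval_monomial, Finsupp.prod_fintype _ _ (fun _ => pow_zero _)]
    congr 1
    refine Finset.prod_congr rfl fun j _ => ?_
    congr 1
    simp [a, hD]
  have hP0 : P = 0 := by
    have hV : IsOpen {y : Fin m → ℝ | a + Metric.diam D • WithLp.toLp 2 y ∈ U} :=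
      hU.preimage (by fun_prop)
    obtain ⟨x, hx⟩ := hne
    have hxV : (WithLp.ofLp ((Metric.diam D)⁻¹ • (x - a)) : Fin m → ℝ) ∈
        {y : Fin m → ℝ | a + Metric.diam D • WithLp.toLp 2 y ∈ U} := by
      simp only [Set.mem_ofPred_eq, WithLp.toLp_ofLp, smul_inv_smul₀ hD, add_sub_cancel]
      exact hx
    obtain ⟨r, hr, hball⟩ := Metric.isOpen_iff.1 hV _ hxV
    refine MvPolynomial.funext_set
      (fun i => Metric.ball (WithLp.ofLp ((Metric.diam D)⁻¹ • (x - a)) i) r)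
      (fun i => infinite_of_mem_nhds _ (Metric.ball_mem_nhds _ hr)) fun y hy => ?_
    rw [map_zero, heval]
    refine h _ (hball ?_)
    rwa [ball_pi _ hr]
  funext s
  have h1 : P.coeff (Finsupp.equivFunOnFinite.symm s.1) = c s := by
    rw [hP, MvPolynomial.coeff_sum]
    simp only [MvPolynomial.coeff_monomial, EmbeddingLike.apply_eq_iff_eq]
    rw [Finset.sum_eq_single s]
    · simp
    · intro t _ hts
      rw [if_neg]
      exact fun h => hts (Subtype.ext h)
    · simp
  rw [← h1, hP0]; rfl

end Polynomials

/-! ### Abstract unisolvence in a Hilbert space -/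

section Unisolvence

variable {H X J : Type*} [NormedAddCommGroup H] [InnerProductSpace ℝ H]
  [NormedAddCommGroup X] [InnerProductSpace ℝ X]

/-- A quotient Poincaré inequality together with a functional detecting the kernel gives a norm
estimate. -/
theorem exists_norm_sq_le_of_poincare (S : H →L[ℝ] X) (ℓ : H →L[ℝ] ℝ) {o : H}
    (ho : ℓ o = 1) {C : ℝ} (hC : 0 ≤ C) (h : ∀ p, ∃ r : ℝ, ‖p - r • o‖ ≤ C * ‖S p‖) :
    ∃ α > 0, ∀ p, α * ‖p‖ ^ 2 ≤ ‖S p‖ ^ 2 + ℓ p ^ 2 := by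
  -- As `ℓ o = 1`, the number `r` equals `ℓ p - ℓ (p - r • o)`, so `|r| ≤ |ℓ p| + ‖ℓ‖ C ‖S p‖`.
  -- Inserted in `p = (p - r • o) + r • o`, this gives `‖p‖ ≤ A ‖S p‖ + B |ℓ p|`.
  set A := C + ‖o‖ * ‖ℓ‖ * C with hA
  set B := ‖o‖
  have hA0 : 0 ≤ A := by positivity
  have key : ∀ p, ‖p‖ ^ 2 ≤ (2 * A ^ 2 + 2 * B ^ 2 + 1) * (‖S p‖ ^ 2 + ℓ p ^ 2) := by
    intro p
    obtain ⟨r, hr⟩ := h p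
    have h1 : r = ℓ p - ℓ (p - r • o) := by rw [map_sub, map_smul, ho]; simp
    have h2 : |r| ≤ |ℓ p| + ‖ℓ‖ * (C * ‖S p‖) := by
      have := (ℓ.le_opNorm (p - r • o)).trans (mul_le_mul_of_nonneg_left hr (norm_nonneg _))
      rw [Real.norm_eq_abs] at this
      calc |r| = |ℓ p - ℓ (p - r • o)| := by rw [← h1]
        _ ≤ |ℓ p| + |ℓ (p - r • o)| := abs_sub _ _
        _ ≤ _ := by linarith
    have h3 : ‖p‖ ≤ A * ‖S p‖ + B * |ℓ p| := by
      calc ‖p‖ = ‖(p - r • o) + r • o‖ := by rw [sub_add_cancel]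
        _ ≤ ‖p - r • o‖ + |r| * ‖o‖ := (norm_add_le _ _).trans (by rw [norm_smul]; rfl)
        _ ≤ C * ‖S p‖ + (|ℓ p| + ‖ℓ‖ * (C * ‖S p‖)) * ‖o‖ := by gcongr
        _ = _ := by rw [hA]; ring
    have h4 : ‖p‖ ^ 2 ≤ (A * ‖S p‖ + B * |ℓ p|) ^ 2 := by gcongr
    rw [← sq_abs (ℓ p)]
    nlinarith [sq_nonneg (A * ‖S p‖ - B * |ℓ p|), mul_nonneg (sq_nonneg A) (sq_nonneg |ℓ p|),
      mul_nonneg (sq_nonneg B) (sq_nonneg ‖S p‖), sq_nonneg ‖S p‖, sq_nonneg |ℓ p|]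
  refine ⟨(2 * A ^ 2 + 2 * B ^ 2 + 1)⁻¹, by positivity, fun p => ?_⟩
  rw [inv_mul_le_iff₀ (by positivity)]
  exact key p

/-- The equation tested with `w = v` gives `‖S v‖² = 0`, and coercivity does the rest. -/
theorem eq_zero_of_inner_eq_sum [Fintype J] (S : H →L[ℝ] X) (D : J → H →L[ℝ] ℝ) {α : ℝ}
    (hα : 0 < α) (h : ∀ p, α * ‖p‖ ^ 2 ≤ ‖S p‖ ^ 2 + ∑ j, D j p ^ 2) {v : H} {c : J → ℝ}
    (hv : ∀ w, inner ℝ (S v) (S w) = ∑ j, c j * D j w) (hD : ∀ j, D j v = 0) : v = 0 := by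
  have h1 := hv v
  simp only [hD, mul_zero, Finset.sum_const_zero, real_inner_self_eq_norm_sq] at h1
  have h2 := h v
  simp only [hD, h1, ne_eq, OfNat.ofNat_ne_zero, not_false_eq_true, zero_pow,
    Finset.sum_const_zero, add_zero] at h2
  have h3 : ‖v‖ ^ 2 ≤ 0 := by
    by_contra h3
    push Not at h3
    nlinarith [mul_pos hα h3]
  simpa using h3

/-- Unisolvence of linearly independent functionals for the solutions of the variational problems
that they generate. -/
theorem exists_inner_eq_sum [CompleteSpace H] [Fintype J] (S : H →L[ℝ] X) (D : J → H →L[ℝ] ℝ) {α : ℝ}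
    (hα : 0 < α) (h : ∀ p, α * ‖p‖ ^ 2 ≤ ‖S p‖ ^ 2 + ∑ j, D j p ^ 2)
    (hind : ∀ c : J → ℝ, (∀ w, ∑ j, c j * D j w = 0) → c = 0) (a : J → ℝ) :
    ∃ v : H, (∃ c : J → ℝ, ∀ w, inner ℝ (S v) (S w) = ∑ j, c j * D j w) ∧ ∀ j, D j v = a j := by
  let I : X →L[ℝ] X →L[ℝ] ℝ :=
    (innerₗ X).mkContinuous₂ 1 fun x y => by simpa using norm_inner_le_norm (𝕜 := ℝ) x y
  let B : H →L[ℝ] H →L[ℝ] ℝ := I.bilinearComp S S + ∑ j, (D j).smulRight (D j)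
  have hB : ∀ v w, B v w = inner ℝ (S v) (S w) + ∑ j, D j v * D j w := by
    intro v w
    simp [B, I]
  have hcoer : IsCoercive B := by
    refine ⟨α, hα, fun u => ?_⟩
    rw [hB, real_inner_self_eq_norm_sq, mul_assoc, ← pow_two]
    simpa only [← pow_two] using h u
  -- By Lax–Milgram, `sol c` solves `B (sol c) w = ∑ c_j D_j w`. Without the penalty terms it solves
  -- the original problem with the coefficients `c_j - D_j (sol c)`.
  let T := hcoer.continuousLinearEquivOfBilin
  let sol : (J → ℝ) →ₗ[ℝ] H :=
    { toFun := fun c => T.symm (∑ j, c j • (InnerProductSpace.toDual ℝ H).symm (D j))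
      map_add' := fun c c' => by simp [add_smul, Finset.sum_add_distrib]
      map_smul' := fun r c => by simp [mul_smul, Finset.smul_sum] }
  have hsol : ∀ c w, inner ℝ (S (sol c)) (S w) + ∑ j, D j (sol c) * D j w = ∑ j, c j * D j w := by
    intro c w
    rw [← hB, ← hcoer.continuousLinearEquivOfBilin_apply]
    change inner ℝ (T (T.symm _)) w = _
    rw [ContinuousLinearEquiv.apply_symm_apply, sum_inner]
    simp [inner_smul_left]
  have hsol' : ∀ c w, inner ℝ (S (sol c)) (S w) = ∑ j, (c j - D j (sol c)) * D j w := by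
    intro c w
    simp only [sub_mul, Finset.sum_sub_distrib, ← hsol c w]; ring
  let Φ : (J → ℝ) →ₗ[ℝ] (J → ℝ) := (LinearMap.pi fun j => (D j : H →ₗ[ℝ] ℝ)) ∘ₗ sol
  -- If all moments of `sol c` vanish, then `sol c = 0` by the uniqueness argument. Its equation
  -- becomes `∑ c_j D_j = 0`, and independence gives `c = 0`.
  have hinj : Function.Injective Φ := by
    rw [← LinearMap.ker_eq_bot, LinearMap.ker_eq_bot']
    intro c hc
    have hDc : ∀ j, D j (sol c) = 0 := fun j => congrFun hc j
    have hz := eq_zero_of_inner_eq_sum S D hα h (hsol' c) hDc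
    refine hind c fun w => ?_
    rw [← hsol, hz]
    simp
  obtain ⟨c, hc⟩ := LinearMap.injective_iff_surjective.1 hinj a
  exact ⟨sol c, ⟨_, hsol' c⟩, fun j => congrFun hc j⟩

end Unisolvence

/-! ### Polynomial densities of moments -/

theorem diam_ne_zero_of_isOpen {m : ℕ} (hm : 1 ≤ m) {Ω : Set (EuclideanSpace ℝ (Fin m))}
    (ho : IsOpen Ω) (hb : Bornology.IsBounded Ω) (hne : Ω.Nonempty) : Metric.diam Ω ≠ 0 := by
  obtain ⟨x, hx⟩ := hne
  have : Nonempty (Fin m) := ⟨⟨0, hm⟩⟩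
  have : Nontrivial (EuclideanSpace ℝ (Fin m)) := inferInstance
  have := Module.punctured_nhds_neBot ℝ (EuclideanSpace ℝ (Fin m)) x
  exact (Metric.diam_pos (infinite_of_mem_nhds x (ho.mem_nhds hx)).nontrivial hb).ne'

theorem volume_real_ne_zero_of_isOpen {m : ℕ} {Ω : Set (EuclideanSpace ℝ (Fin m))}
    (ho : IsOpen Ω) (hb : Bornology.IsBounded Ω) (hne : Ω.Nonempty) : volume.real Ω ≠ 0 :=
  (ENNReal.toReal_pos (ho.measure_pos _ hne).ne' hb.measure_lt_top.ne).ne'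

/-- The function `∑ₛ aₛ |Ω|⁻¹ mₛ` that represents a combination of moments. -/
noncomputable def momentDensity {m : ℕ} {ℓ : ℤ} (Ω : Set (EuclideanSpace ℝ (Fin m)))
    (a : MultiIndexLE m ℓ → ℝ) (x : EuclideanSpace ℝ (Fin m)) : ℝ :=
  ∑ s, (a s * (volume.real Ω)⁻¹) * scaledMonomial Ω s.1 x

section MomentDensity

variable {m : ℕ} {ℓ : ℤ} {Ω : Set (EuclideanSpace ℝ (Fin m))}

theorem continuous_momentDensity (a : MultiIndexLE m ℓ → ℝ) : Continuous (momentDensity Ω a) :=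
  continuous_finsetSum _ fun _ _ => continuous_const.mul (continuous_scaledMonomial Ω _)

theorem sum_moment_eq_integral (ho : IsOpen Ω) (hb : Bornology.IsBounded Ω)
    (a : MultiIndexLE m ℓ → ℝ) (g : L2 Ω ℝ) :
    ∑ s, a s * ((volume.real Ω)⁻¹ * ∫ x in Ω, g x * scaledMonomial Ω s.1 x) =
      ∫ x in Ω, momentDensity Ω a x * g x := by
  simp only [momentDensity, Finset.sum_mul]
  rw [integral_finsetSum]
  · refine Finset.sum_congr rfl fun s _ => ?_
    rw [← mul_assoc, ← integral_const_mul]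
    congr 1; funext x; ring
  · intro s _
    have := (integrable_mul_of_isBounded hb ho.measurableSet (Lp.memLp g)
      (continuous_scaledMonomial Ω s.1)).const_mul (a s * (volume.real Ω)⁻¹)
    refine this.congr (Filter.Eventually.of_forall fun x => ?_)
    ring

theorem exists_polyDegLE_eval_eq_momentDensity (a : MultiIndexLE m ℓ → ℝ) :
    ∃ p ∈ PolyDegLE m ℓ, ∀ x : EuclideanSpace ℝ (Fin m), p.eval x = momentDensity Ω a x :=
  exists_polyDegLE_eval_eq Ω _

theorem exists_momentDensity_eq_eval (hm : 1 ≤ m) (ho : IsOpen Ω) (hb : Bornology.IsBounded Ω)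
    (hne : Ω.Nonempty) {p : MvPolynomial (Fin m) ℝ} (hp : p ∈ PolyDegLE m ℓ) :
    ∃ a : MultiIndexLE m ℓ → ℝ, ∀ x : EuclideanSpace ℝ (Fin m),
      p.eval x = momentDensity Ω a x := by
  obtain ⟨c, hc⟩ := exists_eval_eq_sum_scaledMonomial (diam_ne_zero_of_isOpen hm ho hb hne) hp
  refine ⟨fun s => c s * volume.real Ω, fun x => ?_⟩
  rw [hc, momentDensity]
  simp only [mul_inv_cancel_right₀ (volume_real_ne_zero_of_isOpen ho hb hne)]

theorem eq_zero_of_integral_momentDensity_eq_zero (hm : 1 ≤ m) (ho : IsOpen Ω)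
    (hb : Bornology.IsBounded Ω) (hne : Ω.Nonempty) {a : MultiIndexLE m ℓ → ℝ}
    (h : ∀ φ, IsTestFunction Ω φ → ∫ x in Ω, momentDensity Ω a x * φ x = 0) : a = 0 := by
  have h1 := L2.eq_zero_of_forall_testFunction ho hb
    (memLp_of_isBounded hb ho.measurableSet (continuous_momentDensity a)) h
  have h2 := Measure.eqOn_open_of_ae_eq h1 ho (continuous_momentDensity a).continuousOn
    continuousOn_const
  have h3 := eq_zero_of_sum_scaledMonomial_eq_zero (diam_ne_zero_of_isOpen hm ho hb hne) ho hne h2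
  funext s
  have h4 := congrFun h3 s
  simpa [volume_real_ne_zero_of_isOpen ho hb hne] using h4

end MomentDensity

/-! ### Degrees of freedom of the local space -/

namespace PolytopalDomain

variable {d n : ℕ} {K : PolytopalDomain d n} {k : ℕ}

theorem face_nonempty (i : Fin n) : (K.face i).Nonempty := (K.face_region i).isConnected.nonempty

/-- Without faces the boundary would be empty and `K` the whole space, which is unbounded.
Coercivity needs a face in order to detect constants. -/
theorem pos_of_one_le (hd : 1 ≤ d) (K : PolytopalDomain d n) : 0 < n := by
  rw [Nat.pos_iff_ne_zero]
  rintro rfl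
  have h1 : frontier K.carrier = ∅ := by rw [K.frontier_eq]; simp
  have h2 := (isClopen_iff_frontier_eq_empty.2 h1).eq_univ K.isConnected.nonempty
  have : Nonempty (Fin d) := ⟨⟨0, hd⟩⟩
  have : Nontrivial (EuclideanSpace ℝ (Fin d)) := inferInstance
  exact NormedSpace.unbounded_univ ℝ (EuclideanSpace ℝ (Fin d)) (h2 ▸ K.isBounded)

/-- The indices of the degrees of freedom: the moments on the faces and in the interior. -/
abbrev DofIndex (d n k : ℕ) : Type :=
  (Fin n × MultiIndexLE (d - 1) ((k : ℤ) - 1)) ⊕ MultiIndexLE d ((k : ℤ) - 2)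

variable (K k) in
/-- The degrees of freedom. -/
noncomputable def dof (v : L2 K.carrier ℝ) : DofIndex d n k → ℝ :=
  Sum.elim (fun j => K.faceMoment v j.1 j.2.1) fun s => K.cellMoment v s.1

theorem exists_clm_dof (hd : 2 ≤ d) (j : DofIndex d n k) :
    ∃ ℓ : K.sobolev →L[ℝ] ℝ, ∀ p : K.sobolev, ℓ p = K.dof k p.1.fst j := by
  rcases j with ⟨i, s⟩ | s
  · obtain ⟨ℓ, hℓ⟩ := exists_clm_trace (K := K) hd i (continuous_scaledMonomial (K.face i) s.1)
    refine ⟨(volume.real (K.face i))⁻¹ • ℓ, fun p => ?_⟩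
    simp [dof, faceMoment, hℓ]
  · obtain ⟨ℓ, hℓ⟩ := exists_clm_integral_mul (memLp_of_isBounded K.isBounded
      K.isOpen.measurableSet (continuous_scaledMonomial K.carrier s.1))
    refine ⟨(volume.real K.carrier)⁻¹ • (ℓ.comp ((WithLp.fstL 2 ℝ _ _).comp K.sobolev.subtypeL)),
      fun p => ?_⟩
    simp [dof, cellMoment, hℓ]

theorem sum_dof_eq (c : DofIndex d n k → ℝ) (v : L2 K.carrier ℝ) :
    ∑ j, c j * K.dof k v j =
      (∑ i, ∫ y in K.face i, momentDensity (K.face i) (fun s => c (Sum.inl (i, s))) y *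
        K.trace v i y) +
      ∫ x in K.carrier, momentDensity K.carrier (fun s => c (Sum.inr s)) x * v x := by
  rw [Fintype.sum_sum_type, Fintype.sum_prod_type]
  congr 1
  · refine Finset.sum_congr rfl fun i _ => ?_
    exact sum_moment_eq_integral (K.face_region i).isOpen (K.face_region i).isBounded
      (fun s => c (Sum.inl (i, s))) (K.trace v i)
  · exact sum_moment_eq_integral K.isOpen K.isBounded (fun s => c (Sum.inr s)) v

theorem sum_dof_smooth (hd : 2 ≤ d) (c : DofIndex d n k → ℝ) {w : EuclideanSpace ℝ (Fin d) → ℝ}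
    (hw : ContDiff ℝ ∞ w) : ∃ p : K.sobolev,
    p.1.snd =ᵐ[volume.restrict K.carrier] gradient w ∧
    p.1.fst =ᵐ[volume.restrict K.carrier] w ∧ ∑ j, c j * K.dof k p.1.fst j =
      (∑ i, ∫ y in K.face i, momentDensity (K.face i) (fun s => c (Sum.inl (i, s))) y *
        w (K.chart i y)) +
      ∫ x in K.carrier, momentDensity K.carrier (fun s => c (Sum.inr s)) x * w x := by
  obtain ⟨v, G, hG, hv, hGw, htr⟩ := exists_smooth_trace hd K hw
  refine ⟨⟨WithLp.toLp 2 (v, G), hG⟩, hGw, hv, (sum_dof_eq c v).trans ?_⟩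
  congr 1
  · refine Finset.sum_congr rfl fun i _ => integral_congr_ae ?_
    filter_upwards [htr i] with y hy
    rw [hy]
  · refine integral_congr_ae ?_
    filter_upwards [hv] with x hx
    rw [hx]

theorem eq_zero_of_chart {φ : EuclideanSpace ℝ (Fin d) → ℝ} (hφ : IsTestFunction K.carrier φ)
    {i : Fin n} {y : EuclideanSpace ℝ (Fin (d - 1))} (hy : y ∈ K.face i) :
    φ (K.chart i y) = 0 :=
  image_eq_zero_of_notMem_tsupport fun h =>
    K.notMem_carrier_of_mem_frontier (K.chart_mem_frontier (subset_closure hy)) (hφ.2.2 h)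

theorem sum_dof_testFunction (hd : 2 ≤ d) (c : DofIndex d n k → ℝ)
    {φ : EuclideanSpace ℝ (Fin d) → ℝ} (hφ : IsTestFunction K.carrier φ) : ∃ p : K.sobolev,
    p.1.snd =ᵐ[volume.restrict K.carrier] gradient φ ∧ ∑ j, c j * K.dof k p.1.fst j =
      ∫ x in K.carrier, momentDensity K.carrier (fun s => c (Sum.inr s)) x * φ x := by
  obtain ⟨p, hp, -, h⟩ := sum_dof_smooth (K := K) hd c hφ.1
  refine ⟨p, hp, h.trans ?_⟩
  rw [Finset.sum_eq_zero, zero_add]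
  intro i _
  rw [setIntegral_eq_zero_of_forall_eq_zero]
  intro y hy
  rw [eq_zero_of_chart hφ hy, mul_zero]

/-- Test functions in `K` have no trace and isolate the interior moments, whose density must vanish.
Extensions of test functions on one face then isolate the moments on that face. -/
theorem dof_linearIndependent (hd : 2 ≤ d) {c : DofIndex d n k → ℝ}
    (h : ∀ p : K.sobolev, ∑ j, c j * K.dof k p.1.fst j = 0) : c = 0 := by
  have hcell : (fun s => c (Sum.inr s)) = 0 := by
    refine eq_zero_of_integral_momentDensity_eq_zero (by omega) K.isOpen K.isBounded
      K.isConnected.nonempty fun φ hφ => ?_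
    obtain ⟨p, -, hp⟩ := sum_dof_testFunction hd c hφ
    rw [← hp, h]
  have hface : ∀ i, (fun s => c (Sum.inl (i, s))) = 0 := by
    intro i
    refine eq_zero_of_integral_momentDensity_eq_zero (by omega) (K.face_region i).isOpen
      (K.face_region i).isBounded (face_nonempty i) fun ψ hψ => ?_
    obtain ⟨φ, hφ, -, -, hφi, hφj⟩ := exists_extension (K := K) (by omega) i isOpen_univ hψ.1
      hψ.2.1 hψ.2.2 (fun _ _ => Set.mem_univ _)
    obtain ⟨p, -, -, hp⟩ := sum_dof_smooth (K := K) hd c hφ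
    rw [h, hcell, Finset.sum_eq_single i] at hp
    · simpa [momentDensity, hφi] using hp.symm
    · intro j _ hj
      rw [setIntegral_eq_zero_of_forall_eq_zero]
      intro y hy
      rw [hφj j hj y hy, mul_zero]
    · simp
  funext j
  rcases j with ⟨i, s⟩ | s
  · exact congrFun (hface i) s
  · exact congrFun hcell s

/-- The members of the local space are the solutions of the variational problems generated by the
degrees of freedom. -/
theorem mem_localSpace_iff (hd : 2 ≤ d) {v : L2 K.carrier ℝ} :
    v ∈ K.localSpace k ↔ ∃ p : K.sobolev, p.1.fst = v ∧ ∃ c : DofIndex d n k → ℝ,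
      ∀ q : K.sobolev, inner ℝ p.1.snd q.1.snd = ∑ j, c j * K.dof k q.1.fst j := by
  constructor
  -- The formula for the normal derivative, valid for all of `H¹(K)`, contains all that is needed.
  -- Moving `∫ Δv w` to the right-hand side gives the interior coefficients their minus sign.
  · rintro ⟨G, hG, q, hq, -, P, hP, hN⟩
    obtain ⟨b, hb⟩ := exists_momentDensity_eq_eval (by omega) K.isOpen K.isBounded
      K.isConnected.nonempty hq
    choose a ha using fun i => exists_momentDensity_eq_eval (by omega) (K.face_region i).isOpen
      (K.face_region i).isBounded (face_nonempty i) (hP i)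
    refine ⟨⟨WithLp.toLp 2 (v, G), hG⟩, rfl, Sum.elim (fun j => a j.1 j.2) fun s => -b s,
      fun w => ?_⟩
    rw [sum_dof_eq]
    have h1 := hN w.1.fst w.1.snd w.2
    simp only [ha, hb] at h1
    simp only [Sum.elim_inl, Sum.elim_inr]
    have h2 : ∀ x, momentDensity K.carrier (fun s => -b s) x = -momentDensity K.carrier b x := by
      intro x; simp [momentDensity]
    simp only [h2, neg_mul, integral_neg]
    rw [← h1, L2.inner_def]
    exact (add_neg_cancel_right _ _).symm
  · rintro ⟨p, rfl, c, hc⟩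
    obtain ⟨Q, hQ, hQe⟩ := exists_polyDegLE_eval_eq_momentDensity (Ω := K.carrier)
      (fun s => -c (Sum.inr s))
    choose P hP hPe using fun i => exists_polyDegLE_eval_eq_momentDensity (Ω := K.face i)
      (fun s => c (Sum.inl (i, s)))
    have h2 : ∀ x : EuclideanSpace ℝ (Fin d),
        Q.eval x = -momentDensity K.carrier (fun s => c (Sum.inr s)) x := by
      intro x; rw [hQe]; simp [momentDensity]
    refine ⟨p.1.snd, p.2, Q, hQ, fun φ hφ => ?_, P, hP, fun w H hw => ?_⟩
    -- Tested with functions supported in `K`, the variational identity loses its boundary terms and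
    -- becomes the distributional equation for the Laplacian.
    · obtain ⟨q, hqφ, hq⟩ := sum_dof_testFunction hd c hφ
      rw [← hc q, L2.inner_def] at hq
      simp only [h2, neg_mul, integral_neg, neg_neg]
      rw [← hq]
      refine integral_congr_ae ?_
      filter_upwards [hqφ] with x hx
      rw [hx]
    · have h1 := (hc ⟨WithLp.toLp 2 (w, H), hw⟩).trans (sum_dof_eq c w)
      rw [L2.inner_def] at h1
      simp only [h2, hPe, neg_mul, integral_neg]
      exact sub_eq_of_eq_add h1

/-- The Poincaré inequality controls `p` up to constants, and constants are detected by the zeroth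
moment on a face, which is one for the function `1`. This moment is among the degrees of freedom
because `k ≥ 1`. -/
theorem exists_coercive (hd : 2 ≤ d) (hk : 1 ≤ k) (K : PolytopalDomain d n) :
    ∃ α > 0, ∀ p : K.sobolev,
      α * ‖p‖ ^ 2 ≤ ‖p.1.snd‖ ^ 2 + ∑ j, K.dof k p.1.fst j ^ 2 := by
  obtain ⟨one, G, hG, hone, hG1, htr⟩ := exists_smooth_trace hd K (w := fun _ => (1 : ℝ))
    contDiff_const
  have hG0 : G = 0 := by
    refine Lp.ext ?_
    filter_upwards [hG1, Lp.coeFn_zero (EuclideanSpace ℝ (Fin d)) 2 (volume.restrict K.carrier)]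
      with x h1 h2
    rw [h1, h2]
    simp [gradient]
  subst hG0
  let o : K.sobolev := ⟨WithLp.toLp 2 (one, 0), hG⟩
  obtain ⟨C, hC, hP⟩ := exists_poincare K hone
  let i₀ : Fin n := ⟨0, pos_of_one_le (by omega) K⟩
  let j₀ : DofIndex d n k := Sum.inl (i₀, ⟨0, by simp; omega⟩)
  obtain ⟨ℓ, hℓ⟩ := exists_clm_dof (K := K) hd j₀
  have hℓo : ℓ o = 1 := by
    rw [hℓ]
    change (volume.real (K.face i₀))⁻¹ * ∫ y in K.face i₀, K.trace one i₀ y *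
      scaledMonomial (K.face i₀) 0 y = 1
    have h1 : ∫ y in K.face i₀, K.trace one i₀ y * scaledMonomial (K.face i₀) 0 y =
        ∫ _ in K.face i₀, (1 : ℝ) := by
      refine integral_congr_ae ?_
      filter_upwards [htr i₀] with y hy
      rw [hy, scaledMonomial_zero, one_mul]
    rw [h1]
    simp only [integral_const, smul_eq_mul, mul_one, measureReal_restrict_apply_univ]
    exact inv_mul_cancel₀ (volume_real_ne_zero_of_isOpen (K.face_region i₀).isOpen
      (K.face_region i₀).isBounded (face_nonempty i₀))
  let S : K.sobolev →L[ℝ] L2 K.carrier (EuclideanSpace ℝ (Fin d)) :=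
    (WithLp.sndL 2 ℝ _ _).comp K.sobolev.subtypeL
  -- The norm of `H¹(K)` contains the gradient as well, and `C ^ 2 + 1 ≤ (C + 1) ^ 2`.
  obtain ⟨α, hα, h⟩ := exists_norm_sq_le_of_poincare S ℓ hℓo (C := C + 1) (by positivity)
    fun p => by
      obtain ⟨r, hr⟩ := hP p
      refine ⟨r, ?_⟩
      have h1 : ‖p - r • o‖ ^ 2 = ‖p.1.fst - r • one‖ ^ 2 + ‖p.1.snd‖ ^ 2 := by
        change ‖(p - r • o).1‖ ^ 2 = _
        rw [WithLp.prod_norm_sq_eq_of_L2]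
        simp [o]
      refine le_of_sq_le_sq ?_ (by positivity)
      rw [h1]
      have h2 : ‖p.1.fst - r • one‖ ^ 2 ≤ (C * ‖p.1.snd‖) ^ 2 := by gcongr
      have h3 : S p = p.1.snd := rfl
      rw [h3]
      nlinarith [mul_nonneg hC (sq_nonneg ‖p.1.snd‖)]
  refine ⟨α, hα, fun p => (h p).trans ?_⟩
  have h4 : ℓ p ^ 2 ≤ ∑ j, K.dof k p.1.fst j ^ 2 := by
    rw [hℓ]
    exact Finset.single_le_sum (f := fun j => K.dof k p.1.fst j ^ 2) (fun _ _ => sq_nonneg _)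
      (Finset.mem_univ j₀)
  exact add_le_add le_rfl h4

/-- Unisolvence of the degrees of freedom on the local space. -/
theorem existsUnique_dof_eq (hd : 2 ≤ d) (hk : 1 ≤ k) (K : PolytopalDomain d n)
    (a : DofIndex d n k → ℝ) : ∃! v, v ∈ K.localSpace k ∧ K.dof k v = a := by
  obtain ⟨α, hα, hcoer⟩ := exists_coercive hd hk K
  choose D hD using exists_clm_dof (K := K) (k := k) hd
  let S : K.sobolev →L[ℝ] L2 K.carrier (EuclideanSpace ℝ (Fin d)) :=
    (WithLp.sndL 2 ℝ _ _).comp K.sobolev.subtypeL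
  have hcoer' : ∀ p, α * ‖p‖ ^ 2 ≤ ‖S p‖ ^ 2 + ∑ j, D j p ^ 2 := by
    intro p
    simp only [hD]
    exact hcoer p
  obtain ⟨p, ⟨c, hc⟩, hpa⟩ := exists_inner_eq_sum S D hα hcoer'
    (fun c h => dof_linearIndependent (K := K) hd fun p => by simpa only [hD] using h p) a
  refine ⟨p.1.fst, ⟨(mem_localSpace_iff hd).2 ⟨p, rfl, c, fun q => ?_⟩, ?_⟩, ?_⟩
  · simp only [← hD]
    exact hc q
  · funext j
    rw [← hD, hpa]
  · rintro v ⟨hv, hva⟩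
    obtain ⟨q, rfl, c', hc'⟩ := (mem_localSpace_iff hd).1 hv
    have h1 : q - p = 0 := by
      -- The difference of two solutions solves the variational problem with the difference of the
      -- coefficients, and all its moments vanish.
      refine eq_zero_of_inner_eq_sum S D hα hcoer' (c := c' - c) (fun w => ?_) fun j => ?_
      · rw [map_sub, inner_sub_left, hc w]
        have := hc' w
        simp only [← hD] at this
        change inner ℝ q.1.snd w.1.snd - _ = _
        rw [this, ← Finset.sum_sub_distrib]
        simp [sub_mul]
      · rw [map_sub, hD, hva, hpa, sub_self]
    rw [sub_eq_zero.1 h1]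

theorem dof_zero (hd : 2 ≤ d) : K.dof k 0 = 0 := by
  funext j
  obtain ⟨ℓ, hℓ⟩ := exists_clm_dof (K := K) hd j
  have := hℓ 0
  rw [map_zero] at this
  exact this.symm

theorem zero_mem_localSpace (hd : 2 ≤ d) : (0 : L2 K.carrier ℝ) ∈ K.localSpace k :=
  (mem_localSpace_iff hd).2 ⟨0, rfl, 0, fun q => by simp⟩

end PolytopalDomain

theorem mainTheorem3 (d n k : ℕ) (hd : d = 2 ∨ d = 3) (hk : 1 ≤ k) (K : PolytopalDomain d n) :
    (∀ v ∈ K.localSpace k,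
      (∀ (i : Fin n) (s : MultiIndexLE (d - 1) ((k : ℤ) - 1)), K.faceMoment v i s.1 = 0) →
      (∀ s : MultiIndexLE d ((k : ℤ) - 2), K.cellMoment v s.1 = 0) → v = 0) ∧
    (∀ (a : Fin n → MultiIndexLE (d - 1) ((k : ℤ) - 1) → ℝ)
        (b : MultiIndexLE d ((k : ℤ) - 2) → ℝ),
      ∃! v, v ∈ K.localSpace k ∧
        (∀ (i : Fin n) (s : MultiIndexLE (d - 1) ((k : ℤ) - 1)),
          K.faceMoment v i s.1 = a i s) ∧
        (∀ s : MultiIndexLE d ((k : ℤ) - 2), K.cellMoment v s.1 = b s)) := by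
  have hd2 : 2 ≤ d := by omega
  have hdof : ∀ (v : L2 K.carrier ℝ) (a : Fin n → MultiIndexLE (d - 1) ((k : ℤ) - 1) → ℝ)
      (b : MultiIndexLE d ((k : ℤ) - 2) → ℝ),
      K.dof k v = Sum.elim (fun j => a j.1 j.2) b ↔
        (∀ i s, K.faceMoment v i s.1 = a i s) ∧ ∀ s, K.cellMoment v s.1 = b s := by
    intro v a b
    simp only [funext_iff, Sum.forall, Prod.forall, PolytopalDomain.dof, Sum.elim_inl,
      Sum.elim_inr]
  refine ⟨fun v hv h1 h2 => ?_, fun a b => ?_⟩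
  · refine (K.existsUnique_dof_eq hd2 hk 0).unique ⟨hv, ?_⟩
      ⟨PolytopalDomain.zero_mem_localSpace hd2, PolytopalDomain.dof_zero hd2⟩
    have := (hdof v 0 0).2 ⟨h1, h2⟩
    rw [this]
    funext j
    rcases j with j | j <;> rfl
  · simp only [← hdof]
    exact PolytopalDomain.existsUnique_dof_eq hd2 hk K _
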